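/- Let $A=[a_1,\dots,a_d]\in\mathbb{R}^{n\times d}$ have rank $t$, and let $\lambda_1\ge\dots\ge\lambda_t>0$ be the $t$ largest eigenvalues of $A^{\mathrm T}A$. Assume $\lambda_t<\lambda_1$ and put $$\alpha^{-1}=\frac1t\sum_{i=1}^t\lambda_i^{-1},\qquad \beta=\frac{\lambda_t^{-1}-\alpha^{-1}}{\lambda_t^{-1}-\lambda_1^{-1}},\qquad \gamma_{A,k}=\Bigl(\sqrt{\tfrac kt}-\sqrt{\tfrac{\beta}{1-\beta}\bigl(1-\tfrac kt\bigr)}\Bigr)^2 .$$ Let $k$ be an integer with $\beta t\le k<t$ and let $\varepsilon>0$. For $S\subset[d]$ let $A_S$ be the submatrix of the columns of $A$ indexed by $S$, let $A_S^\dagger$ be its Moore–Penrose pseudoinverse, $R_S=A-A_SA_S^\dagger A$, and for $|S|\le k$ $$\widehat p_S(x)=(x^2\partial_x-d\,x)^{k-|S|}\det[x I_d-R_S^{\mathrm T}R_S].$$ The greedy algorithm, on the input $(A,k,\varepsilon)$, starts with $S=\emptyset$. In iteration $l=1,\dots,k$ it computes, for every $i\in[d]\setminus S$, a real number $\mu_{l,i}$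 that differs by at most $\varepsilon$ from the largest root of $\widehat p_{S\cup\{i\}}$, chooses $j_l\in[d]\setminus S$ that minimizes $\mu_{l,i}$ over $i\in[d]\setminus S$, and replaces $S$ by $S\cup\{j_l\}$. It outputs $S=\{j_1,\dots,j_k\}$. (1) Whatever $\varepsilon$-approximations are used and however ties are broken, the output satisfies $|S|=k$ and $$\|A-A_SA_S^\dagger A\|_2^2\;\le\;2k\varepsilon+\frac{\|A\|_2^2}{1+(\|A\|_2^2\,\alpha^{-1}-1)\,\gamma_{A,k}} .$$ (2) Let $w>2$ be any real number such that two real $m\times m$ matrices can be multiplied in time $O(m^w)$. Then the algorithm can be executed by a single deterministic program that, on every such input, computes $j_1,\dots,j_k$ and all the $\mu_{l,i}$ in time $$O\bigl(kdn^2+kd^{\,w+1}\log(d\vee\|A\|_2^2\,\varepsilon^{-1})\bigr)\ \text{ if } d<n,\qquad O\bigl(kdn^{w}\log(n\vee\|A\|_2^2\,\varepsilon^{-1})\bigr)\ \text{ if } d\ge n,$$ where $a\vee b=\max\{a,b\}$ and the implied constants do not depend on $n,d,k,A,\varepsilon$. In particular, for $\|A\|_2\le1$ the logarithms may be replaced by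 $\log(d\vee\varepsilon^{-1})$ and $\log(n\vee\varepsilon^{-1})$. Time is the number of steps on a real RAM: a program over finitely many arrays of natural numbers and of real numbers, in which exact $+,-,\times,\div$ and comparisons of reals, $+,-$ and comparisons of naturals (which serve as addresses and may be converted into reals), memory accesses and instructions cost one unit each; cells that do not hold the input contain arbitrary values at the start. -/

import Mathlib

open Matrix Polynomial

namespace ColSubset

/-! ### Linear algebra -/

section LinearAlgebra

noncomputable section

open scoped Matrix.Norms.L2Operator in
/-- The spectral norm `‖A‖₂`: the operator norm of `A` between Euclidean spaces. -/
def specNorm {m n : Type*} [Fintype m] [Fintype n] [DecidableEq n] (A : Matrix m n ℝ) : ℝ := ‖A‖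

/-- The Moore-Penrose pseudoinverse, `A† = V D Vᵀ Aᵀ`, where `AᵀA = V diag(λ) Vᵀ` is an orthogonal
diagonalization and `D = diag(λ⁻¹)` with the convention `0⁻¹ = 0`. The four Penrose equations, which
characterize it, are proved in `isMoorePenrose_pinv`. -/
def pinv {m n : Type*} [Fintype m] [Fintype n] [DecidableEq n] (A : Matrix m n ℝ) :
    Matrix n m ℝ :=
  let h : (Aᴴ * A).IsHermitian := isHermitian_conjTranspose_mul_self A
  (h.eigenvectorUnitary : Matrix n n ℝ) * diagonal (fun i => (h.eigenvalues i)⁻¹) *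
    (h.eigenvectorUnitary : Matrix n n ℝ)ᵀ * Aᵀ

/-- The four Penrose equations. -/
structure IsMoorePenrose {m n : Type*} [Fintype m] [Fintype n]
    (A : Matrix m n ℝ) (X : Matrix n m ℝ) : Prop where
  mul_mul_left : A * X * A = A
  mul_mul_right : X * A * X = X
  symm_left : (A * X)ᵀ = A * X
  symm_right : (X * A)ᵀ = X * A

/-- `i ↦ λ_{i+1}`: the eigenvalues of `AᵀA` in non-increasing order, with multiplicity, numbered
from `0` (and `0` beyond the last one). -/
def lam {n d : ℕ} (A : Matrix (Fin n) (Fin d) ℝ) (i : ℕ) : ℝ :=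
  if h : i < Fintype.card (Fin d) then
    (isHermitian_conjTranspose_mul_self A).eigenvalues₀ ⟨i, h⟩
  else 0

/-- The largest eigenvalue `λ₁` of `AᵀA`. -/
def lamFirst {n d : ℕ} (A : Matrix (Fin n) (Fin d) ℝ) : ℝ := lam A 0

/-- The `t`-th largest eigenvalue `λ_t` of `AᵀA`, where `t = rank A`. -/
def lamLast {n d : ℕ} (A : Matrix (Fin n) (Fin d) ℝ) : ℝ := lam A (A.rank - 1)

/-- `α⁻¹ = (1/t) ∑_{i=1}^t λ_i⁻¹`. -/
def alphaInv {n d : ℕ} (A : Matrix (Fin n) (Fin d) ℝ) : ℝ :=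
  1 / (A.rank : ℝ) * ∑ i ∈ Finset.range A.rank, (lam A i)⁻¹

/-- `β = (λ_t⁻¹ - α⁻¹) / (λ_t⁻¹ - λ₁⁻¹)`. -/
def beta {n d : ℕ} (A : Matrix (Fin n) (Fin d) ℝ) : ℝ :=
  ((lamLast A)⁻¹ - alphaInv A) / ((lamLast A)⁻¹ - (lamFirst A)⁻¹)

/-- `γ_{A,k} = (√(k/t) - √(β/(1-β) · (1 - k/t)))²`. -/
def gamma {n d : ℕ} (A : Matrix (Fin n) (Fin d) ℝ) (k : ℕ) : ℝ :=
  (Real.sqrt ((k : ℝ) / A.rank) -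
    Real.sqrt (beta A / (1 - beta A) * (1 - (k : ℝ) / A.rank))) ^ 2

/-- The submatrix `A_S` of the columns of `A` indexed by `S`. -/
def cols {n d : ℕ} (A : Matrix (Fin n) (Fin d) ℝ) (S : Finset (Fin d)) :
    Matrix (Fin n) S ℝ :=
  A.submatrix id Subtype.val

/-- The residual matrix `A - A_S A_S† A`. -/
def residual {n d : ℕ} (A : Matrix (Fin n) (Fin d) ℝ) (S : Finset (Fin d)) :
    Matrix (Fin n) (Fin d) ℝ :=
  A - cols A S * pinv (cols A S) * A

/-- `p_S(x) = det[x I_d - (A - A_S A_S† A)ᵀ (A - A_S A_S† A)]`. -/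
def pPoly {n d : ℕ} (A : Matrix (Fin n) (Fin d) ℝ) (S : Finset (Fin d)) : ℝ[X] :=
  ((residual A S)ᵀ * residual A S).charpoly

/-- The differential operator `x² ∂ₓ - d x`. -/
def polarOp (d : ℕ) (p : ℝ[X]) : ℝ[X] := X ^ 2 * derivative p - C (d : ℝ) * X * p

/-- `p̂_S = (x² ∂ₓ - d x)^(k - |S|) p_S`; it is only used for `|S| ≤ k`. -/
def pHat {n d : ℕ} (A : Matrix (Fin n) (Fin d) ℝ) (k : ℕ) (S : Finset (Fin d)) : ℝ[X] :=
  (polarOp d)^[k - S.card] (pPoly A S)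

/-- `x` is an `ε`-approximation of the largest real root of `p` (which has to exist). -/
def IsApproxMaxRoot (p : ℝ[X]) (ε x : ℝ) : Prop :=
  ∃ r : ℝ, IsGreatest {y : ℝ | p.IsRoot y} r ∧ |x - r| ≤ ε

/-- The set `{j_1, …, j_{l-1}}` of the indices chosen before iteration `l`. -/
def chosenBefore {d k : ℕ} (j : Fin k → Fin d) (l : Fin k) : Finset (Fin d) :=
  (Finset.univ.filter (fun m : Fin k => m < l)).image j

/-- `j` (the columns chosen, in order) and `μ` (the approximations computed) record a possible run
of the greedy algorithm on the input `A`, `k`, `ε`: in iteration `l`, with `S` the set of the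
columns chosen so far, `μ l i` is, for every `i ∉ S`, an `ε`-approximation of the largest root of
`p̂_{S ∪ {i}}`, and `j l` minimizes `μ l i` over all `i ∉ S`. Which approximations are obtained and
how ties are broken is left open. The output of the run is the set of all values of `j`. -/
structure IsGreedyRun {n d : ℕ} (A : Matrix (Fin n) (Fin d) ℝ) (k : ℕ) (ε : ℝ)
    (j : Fin k → Fin d) (μ : Fin k → Fin d → ℝ) : Prop where
  approx : ∀ l : Fin k, ∀ i : Fin d, i ∉ chosenBefore j l →
    IsApproxMaxRoot (pHat A k (insert i (chosenBefore j l))) ε (μ l i)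
  choice_new : ∀ l : Fin k, j l ∉ chosenBefore j l
  choice_min : ∀ l : Fin k, ∀ i : Fin d, i ∉ chosenBefore j l → μ l (j l) ≤ μ l i

end

theorem isMoorePenrose_pinv {m n : Type*} [Fintype m] [Fintype n] [DecidableEq n]
    (A : Matrix m n ℝ) : IsMoorePenrose A (pinv A) := by
  have h : (Aᴴ * A).IsHermitian := isHermitian_conjTranspose_mul_self A
  set U : Matrix n n ℝ := (h.eigenvectorUnitary : Matrix n n ℝ) with hU
  have hX : pinv A = U * diagonal (fun i => (h.eigenvalues i)⁻¹) * Uᵀ * Aᵀ := rfl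
  have hUU : Uᵀ * U = 1 := by
    have := Unitary.coe_star_mul_self h.eigenvectorUnitary
    rwa [star_eq_conjTranspose, conjTranspose_eq_transpose_of_trivial] at this
  have hG : Aᵀ * A = U * diagonal h.eigenvalues * Uᵀ := by
    have := h.spectral_theorem
    rw [Unitary.conjStarAlgAut_apply] at this
    exact this
  generalize h.eigenvalues = e at hX hG
  set H : Matrix n n ℝ := U * diagonal (fun i => (e i)⁻¹) * Uᵀ with hH
  have hHt : Hᵀ = H := by simp [hH, Matrix.mul_assoc]
  have hmul : ∀ v v' : n → ℝ, U * diagonal v * Uᵀ * (U * diagonal v' * Uᵀ)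
      = U * diagonal (fun i => v i * v' i) * Uᵀ := by
    intro v v'
    calc U * diagonal v * Uᵀ * (U * diagonal v' * Uᵀ)
        = U * (diagonal v * (Uᵀ * U) * diagonal v') * Uᵀ := by simp only [Matrix.mul_assoc]
      _ = _ := by rw [hUU, Matrix.mul_one, diagonal_mul_diagonal]
  have hHG : H * (Aᵀ * A) =
      U * diagonal (fun i => (e i)⁻¹ * e i) * Uᵀ := by
    rw [hG, hH, hmul]
  have hGHG : Aᵀ * A * (H * (Aᵀ * A)) = Aᵀ * A := by
    rw [hHG, hG, hmul]
    congr 3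
    funext i
    by_cases hi : e i = 0 <;> simp [hi]
  have hHGH : H * (Aᵀ * A) * H = H := by
    rw [hHG, hH, hmul]
    congr 3
    funext i
    by_cases hi : e i = 0 <;> simp [hi]
  have hAX : A * (H * (Aᵀ * A)) = A := by
    have h0 : (A * (H * (Aᵀ * A)) - A)ᴴ * (A * (H * (Aᵀ * A)) - A) = 0 := by
      have h1 : Aᵀ * (A * (H * (Aᵀ * A)) - A) = 0 := by
        rw [Matrix.mul_sub, ← Matrix.mul_assoc, hGHG, sub_self]
      have h2 : A * (H * (Aᵀ * A)) - A = A * (H * (Aᵀ * A) - 1) := by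
        rw [Matrix.mul_sub, Matrix.mul_one]
      rw [conjTranspose_eq_transpose_of_trivial]
      nth_rewrite 1 [h2]
      rw [transpose_mul, Matrix.mul_assoc, h1, Matrix.mul_zero]
    exact sub_eq_zero.mp (conjTranspose_mul_self_eq_zero.mp h0)
  rw [hX]
  refine ⟨?_, ?_, ?_, ?_⟩
  · simpa only [Matrix.mul_assoc] using hAX
  · calc H * Aᵀ * A * (H * Aᵀ) = H * (Aᵀ * A) * H * Aᵀ := by simp only [Matrix.mul_assoc]
      _ = _ := by rw [hHGH]
  · simp only [transpose_mul, transpose_transpose, hHt, Matrix.mul_assoc]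
  · rw [Matrix.mul_assoc, hHG]
    simp [Matrix.mul_assoc]

end LinearAlgebra

/-! ### The machine model: a real RAM

A program is a structured program over finitely many arrays (the names of arrays are literals of the
program text). An array of naturals is indexed by a natural number, an array of reals by a pair of
natural numbers. Naturals can be added, subtracted (truncated at `0`) and compared, and they serve
as addresses; reals can be added, subtracted, multiplied, divided and compared, exactly. Every such
operation, every memory access and every instruction costs one unit of time. There is no rounding
and no conversion of reals into naturals. -/

section Machine

/-- The memory: arrays of naturals and doubly indexed arrays of reals, both addressed by name. -/
structure Mem where
  nat : ℕ → ℕ → ℕ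
  real : ℕ → ℕ → ℕ → ℝ

/-- Expressions for naturals. -/
inductive NExpr where
  | lit (c : ℕ)
  | cell (a : ℕ) (i : NExpr)
  | add (e f : NExpr)
  | sub (e f : NExpr)

/-- The value of an expression for naturals. -/
def NExpr.eval (s : Mem) : NExpr → ℕ
  | .lit c => c
  | .cell a i => s.nat a (i.eval s)
  | .add e f => e.eval s + f.eval s
  | .sub e f => e.eval s - f.eval s

/-- The time that the evaluation takes: the number of nodes of the expression. -/
def NExpr.cost : NExpr → ℕ
  | .lit _ => 1
  | .cell _ i => i.cost + 1
  | .add e f => e.cost + f.cost + 1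
  | .sub e f => e.cost + f.cost + 1

/-- Expressions for reals; `ofNat` is the conversion of a natural into a real. -/
inductive RExpr where
  | lit (c : ℤ)
  | ofNat (e : NExpr)
  | cell (a : ℕ) (i j : NExpr)
  | add (e f : RExpr)
  | sub (e f : RExpr)
  | mul (e f : RExpr)
  | div (e f : RExpr)

/-- The value of an expression for reals. A division by `0` returns `0`; as a program can test
whether a real is `0` before it divides, this is no more than a convention. -/
noncomputable def RExpr.eval (s : Mem) : RExpr → ℝ
  | .lit c => (c : ℝ)
  | .ofNat e => ((e.eval s : ℕ) : ℝ)
  | .cell a i j => s.real a (i.eval s) (j.eval s)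
  | .add e f => e.eval s + f.eval s
  | .sub e f => e.eval s - f.eval s
  | .mul e f => e.eval s * f.eval s
  | .div e f => e.eval s / f.eval s

/-- The time that the evaluation takes: the number of nodes of the expression. -/
def RExpr.cost : RExpr → ℕ
  | .lit _ => 1
  | .ofNat e => e.cost + 1
  | .cell _ i j => i.cost + j.cost + 1
  | .add e f => e.cost + f.cost + 1
  | .sub e f => e.cost + f.cost + 1
  | .mul e f => e.cost + f.cost + 1
  | .div e f => e.cost + f.cost + 1

/-- Tests: strict comparison of naturals, strict comparison of reals, negation. -/
inductive Test where
  | nlt (e f : NExpr)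
  | rlt (e f : RExpr)
  | not (b : Test)

/-- Whether a test succeeds. -/
def Test.Holds (s : Mem) : Test → Prop
  | .nlt e f => e.eval s < f.eval s
  | .rlt e f => e.eval s < f.eval s
  | .not b => ¬ b.Holds s

/-- The time that a test takes. -/
def Test.cost : Test → ℕ
  | .nlt e f => e.cost + f.cost + 1
  | .rlt e f => e.cost + f.cost + 1
  | .not b => b.cost + 1

/-- Programs: `nset a i e` is the assignment `a[i] := e`, `rset a i j e` is `a[i, j] := e`,
`loop b c` is `while b do c`. -/
inductive Prog where
  | skip
  | nset (a : ℕ) (i e : NExpr)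
  | rset (a : ℕ) (i j : NExpr) (e : RExpr)
  | seq (c c' : Prog)
  | ite (b : Test) (c c' : Prog)
  | loop (b : Test) (c : Prog)

/-- The memory after the assignment `a[i] := v` to an array of naturals. -/
def Mem.setNat (s : Mem) (a i v : ℕ) : Mem :=
  { s with nat := fun a' i' => if a' = a ∧ i' = i then v else s.nat a' i' }

/-- The memory after the assignment `a[i, j] := v` to an array of reals. -/
noncomputable def Mem.setReal (s : Mem) (a i j : ℕ) (v : ℝ) : Mem :=
  { s with real := fun a' i' j' => if a' = a ∧ i' = i ∧ j' = j then v else s.real a' i' j' }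

/-- `c.Runs s T s'`: the program `c`, started on the memory `s`, halts after exactly `T` units of
time with the memory `s'`. -/
inductive Prog.Runs : Prog → Mem → ℕ → Mem → Prop where
  | skip (s : Mem) : Prog.Runs .skip s 1 s
  | nset (a : ℕ) (i e : NExpr) (s : Mem) :
      Prog.Runs (.nset a i e) s (i.cost + e.cost + 1) (s.setNat a (i.eval s) (e.eval s))
  | rset (a : ℕ) (i j : NExpr) (e : RExpr) (s : Mem) :
      Prog.Runs (.rset a i j e) s (i.cost + j.cost + e.cost + 1)
        (s.setReal a (i.eval s) (j.eval s) (e.eval s))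
  | seq {c c' : Prog} {s s' s'' : Mem} {T T' : ℕ} :
      Prog.Runs c s T s' → Prog.Runs c' s' T' s'' → Prog.Runs (.seq c c') s (T + T') s''
  | ite_true {b : Test} {c c' : Prog} {s s' : Mem} {T : ℕ} :
      b.Holds s → Prog.Runs c s T s' → Prog.Runs (.ite b c c') s (b.cost + T + 1) s'
  | ite_false {b : Test} {c c' : Prog} {s s' : Mem} {T : ℕ} :
      ¬ b.Holds s → Prog.Runs c' s T s' → Prog.Runs (.ite b c c') s (b.cost + T + 1) s'
  | loop_stop {b : Test} {c : Prog} {s : Mem} :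
      ¬ b.Holds s → Prog.Runs (.loop b c) s (b.cost + 1) s
  | loop_step {b : Test} {c : Prog} {s s' s'' : Mem} {T T' : ℕ} :
      b.Holds s → Prog.Runs c s T s' → Prog.Runs (.loop b c) s' T' s'' →
      Prog.Runs (.loop b c) s (b.cost + T + T' + 1) s''

/-- The matrix `M` is stored in the array of reals with the name `a`. -/
def Mem.Stores {p q : ℕ} (s : Mem) (a : ℕ) (M : Matrix (Fin p) (Fin q) ℝ) : Prop :=
  ∀ (i : Fin p) (j : Fin q), s.real a i j = M i j

/-- `w` is an exponent of matrix multiplication: a program multiplies any two `m × m` matrices in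
time `O(m ^ w)`. The input is `m`, `X`, `Y`, the output is `X * Y`; the rest of the memory holds
arbitrary values at the start. -/
def MatMulExponent (w : ℝ) : Prop :=
  ∃ (P : Prog) (C : ℝ), ∀ (m : ℕ), 0 < m → ∀ (X Y : Matrix (Fin m) (Fin m) ℝ) (s : Mem),
    s.nat 0 0 = m → s.Stores 0 X → s.Stores 1 Y →
    ∃ (T : ℕ) (s' : Mem), P.Runs s T s' ∧ (T : ℝ) ≤ C * (m : ℝ) ^ w ∧ s'.Stores 2 (X * Y)

/-- The memory holds the input `n`, `d`, `k`, `A`, `ε`, and arbitrary values elsewhere. -/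
structure Mem.HasInput {n d : ℕ} (s : Mem) (A : Matrix (Fin n) (Fin d) ℝ) (k : ℕ) (ε : ℝ) :
    Prop where
  rows : s.nat 0 0 = n
  columns : s.nat 1 0 = d
  size : s.nat 2 0 = k
  matrix : s.Stores 0 A
  precision : s.real 1 0 0 = ε

/-- `P`, started on `s`, executes the greedy algorithm on the input `A`, `k`, `ε` in time `T`:
when it halts, the memory holds the list `j_1, …, j_k` of the columns chosen by a run of the
algorithm, and the approximations of the largest roots that this run has computed. -/
def Prog.ExecutesGreedy {n d : ℕ} (P : Prog) (s : Mem) (A : Matrix (Fin n) (Fin d) ℝ) (k : ℕ)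
    (ε : ℝ) (T : ℕ) : Prop :=
  ∃ (s' : Mem) (j : Fin k → Fin d) (μ : Fin k → Fin d → ℝ),
    P.Runs s T s' ∧ IsGreedyRun A k ε j μ ∧
    (∀ l : Fin k, s'.nat 3 l = j l) ∧ (∀ (l : Fin k) (i : Fin d), s'.real 2 l i = μ l i)

end Machine

end ColSubset

/-! ### Real-rooted polynomials that are positive on a half-line -/

namespace ColSubset

/-! The proof works in the variable y = 1/x. Let M_S be the Gram matrix of the residual (`gram`).
Then p̂_S(x) = x^d F_S(1/x) for x ≠ 0, where F_S = (-d/dy)^(k-|S|) det(1 - y M_S) is `hatRev`: the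
operator x²∂ - dx turns into -d/dy (`eval_polarOp`). F_S is real-rooted and positive on (-∞, 0], so
all roots of p̂_S are at most ρ > 0 exactly if F_S is positive on [0, 1/ρ).

Quality of the output. Adding a column replaces M = M_S by a Schur complement (`gram_insert`), and
in an eigenbasis U of M the polynomial M_ii det(1 - y M_{S∪i}) equals ∑_j U_ij² λ_j ∏_{l≠j} (1 - λ_l
y) (`charpolyRev_schurStep`). The sum over i is -d/dy det(1 - y M). Hence, if H is the iterate of
order k-|S|-1, then F_S = -H' is a combination with positive weights of polynomials F_{S∪i}, each of
which interlaces H. Interlacing is expressed by half-planes, so that Gauss-Lucas carries it over to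
derivatives, and it gives a sign for the Wronskian. It follows that some column does not increase
the largest root (`exists_insert_roots_le`), and a greedy choice from ε-approximations loses at most
2ε per iteration (`greedy_roots_le`). At the end |S| = k, and p̂_S is the characteristic polynomial
of M_S, whose largest root is the squared norm of the residual.

For S = ∅ the largest root is bounded by a barrier argument. The barrier -F'/F at a is the sum of
1/(r - a) over the roots r. If it is at most φ, then passing from F to -F' moves the root-free
half-line by 1/φ to the right and does not raise the barrier (`LeftOf.barrier_step`). The roots of
det(1 - y AᵀA) are the λ_i⁻¹, with mean α⁻¹; convexity bounds the initial barrier by that of a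
distribution on the two extreme points, and an optimal starting point produces γ
(`leftOf_iterate_of_roots`).

Running time. The Gram matrix is kept as a product L R of a d × m and an m × d matrix, m = min(n,
d). The Faddeev-LeVerrier matrices ∑_l λ_l b_l u_l u_lᵀ, where b_l is the b-th coefficient of
∏_{l'≠l} (1 - λ_l' y), have as diagonal entries the coefficients of M_ii det(1 - y M_{S∪i}) for all
i at once. One recursion of m + 1 steps therefore serves all the candidates; in the form L W each
step multiplies an m × m by an m × d matrix, cut into square blocks, so an iteration costs O(d m^w).
Each largest root is then found by bisection on [0, tr M_S]. The test is Budan's: a real-rooted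
polynomial has no root beyond x if and only if its Taylor coefficients at x do not change sign
(`budan`). A test costs O(m²), and O(log X) of them suffice, because tr M_S ≤ ε X² with X = max(m,
‖A‖²/ε). -/

/-- `F` is real-rooted and positive on `(-∞, a]`. -/
structure LeftOf (a : ℝ) (F : ℝ[X]) : Prop where
  splits : F.Splits
  pos : ∀ x ≤ a, 0 < F.eval x

theorem LeftOf.ne_zero {a : ℝ} {F : ℝ[X]} (h : LeftOf a F) : F ≠ 0 := by
  rintro rfl; simpa using h.pos a le_rfl

theorem LeftOf.mono {a b : ℝ} {F : ℝ[X]} (h : LeftOf a F) (hb : b ≤ a) : LeftOf b F :=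
  ⟨h.splits, fun x hx => h.pos x (hx.trans hb)⟩

theorem LeftOf.lt_root {a r : ℝ} {F : ℝ[X]} (h : LeftOf a F) (hr : r ∈ F.roots) : a < r := by
  by_contra hle
  have := h.pos r (not_lt.mp hle)
  rw [(mem_roots h.ne_zero).mp hr |>.eq_zero] at this
  exact lt_irrefl _ this

/-- A real-rooted polynomial with a positive value and without roots in `(-∞, a]` is positive
there. -/
theorem LeftOf.of_no_root {a : ℝ} {F : ℝ[X]} (h : LeftOf 0 F)
    (hr : ∀ x, 0 < x → x ≤ a → F.eval x ≠ 0) : LeftOf a F := by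
  refine ⟨h.splits, fun x hx => ?_⟩
  rcases le_or_gt x 0 with h0 | h0
  · exact h.pos x h0
  by_contra hneg
  have hc : ContinuousOn (fun y => F.eval y) (Set.Icc 0 x) := F.continuous.continuousOn
  obtain ⟨y, hy, hy0⟩ := intermediate_value_Icc' h0.le hc
    (⟨not_lt.mp hneg, (h.pos 0 le_rfl).le⟩ : (0 : ℝ) ∈ Set.Icc (F.eval x) (F.eval 0))
  rcases hy.1.eq_or_lt with h1 | h1
  · have := h.pos y h1.ge
    simp only at hy0
    linarith
  · exact hr y h1 (hy.2.trans hx) hy0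

/-- By Rolle's theorem the derivative has at most one root less than `F`, counted with multiplicity,
which exhausts its degree. -/
theorem splits_derivative {F : ℝ[X]} (h : F.Splits) : (derivative F).Splits := by
  by_cases hd : F.natDegree = 0
  · rw [derivative_of_natDegree_zero hd]; exact Splits.zero
  · rw [splits_iff_card_roots] at h ⊢
    have h1 := card_roots_le_derivative F
    have h2 := card_roots' (derivative F)
    have h3 := natDegree_derivative_lt hd
    omega

/-- The barrier function `-F'/F`. -/
noncomputable def barrier (F : ℝ[X]) (x : ℝ) : ℝ := -(derivative F).eval x / F.eval x

theorem LeftOf.barrier_eq {a : ℝ} {F : ℝ[X]} (h : LeftOf a F) :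
    barrier F a = (F.roots.map fun r => 1 / (r - a)).sum := by
  have h1 := h.splits.eval_derivative_div_eval_of_ne_zero (h.pos a le_rfl).ne'
  rw [barrier, neg_div, h1, ← Multiset.sum_map_neg', Multiset.map_map]
  congr 1
  apply Multiset.map_congr rfl
  intro r hr
  rw [Function.comp_apply, ← neg_sub r a, div_neg, neg_neg]

/-- `-F'` is `F` times the barrier, and the barrier is a nonempty sum of positive terms `1/(r - x)`.
-/
theorem LeftOf.neg_derivative {a : ℝ} {F : ℝ[X]} (h : LeftOf a F) (hd : 1 ≤ F.natDegree) :
    LeftOf a (-derivative F) := by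
  refine ⟨(splits_derivative h.splits).neg, fun x hx => ?_⟩
  have hx' := h.mono hx
  have h1 : 0 < barrier F x := by
    rw [hx'.barrier_eq]
    have hne : F.roots ≠ 0 := by
      intro h0
      have := splits_iff_card_roots.mp h.splits
      simp [h0] at this
      omega
    obtain ⟨r, hr⟩ := Multiset.exists_mem_of_ne_zero hne
    have hm : 1 / (r - x) ∈ F.roots.map fun r => 1 / (r - x) := Multiset.mem_map_of_mem _ hr
    have hpos : 0 < 1 / (r - x) := by
      have := hx'.lt_root hr
      apply one_div_pos.mpr; linarith
    refine hpos.trans_le (Multiset.single_le_sum ?_ _ hm)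
    intro y hy
    obtain ⟨s, hs, rfl⟩ := Multiset.mem_map.mp hy
    have := hx'.lt_root hs
    apply one_div_nonneg.mpr; linarith
  have h2 := h.pos x hx
  rw [barrier, div_pos_iff_of_pos_right h2] at h1
  simpa using h1

/-- The iterates of `F ↦ -F'`. -/
noncomputable def negDer (F : ℝ[X]) : ℝ[X] := -derivative F

theorem natDegree_negDer (F : ℝ[X]) : (negDer F).natDegree = F.natDegree - 1 := by
  rw [negDer, natDegree_neg]
  exact natDegree_derivative F

theorem natDegree_negDer_iterate (F : ℝ[X]) (k : ℕ) :
    (negDer^[k] F).natDegree = F.natDegree - k := by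
  induction k with
  | zero => rfl
  | succ k ih => rw [Function.iterate_succ_apply', natDegree_negDer, ih]; omega

theorem LeftOf.iterate {a : ℝ} {F : ℝ[X]} (h : LeftOf a F) (k : ℕ) (hk : k ≤ F.natDegree) :
    LeftOf a (negDer^[k] F) := by
  induction k with
  | zero => exact h
  | succ k ih =>
    rw [Function.iterate_succ_apply']
    exact (ih (by omega)).neg_derivative (by rw [natDegree_negDer_iterate]; omega)

end ColSubset

/-! ### A barrier argument -/

namespace ColSubset

theorem exists_roots_enum (F : ℝ[X]) :
    ∃ (r : Fin (Multiset.card F.roots) → ℝ), F.roots = Finset.univ.val.map r := by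
  refine ⟨fun i => F.roots.toList.get (i.cast (by simp)), ?_⟩
  have h : F.roots.toList = List.ofFn
      (fun i : Fin (Multiset.card F.roots) => F.roots.toList.get (i.cast (by simp))) := by
    apply List.ext_get
    · simp
    · intro n h1 h2
      simp
  rw [Fin.univ_val_map, ← h, Multiset.coe_toList]

/-- Let `S = ∑ 1/(r i - y)`. Then `F' = -F S`, hence `F'' = F (S² - S')` with `S' = ∑ 1/(r i - y)²`,
and the barrier of `-F'` is `-F''/F'`. -/
theorem barrier_negDer {b : ℝ} {F : ℝ[X]} (h : LeftOf b F) {N : ℕ} {r : Fin N → ℝ}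
    (hr : F.roots = Finset.univ.val.map r) :
    barrier (negDer F) b = (∑ i, 1 / (r i - b)) - (∑ i, 1 / (r i - b) ^ 2) / ∑ i, 1 / (r i - b) := by
  have hlt : ∀ i, b < r i := fun i => h.lt_root (by rw [hr]; simp)
  have hF := h.pos b le_rfl
  -- The identity is needed on a neighbourhood because it is differentiated below.
  have hev : ∀ᶠ y in nhds b, (derivative F).eval y = F.eval y * ∑ i, (y - r i)⁻¹ := by
    have : ∀ᶠ y in nhds b, F.eval y ≠ 0 := F.continuous.continuousAt.eventually_ne hF.ne'
    filter_upwards [this] with y hy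
    rw [h.splits.eval_derivative_eq_eval_mul_sum hy, hr]
    simp [Finset.sum, Function.comp_def]
  have hd1 : HasDerivAt (fun y => (derivative F).eval y) ((derivative (derivative F)).eval b) b :=
    (derivative F).hasDerivAt b
  have hd2 : HasDerivAt (fun y => F.eval y * ∑ i, (y - r i)⁻¹)
      ((derivative F).eval b * (∑ i, (b - r i)⁻¹) + F.eval b * ∑ i, (-1 / (b - r i) ^ 2)) b := by
    refine (F.hasDerivAt b).mul ?_
    have := HasDerivAt.fun_sum (u := Finset.univ) (A := fun i y => (y - r i)⁻¹)
      (A' := fun i => -1 / (b - r i) ^ 2) (x := b) (fun i _ => by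
        exact ((hasDerivAt_id b).sub_const (r i)).fun_inv (by simp [sub_ne_zero, (hlt i).ne]))
    exact this
  have h2 := hd1.unique (hd2.congr_of_eventuallyEq hev)
  have h1 := hev.self_of_nhds
  have e1 : ∑ i, (b - r i)⁻¹ = -∑ i, 1 / (r i - b) := by
    rw [← Finset.sum_neg_distrib]
    refine Finset.sum_congr rfl fun i _ => ?_
    rw [← neg_sub, inv_neg, one_div]
  have e2 : ∑ i, (-1 / (b - r i) ^ 2) = -∑ i, 1 / (r i - b) ^ 2 := by
    rw [← Finset.sum_neg_distrib]
    refine Finset.sum_congr rfl fun i _ => ?_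
    rw [← neg_sub (r i) b, neg_sq, neg_div]
  rw [e1] at h1
  rw [e1, e2, h1] at h2
  rw [barrier, negDer, derivative_neg, eval_neg, eval_neg, h1, h2]
  set S := ∑ i, 1 / (r i - b)
  by_cases hS : S = 0
  · simp [hS]
  · field_simp
    ring

theorem barrier_eq_sum {b : ℝ} {F : ℝ[X]} (h : LeftOf b F) {N : ℕ} {r : Fin N → ℝ}
    (hr : F.roots = Finset.univ.val.map r) :
    barrier F b = ∑ i, 1 / (r i - b) := by
  rw [h.barrier_eq, hr]; simp [Finset.sum, Function.comp_def]

/-- With `c i = 1/(r i - a - δ)` one has `c i/(1 + δ c i) = 1/(r i - a)`, so this compares the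
barrier of `-F'` at `a + δ` with that of `F` at `a`. In terms of the sums `φ`, `Y`, `Z` below the
claim is `δYφ + δ²Y² ≤ Y + δZ`, a consequence of `δφ ≤ 1` and of Cauchy-Schwarz, `Y² ≤ φZ`. -/
theorem barrier_step_ineq {N : ℕ} {c : Fin N → ℝ} (hN : 0 < N) (hc : ∀ i, 0 < c i) {δ : ℝ}
    (hδ : 0 < δ) (h : δ * ∑ i, c i / (1 + δ * c i) ≤ 1) :
    (∑ i, c i) - (∑ i, c i ^ 2) / ∑ i, c i ≤ ∑ i, c i / (1 + δ * c i) := by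
  have : Nonempty (Fin N) := ⟨⟨0, hN⟩⟩
  have hp : ∀ i, 0 < 1 + δ * c i := fun i => by have := hc i; positivity
  set φ := ∑ i, c i / (1 + δ * c i) with hφ
  set Y := ∑ i, c i ^ 2 / (1 + δ * c i) with hY
  set Z := ∑ i, c i ^ 3 / (1 + δ * c i) with hZ
  have hφ0 : 0 < φ := Finset.sum_pos (fun i _ => div_pos (hc i) (hp i)) Finset.univ_nonempty
  have hY0 : 0 < Y := Finset.sum_pos (fun i _ => div_pos (pow_pos (hc i) 2) (hp i))
    Finset.univ_nonempty
  have h1 : ∑ i, c i = φ + δ * Y := by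
    rw [hφ, hY, Finset.mul_sum, ← Finset.sum_add_distrib]
    refine Finset.sum_congr rfl fun i _ => ?_
    rw [mul_div_assoc', ← add_div, eq_div_iff (hp i).ne']
    ring
  have h2 : ∑ i, c i ^ 2 = Y + δ * Z := by
    rw [hZ, hY, Finset.mul_sum, ← Finset.sum_add_distrib]
    refine Finset.sum_congr rfl fun i _ => ?_
    rw [mul_div_assoc', ← add_div, eq_div_iff (hp i).ne']
    ring
  have h3 : Y ^ 2 ≤ φ * Z := by
    refine Finset.sum_sq_le_sum_mul_sum_of_sq_le_mul _ (fun i _ => ?_) (fun i _ => ?_) (fun i _ => ?_)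
    · exact (div_pos (hc i) (hp i)).le
    · exact (div_pos (pow_pos (hc i) 3) (hp i)).le
    · have := (hp i).ne'
      apply le_of_eq
      field_simp
  have hs : 0 < φ + δ * Y := by positivity
  rw [h1, h2, sub_le_iff_le_add, ← sub_le_iff_le_add', le_div_iff₀ hs]
  have h4 : 0 ≤ Y * (1 - δ * φ) := mul_nonneg hY0.le (by linarith)
  have h5 : δ * φ * (δ * Y ^ 2) ≤ δ * φ * Z := by
    have : δ * φ * (δ * Y ^ 2) ≤ δ * (δ * φ * (φ * Z)) := by
      have := mul_le_mul_of_nonneg_left h3 (by positivity : 0 ≤ δ * δ * φ)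
      nlinarith
    have hZ0 : 0 ≤ Z := Finset.sum_nonneg fun i _ => (div_pos (pow_pos (hc i) 3) (hp i)).le
    have h6 : δ * (δ * φ * (φ * Z)) ≤ δ * (1 * (φ * Z)) := by gcongr
    linarith
  have h7 : δ * Y ^ 2 ≤ Z := le_of_mul_le_mul_left h5 (by positivity)
  nlinarith [mul_le_mul_of_nonneg_left h7 hδ.le]

/-- Degree at least 2 makes each single term `1/(r i - a)` strictly smaller than `φ`, so `a + 1/φ`
is still to the left of all roots. That the barrier does not rise is `barrier_step_ineq` with `δ =
1/φ`. -/
theorem LeftOf.barrier_step {a φ : ℝ} {F : ℝ[X]} (h : LeftOf a F) (hd : 2 ≤ F.natDegree)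
    (hφ : barrier F a ≤ φ) :
    LeftOf (a + 1 / φ) (negDer F) ∧ barrier (negDer F) (a + 1 / φ) ≤ φ := by
  obtain ⟨r, hr⟩ := exists_roots_enum F
  have hcard : Multiset.card F.roots = F.natDegree := (splits_iff_card_roots.mp h.splits)
  have hN : 2 ≤ Multiset.card F.roots := by omega
  generalize Multiset.card F.roots = N at r hr hN
  have hlt : ∀ i, a < r i := fun i => h.lt_root (by rw [hr]; simp)
  have hpos : ∀ i, 0 < 1 / (r i - a) := fun i => by
    have := hlt i; apply one_div_pos.mpr; linarith
  rw [barrier_eq_sum h hr] at hφ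
  have hφ0 : 0 < φ := by
    refine lt_of_lt_of_le ?_ hφ
    exact Finset.sum_pos (fun i _ => hpos i) ⟨⟨0, by omega⟩, Finset.mem_univ _⟩
  have hlt' : ∀ i, a + 1 / φ < r i := by
    intro i
    have h1 : 1 / (r i - a) < φ := by
      refine lt_of_lt_of_le ?_ hφ
      have : Nontrivial (Fin N) := Fin.nontrivial_iff_two_le.mpr hN
      obtain ⟨j, hj⟩ := exists_ne i
      exact Finset.single_lt_sum hj (Finset.mem_univ i) (Finset.mem_univ j) (hpos j)
        (fun k _ _ => (hpos k).le)
    have h2 : 0 < r i - a := by linarith [hlt i]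
    have h3 : 1 / φ < r i - a := by
      rw [div_lt_iff₀ h2] at h1
      rw [div_lt_iff₀ hφ0]; linarith
    linarith
  have hL : LeftOf (a + 1 / φ) F := by
    refine ⟨h.splits, fun x hx => ?_⟩
    by_contra hneg
    rcases le_or_gt x a with hxa | hxa
    · exact hneg (h.pos x hxa)
    have hc : ContinuousOn (fun y => F.eval y) (Set.Icc a x) := F.continuous.continuousOn
    obtain ⟨y, hy, hy0⟩ := intermediate_value_Icc' hxa.le hc
      (⟨not_lt.mp hneg, (h.pos a le_rfl).le⟩ : (0 : ℝ) ∈ Set.Icc (F.eval x) (F.eval a))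
    have hm : y ∈ F.roots := (mem_roots h.ne_zero).mpr hy0
    rw [hr] at hm
    obtain ⟨i, _, rfl⟩ := Multiset.mem_map.mp hm
    linarith [hlt' i, hy.2]
  refine ⟨hL.neg_derivative (by omega), ?_⟩
  rw [barrier_negDer hL hr]
  have hc : ∀ i, 0 < 1 / (r i - (a + 1 / φ)) := fun i => by
    have := hlt' i; apply one_div_pos.mpr; linarith
  have e : ∀ i, 1 / (r i - (a + 1 / φ)) / (1 + 1 / φ * (1 / (r i - (a + 1 / φ)))) =
      1 / (r i - a) := by
    intro i
    have h1 : r i - (a + 1 / φ) ≠ 0 := by linarith [hlt' i]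
    have h2 : r i - a ≠ 0 := by linarith [hlt i]
    generalize hs : r i - (a + 1 / φ) = s at *
    have : r i - a = s + 1 / φ := by linarith
    rw [this] at h2 ⊢
    have h3 : s * φ + 1 ≠ 0 := by
      intro h0; apply h2; field_simp; linarith
    have h4 : φ * s + 1 ≠ 0 := by rwa [mul_comm]
    field_simp
  have key := barrier_step_ineq (by omega) hc (δ := 1 / φ) (by positivity) (by
    simp only [e]
    rw [one_div, inv_mul_le_iff₀ hφ0]; linarith)
  simp only [e, _root_.one_div_pow] at key ⊢
  linarith

theorem LeftOf.barrier_iterate {a φ : ℝ} {F : ℝ[X]} (h : LeftOf a F) (hφ : barrier F a ≤ φ)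
    (k : ℕ) (hk : k < F.natDegree) :
    LeftOf (a + k / φ) (negDer^[k] F) ∧ barrier (negDer^[k] F) (a + k / φ) ≤ φ := by
  induction k with
  | zero => simpa using ⟨h, hφ⟩
  | succ k ih =>
    obtain ⟨h1, h2⟩ := ih (by omega)
    have h3 := h1.barrier_step (by rw [natDegree_negDer_iterate]; omega) h2
    rw [Function.iterate_succ_apply']
    have e : a + ((k + 1 : ℕ) : ℝ) / φ = a + k / φ + 1 / φ := by push_cast; ring
    rw [e]
    exact h3

end ColSubset

/-! ### The bound for the largest root -/

namespace ColSubset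

/-- The expanded form is the one in which the optimization in `leftOf_iterate_of_roots` delivers the
bound. -/
theorem gamma_identity {κ β : ℝ} (hβ : 0 < β) (hβ1 : β < 1) (hκ : β ≤ κ) (hκ1 : κ < 1) :
    (1 - β) * (√κ - √(β / (1 - β) * (1 - κ))) ^ 2 =
      κ + β - 2 * β * κ - 2 * √(κ * (1 - κ) * (β * (1 - β))) := by
  have h1 : 0 < 1 - β := by linarith
  have h2 : 0 < 1 - κ := by linarith
  have h0 : 0 < κ := by linarith
  have e1 : √(κ * (1 - κ) * (β * (1 - β))) = (1 - β) * (√κ * √(β / (1 - β) * (1 - κ))) := by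
    rw [← Real.sqrt_mul h0.le, ← Real.sqrt_sq h1.le, ← Real.sqrt_mul (sq_nonneg _),
      Real.sqrt_sq h1.le]
    congr 1
    field_simp
  rw [e1, sub_sq, Real.sq_sqrt h0.le, Real.sq_sqrt (by positivity)]
  field_simp
  ring

/-- A root-free interval of the `k`-th derivative of a real-rooted polynomial, in terms of the
mean and of bounds of the roots. -/
theorem leftOf_iterate_of_roots {t k : ℕ} {F : ℝ[X]} {r : Fin t → ℝ} {u₀ u₁ β : ℝ}
    (hF : ∀ a < u₀, LeftOf a F) (hr : F.roots = Finset.univ.val.map r) (hu : u₀ < u₁)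
    (h0 : ∀ i, u₀ ≤ r i) (h1 : ∀ i, r i ≤ u₁)
    (hmean : ∑ i, (u₁ - r i) = t * (β * (u₁ - u₀)))
    (hβ : 0 < β) (hβ1 : β < 1) (hk : β * t ≤ k) (hkt : k < t) :
    ∀ y < u₀ + (1 - β) * (u₁ - u₀) * (√((k : ℝ) / t) - √(β / (1 - β) * (1 - (k : ℝ) / t))) ^ 2,
      LeftOf y (negDer^[k] F) := by
  intro y hy
  have ht : (0 : ℝ) < t := by exact_mod_cast (Nat.zero_le k).trans_lt hkt
  have hdeg : F.natDegree = t := by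
    have := splits_iff_card_roots.mp (hF (u₀ - 1) (by linarith)).splits
    rw [hr] at this
    simpa using this.symm
  obtain ⟨κ, hκdef⟩ : ∃ κ, κ = (k : ℝ) / t := ⟨_, rfl⟩
  rw [← hκdef] at hy
  have hkκ : (k : ℝ) = κ * t := by rw [hκdef]; field_simp
  have hκ : β ≤ κ := by rw [hκdef, le_div_iff₀ ht]; exact hk
  have hκ1 : κ < 1 := by rw [hκdef, div_lt_one ht]; exact_mod_cast hkt
  have hγ := gamma_identity hβ hβ1 hκ hκ1
  -- If `κ = β`, the gain `γ` is zero and no barrier is needed; the starting point below requires `κ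
  -- > β`.
  rcases hκ.eq_or_lt with heq | hlt
  · have hz : √κ - √(β / (1 - β) * (1 - κ)) = 0 := by
      rw [← heq, div_mul_cancel₀ _ (by linarith), sub_self]
    rw [hz] at hy
    exact (hF y (by simpa using hy)).iterate k (by omega)
  set q := √(κ * (1 - κ) * (β * (1 - β))) with hq
  have hb1 : 0 < 1 - β := by linarith
  have hk1 : 0 < 1 - κ := by linarith
  have hκ0 : 0 < κ := by linarith
  have hq2 : q ^ 2 = κ * (1 - κ) * (β * (1 - β)) := Real.sq_sqrt (by positivity)
  have hq0 : 0 < q := Real.sqrt_pos.mpr (by positivity)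
  set Δ := u₁ - u₀ with hΔ
  have hΔ0 : 0 < Δ := by linarith
  -- The barrier is started at `u₀ - (s - β)Δ` and ends at `u₀ + Δ(β - s + κ(s + 1 - β)(s - β)/s)`.
  -- This is largest for `s²(1 - κ) = κβ(1 - β)`, and `κ > β` implies `s > β`.
  obtain ⟨s, hs⟩ : ∃ s, s = q / (1 - κ) := ⟨_, rfl⟩
  have hqs : q = s * (1 - κ) := by rw [hs]; field_simp
  have hs0 : 0 < s := by rw [hs]; positivity
  have hsβ : β < s := by
    rw [hs, lt_div_iff₀ hk1]
    refine lt_of_pow_lt_pow_left₀ 2 hq0.le ?_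
    rw [hq2]
    have : 0 < β * (1 - κ) * (κ - β) := mul_pos (by positivity) (by linarith)
    nlinarith
  have hss : s ^ 2 * (1 - κ) = κ * (β * (1 - β)) := by
    have h : (s ^ 2 * (1 - κ)) * (1 - κ) = (κ * (β * (1 - β))) * (1 - κ) := by
      rw [hqs] at hq2; linarith
    exact mul_right_cancel₀ hk1.ne' h
  -- `bΔ` and `(b - 1)Δ` are the distances from the starting point to `u₁` and to `u₀`.
  set b := s + 1 - β with hb
  have hbm : 0 < b - 1 := by linarith
  have hbp : 0 < b := by linarith
  have hL := hF (u₀ - (s - β) * Δ) (by nlinarith)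
  have hbar : barrier F (u₀ - (s - β) * Δ) ≤ t * s / (b * (b - 1) * Δ) := by
    rw [barrier_eq_sum hL hr]
    -- As a function of the root, the term is convex, so it lies below its chord over `[u₀, u₁]`.
    -- The sum of the chord values depends only on the mean of the roots.
    have hterm : ∀ i, 1 / (r i - (u₀ - (s - β) * Δ)) ≤
        1 / (b * Δ) + (1 / ((b - 1) * Δ) - 1 / (b * Δ)) * ((u₁ - r i) / Δ) := by
      intro i
      obtain ⟨v, hv⟩ : ∃ v, v = (u₁ - r i) / Δ := ⟨_, rfl⟩
      have hv0 : 0 ≤ v := by rw [hv]; exact div_nonneg (by linarith [h1 i]) hΔ0.le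
      have hv1 : v ≤ 1 := by rw [hv, div_le_one hΔ0]; linarith [h0 i]
      have hri : r i - (u₀ - (s - β) * Δ) = (b - v) * Δ := by
        have : u₁ - r i = v * Δ := by rw [hv]; field_simp
        linarith
      have hbv : 0 < b - v := by linarith
      rw [← hv, hri]
      have e : 1 / (b * Δ) + (1 / ((b - 1) * Δ) - 1 / (b * Δ)) * v - 1 / ((b - v) * Δ) =
          v * (1 - v) / (b * (b - 1) * (b - v) * Δ) := by
        field_simp
        ring
      have : 0 ≤ v * (1 - v) / (b * (b - 1) * (b - v) * Δ) :=
        div_nonneg (mul_nonneg hv0 (by linarith)) (by positivity)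
      linarith
    refine (Finset.sum_le_sum fun i _ => hterm i).trans (le_of_eq ?_)
    rw [Finset.sum_add_distrib, ← Finset.mul_sum, ← Finset.sum_div Finset.univ (fun i => u₁ - r i), hmean]
    simp only [Finset.sum_const, Finset.card_univ, Fintype.card_fin, nsmul_eq_mul]
    have e : s = b - 1 + β := by rw [hb]; ring
    rw [e]
    field_simp
    ring
  refine (hL.barrier_iterate hbar k (by omega)).1.mono ?_
  have e : u₀ - (s - β) * Δ + k / (t * s / (b * (b - 1) * Δ)) =
      u₀ + Δ * ((1 - β) * (√κ - √(β / (1 - β) * (1 - κ))) ^ 2) := by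
    rw [hγ, hqs, hkκ]
    have : κ * t / (t * s / (b * (b - 1) * Δ)) = Δ * (κ * b * (b - 1) / s) := by
      field_simp
    rw [this]
    -- The optimal `s` satisfies `κβ(1 - β)/s = s(1 - κ)`, which replaces the only term with `s` in
    -- the denominator.
    have h3 : κ * b * (b - 1) / s = κ * s + κ * (1 - 2 * β) - s * (1 - κ) := by
      rw [div_eq_iff hs0.ne', hb]
      linear_combination hss
    rw [h3]
    ring
  rw [e]
  linarith

end ColSubset

/-! ### Interlacing -/

namespace ColSubset

/-- `h - z g` has no root in the upper half-plane when `z` lies in it. -/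
def Interlaces (h g : ℝ[X]) : Prop :=
  ∀ z : ℂ, 0 < z.im → ∀ y : ℂ, 0 < y.im →
    (h.map (algebraMap ℝ ℂ) - C z * g.map (algebraMap ℝ ℂ)).eval y ≠ 0

/-- The coefficient in the degree of `h` cannot vanish: its imaginary part would force the
coefficient of `g` to be zero, and then its real part the leading coefficient of `h`. -/
theorem natDegree_pencil_pos {h g : ℝ[X]} (hd : 1 ≤ h.natDegree) {z : ℂ} (hz : 0 < z.im) :
    0 < (h.map (algebraMap ℝ ℂ) - C z * g.map (algebraMap ℝ ℂ)).degree := by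
  by_contra hle
  have hc : (h.map (algebraMap ℝ ℂ) - C z * g.map (algebraMap ℝ ℂ)).coeff h.natDegree = 0 := by
    apply coeff_eq_zero_of_degree_lt
    refine (not_lt.mp hle).trans_lt ?_
    exact_mod_cast hd
  have hre := congrArg Complex.re hc
  have him := congrArg Complex.im hc
  simp only [coeff_sub, coeff_map, coeff_C_mul, Complex.coe_algebraMap, Complex.sub_re,
    Complex.sub_im, Complex.ofReal_re, Complex.ofReal_im, Complex.mul_re, Complex.mul_im,
    Complex.zero_re, Complex.zero_im] at hre him
  have hg : g.coeff h.natDegree = 0 := by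
    have : z.im * g.coeff h.natDegree = 0 := by linarith
    exact (mul_eq_zero.mp this).resolve_left hz.ne'
  rw [hg] at hre
  have : h.leadingCoeff = 0 := by rw [leadingCoeff]; linarith
  rw [leadingCoeff_eq_zero] at this
  simp [this] at hd

/-- Gauss-Lucas: the roots of `h - z g` lie in the closed lower half-plane, which is convex, so the
roots of the derivative lie there too. -/
theorem Interlaces.of_derivative {h g : ℝ[X]} (H : Interlaces h g) (hd : 1 < h.natDegree) :
    Interlaces (derivative h) (derivative g) := by
  intro z hz y hy h0
  set F := h.map (algebraMap ℝ ℂ) - C z * g.map (algebraMap ℝ ℂ) with hF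
  have hder : (Polynomial.derivative h).map (algebraMap ℝ ℂ) -
      C z * (Polynomial.derivative g).map (algebraMap ℝ ℂ) = Polynomial.derivative F := by
    simp [hF, derivative_map]
  have hne : Polynomial.derivative F ≠ 0 := by
    rw [← hder]
    intro h1
    have h2 := natDegree_pencil_pos (h := Polynomial.derivative h) (g := Polynomial.derivative g)
      (by rw [natDegree_derivative]; omega) hz
    rw [h1] at h2
    simp at h2
  rw [hder] at h0
  have hmem : y ∈ (Polynomial.derivative F).rootSet ℂ := by
    rw [mem_rootSet]
    exact ⟨hne, by simpa using h0⟩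
  have hsub : convexHull ℝ (F.rootSet ℂ) ⊆ {x : ℂ | x.im ≤ 0} := by
    refine convexHull_min ?_ (convex_halfSpace_im_le 0)
    intro x hx
    rw [mem_rootSet] at hx
    by_contra hx0
    refine H z hz x (not_le.mp hx0) ?_
    rw [← coe_aeval_eq_eval]
    exact hx.2
  have := hsub (rootSet_derivative_subset_convexHull_rootSet (natDegree_pencil_pos hd.le hz) hmem)
  exact absurd hy (not_lt.mpr this)

theorem Interlaces.neg {h g : ℝ[X]} (H : Interlaces h g) : Interlaces (-h) (-g) := by
  intro z hz y hy h0
  apply H z hz y hy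
  simp only [Polynomial.map_neg, eval_sub, eval_neg, eval_mul, eval_C] at h0 ⊢
  linear_combination -h0

theorem Interlaces.iterate {h g : ℝ[X]} (H : Interlaces h g) (k : ℕ) (hk : k < h.natDegree) :
    Interlaces (negDer^[k] h) (negDer^[k] g) := by
  induction k with
  | zero => exact H
  | succ k ih =>
    rw [Function.iterate_succ_apply', Function.iterate_succ_apply']
    have hd : (negDer^[k] h).natDegree = h.natDegree - k := natDegree_negDer_iterate h k
    exact ((ih (by omega)).of_derivative (by omega)).neg

/-- On the upper half-plane `h/g` takes no value in that half-plane, so `g` times the conjugate of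
`h` has nonnegative imaginary part at `x + it`, `t > 0`. This imaginary part is zero at `t = 0`, and
its derivative there is the Wronskian. -/
theorem Interlaces.wronskian_nonneg {h g : ℝ[X]} (H : Interlaces h g) (x : ℝ) :
    0 ≤ (derivative g).eval x * h.eval x - g.eval x * (derivative h).eval x := by
  set gc := g.map (algebraMap ℝ ℂ)
  set hc := h.map (algebraMap ℝ ℂ)
  have hconj : ∀ y : ℂ, hc.eval ((starRingEnd ℂ) y) = (starRingEnd ℂ) (hc.eval y) := by
    intro y
    rw [eval_map, eval_map, hom_eval₂]
    congr 1
    ext r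
    simp
  let φ : ℝ → ℂ := fun t => gc.eval (x + t * Complex.I) * hc.eval (x - t * Complex.I)
  have hφ : ∀ t : ℝ, 0 < t → 0 ≤ (φ t).im := by
    intro t ht
    by_contra hneg
    have hy : 0 < ((x : ℂ) + t * Complex.I).im := by simpa using ht
    have hst : (x : ℂ) - t * Complex.I = (starRingEnd ℂ) ((x : ℂ) + t * Complex.I) := by
      simp [sub_eq_add_neg]
    simp only [φ, hst, hconj] at hneg
    set G := gc.eval ((x : ℂ) + t * Complex.I)
    set K := hc.eval ((x : ℂ) + t * Complex.I)
    have hG : G ≠ 0 := by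
      intro h0; rw [h0] at hneg; simp at hneg
    refine H (K / G) ?_ _ hy ?_
    · rw [Complex.div_im]
      have hn : 0 < Complex.normSq G := Complex.normSq_pos.mpr hG
      rw [← sub_div]
      refine div_pos ?_ hn
      simp only [Complex.mul_im, Complex.conj_re, Complex.conj_im] at hneg
      linarith
    · simp only [eval_sub, eval_mul, eval_C]
      change K - K / G * G = 0
      rw [div_mul_cancel₀ _ hG, sub_self]
  have hev : ∀ (p : ℝ[X]) (y : ℝ), (p.map (algebraMap ℝ ℂ)).eval (y : ℂ) = ((p.eval y : ℝ) : ℂ) := by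
    intro p y
    rw [eval_map, ← Complex.coe_algebraMap, eval₂_at_apply]
  have hd : HasDerivAt φ (((derivative g).eval x * h.eval x - g.eval x * (derivative h).eval x : ℝ)
      * Complex.I) 0 := by
    have h1 : HasDerivAt (fun t : ℝ => (x : ℂ) + t * Complex.I) Complex.I 0 := by
      simpa using ((Complex.ofRealCLM.hasDerivAt (x := (0:ℝ))).mul_const Complex.I).const_add (x : ℂ)
    have h2 : HasDerivAt (fun t : ℝ => (x : ℂ) - t * Complex.I) (-Complex.I) 0 := by
      simpa using ((Complex.ofRealCLM.hasDerivAt (x := (0:ℝ))).mul_const Complex.I).const_sub (x : ℂ)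
    have h3 := (gc.hasDerivAt ((x : ℂ) + (0:ℝ) * Complex.I)).comp (0 : ℝ) h1
    have h4 := (hc.hasDerivAt ((x : ℂ) - (0:ℝ) * Complex.I)).comp (0 : ℝ) h2
    have h5 : HasDerivAt φ _ 0 := h3.mul h4
    refine h5.congr_deriv ?_
    simp only [Complex.ofReal_zero, zero_mul, add_zero, sub_zero, Function.comp_apply, gc, hc,
      derivative_map, hev]
    push_cast
    ring
  have him : HasDerivAt (fun t => (φ t).im)
      ((derivative g).eval x * h.eval x - g.eval x * (derivative h).eval x) 0 := by
    have h6 : HasDerivAt (fun t => (φ t).im) _ 0 :=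
      (Complex.imCLM.hasFDerivAt (x := φ 0)).comp_hasDerivAt (0 : ℝ) hd
    refine h6.congr_deriv ?_
    simp
  have h0 : (φ 0).im = 0 := by
    simp only [φ, Complex.ofReal_zero, zero_mul, add_zero, sub_zero, gc, hc, hev]
    rw [← Complex.ofReal_mul, Complex.ofReal_im]
  have hlim := him.tendsto_slope_zero_right
  refine ge_of_tendsto hlim ?_
  filter_upwards [self_mem_nhdsWithin] with t ht
  have ht' : 0 < t := ht
  simp only [zero_add, h0, sub_zero, smul_eq_mul]
  exact mul_nonneg (inv_nonneg.mpr ht'.le) (hφ t ht')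

/-- The quotient `g/h = ∑ α λ/(1 - λ y)` has nonnegative imaginary part on the upper half-plane,
whereas a root of `h - z g` would make it equal to `1/z`, whose imaginary part is negative. -/
theorem interlaces_of_weights {ι : Type*} [Fintype ι] [DecidableEq ι] {lam α : ι → ℝ}
    (hl : ∀ j, 0 ≤ lam j) (hα : ∀ j, 0 ≤ α j) :
    Interlaces (∏ j, (1 - C (lam j) * X))
      (∑ j, C (α j * lam j) * ∏ l ∈ Finset.univ.erase j, (1 - C (lam l) * X)) := by
  intro z hz y hy h0
  simp only [Polynomial.map_prod, Polynomial.map_sum, Polynomial.map_sub, Polynomial.map_one,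
    Polynomial.map_mul, map_C, map_X, eval_sub, eval_mul, eval_C, eval_prod, eval_finsetSum,
    eval_one, eval_X, Complex.coe_algebraMap] at h0
  have hne : ∀ j, (1 : ℂ) - lam j * y ≠ 0 := by
    intro j h1
    have him := congrArg Complex.im h1
    have hre := congrArg Complex.re h1
    simp at him hre
    rcases him with h | h
    · rw [h] at hre; simp at hre
    · exact hy.ne' h
  have hP : ∏ j, ((1 : ℂ) - lam j * y) ≠ 0 := Finset.prod_ne_zero_iff.mpr fun j _ => hne j
  have e : ∑ j, ((α j * lam j : ℝ) : ℂ) * ∏ l ∈ Finset.univ.erase j, ((1 : ℂ) - lam l * y) =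
      (∏ j, ((1 : ℂ) - lam j * y)) * ∑ j, ((α j * lam j : ℝ) : ℂ) / (1 - lam j * y) := by
    rw [Finset.mul_sum]
    refine Finset.sum_congr rfl fun j _ => ?_
    rw [← Finset.mul_prod_erase _ _ (Finset.mem_univ j)]
    rw [mul_assoc, mul_comm (∏ _ ∈ _, _), ← mul_assoc, mul_div_cancel₀ _ (hne j)]
  rw [e] at h0
  set T := ∑ j, ((α j * lam j : ℝ) : ℂ) / (1 - lam j * y) with hT
  have h1 : z * T = 1 := by
    have : (∏ j, ((1 : ℂ) - lam j * y)) * (1 - z * T) = 0 := by linear_combination h0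
    have := (mul_eq_zero.mp this).resolve_left hP
    linear_combination -this
  have hTim : 0 ≤ T.im := by
    rw [hT, Complex.im_sum]
    refine Finset.sum_nonneg fun j _ => ?_
    rw [Complex.div_im]
    simp only [Complex.ofReal_im, Complex.ofReal_re, Complex.sub_im, Complex.one_im,
      Complex.mul_im, zero_mul, add_zero, zero_sub, zero_div]
    rw [← neg_div]
    refine div_nonneg ?_ (Complex.normSq_nonneg _)
    have := mul_nonneg (mul_nonneg (hα j) (hl j)) (mul_nonneg (hl j) hy.le)
    linarith
  have hT2 : T = z⁻¹ := by
    rw [eq_comm, inv_eq_of_mul_eq_one_right h1]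
  rw [hT2, Complex.inv_im] at hTim
  have hz0 : 0 < Complex.normSq z := Complex.normSq_pos.mpr (by rintro rfl; simp at hz)
  have : -z.im / Complex.normSq z < 0 := div_neg_of_neg_of_pos (by linarith) hz0
  linarith

end ColSubset

/-! ### Choice of a term with small roots -/

namespace ColSubset

/-- If `G/H` is non-decreasing between the zeros of `H` and `H` decreases on `[0, y]`, then `G` is
positive on `[0, y]` as soon as it is positive at the two ends. -/
theorem pos_on_of_wronskian {H G : ℝ[X]} {y : ℝ} (hy : 0 ≤ y) (hH0 : 0 < H.eval 0)
    (hH : ∀ x, 0 ≤ x → x ≤ y → (derivative H).eval x < 0)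
    (hW : ∀ x, 0 ≤ (derivative G).eval x * H.eval x - G.eval x * (derivative H).eval x)
    (hG0 : 0 < G.eval 0) (hGy : 0 < G.eval y) : ∀ x, 0 ≤ x → x ≤ y → 0 < G.eval x := by
  have hanti : StrictAntiOn (fun x => H.eval x) (Set.Icc 0 y) := by
    refine strictAntiOn_of_deriv_neg (convex_Icc 0 y) H.continuous.continuousOn fun x hx => ?_
    rw [interior_Icc] at hx
    rw [Polynomial.deriv]
    exact hH x hx.1.le hx.2.le
  have hmono : ∀ {a b : ℝ}, (∀ x ∈ Set.Icc a b, H.eval x ≠ 0) → a ≤ b →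
      G.eval a / H.eval a ≤ G.eval b / H.eval b := by
    intro a b hne hab
    have hm : MonotoneOn (fun x => G.eval x / H.eval x) (Set.Icc a b) := by
      refine monotoneOn_of_deriv_nonneg (convex_Icc a b)
        (G.continuous.continuousOn.div H.continuous.continuousOn hne) ?_ ?_
      · intro x hx
        rw [interior_Icc] at hx
        exact (G.differentiable.differentiableAt.div H.differentiable.differentiableAt
          (hne x (Set.Ioo_subset_Icc_self hx))).differentiableWithinAt
      · intro x hx
        rw [interior_Icc] at hx
        have hd := (G.hasDerivAt x).fun_div (H.hasDerivAt x) (hne x (Set.Ioo_subset_Icc_self hx))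
        rw [hd.deriv]
        exact div_nonneg (hW x) (sq_nonneg _)
    exact hm (Set.left_mem_Icc.mpr hab) (Set.right_mem_Icc.mpr hab) hab
  -- `H` has at most one zero in `[0, y]`. To the left of it `G/H` is at least its positive value at
  -- `0`; to the right of it `G/H` is at most its negative value at `y`.
  have hleft : ∀ x, 0 ≤ x → x ≤ y → 0 < H.eval x →
      G.eval 0 / H.eval 0 * H.eval x ≤ G.eval x := by
    intro x hx0 hxy hHx
    have := hmono (a := 0) (b := x) (fun z hz => by
      have h1 : H.eval x ≤ H.eval z := hanti.antitoneOn ⟨hz.1, hz.2.trans hxy⟩ ⟨hx0, hxy⟩ hz.2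
      exact (hHx.trans_le h1).ne') hx0
    rwa [le_div_iff₀ hHx] at this
  have hright : ∀ x, 0 ≤ x → x ≤ y → H.eval x < 0 → 0 < G.eval x := by
    intro x hx0 hxy hHx
    have hHy : H.eval y < 0 :=
      lt_of_le_of_lt (hanti.antitoneOn ⟨hx0, hxy⟩ ⟨hy, le_rfl⟩ hxy) hHx
    have h1 := hmono (a := x) (b := y) (fun z hz => by
      have h1 : H.eval z ≤ H.eval x := hanti.antitoneOn ⟨hx0, hxy⟩ ⟨hx0.trans hz.1, hz.2⟩ hz.1
      exact (h1.trans_lt hHx).ne) hxy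
    have h2 : G.eval y / H.eval y < 0 := div_neg_of_pos_of_neg hGy hHy
    by_contra hneg
    have := div_nonneg_of_nonpos (not_lt.mp hneg) hHx.le
    linarith
  intro x hx0 hxy
  rcases lt_trichotomy (H.eval x) 0 with hHx | hHx | hHx
  · exact hright x hx0 hxy hHx
  · have hx0' : 0 < x := by
      rcases hx0.eq_or_lt with h | h
      · rw [← h] at hHx; exact absurd hHx hH0.ne'
      · exact h
    rcases hxy.eq_or_lt with h | hxy'
    · rw [h]; exact hGy
    have hHd := hH x hx0 hxy
    have hWx := hW x
    rw [hHx, mul_zero, zero_sub] at hWx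
    have hGx : 0 ≤ G.eval x := by
      by_contra hneg
      have := mul_pos_of_neg_of_neg (not_le.mp hneg) hHd
      linarith
    -- At the zero of `H` the Wronskian yields only `G ≥ 0`. If `G` were zero as well, then `G ≥ cH`
    -- on the left would give `G' ≤ cH' < 0`, and `G > 0` on the right would give `G' ≥ 0`.
    rcases hGx.eq_or_lt with hz | hz
    · exfalso
      set c := G.eval 0 / H.eval 0
      have hc : 0 < c := div_pos hG0 hH0
      have hK := (G - C c * H).hasDerivAt x
      have hGd := G.hasDerivAt x
      have hlim1 := hK.tendsto_slope_zero_left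
      have hlim2 := hGd.tendsto_slope_zero_right
      have h1 : (derivative (G - C c * H)).eval x ≤ 0 := by
        refine le_of_tendsto hlim1 ?_
        have : ∀ᶠ t in nhdsWithin (0 : ℝ) (Set.Iio 0), -x < t :=
          nhdsWithin_le_nhds (lt_mem_nhds (by linarith))
        filter_upwards [this, self_mem_nhdsWithin] with t ht ht0
        have ht0' : t < 0 := ht0
        have hHpos : 0 < H.eval (x + t) := by
          rw [← hHx]
          exact hanti ⟨by linarith, by linarith⟩ ⟨hx0, hxy⟩ (by linarith)
        have := hleft (x + t) (by linarith) (by linarith) hHpos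
        simp only [eval_sub, eval_mul, eval_C, ← hz, hHx, mul_zero, sub_zero, smul_eq_mul]
        exact mul_nonpos_of_nonpos_of_nonneg (inv_nonpos.mpr ht0'.le) (by linarith)
      have h2 : 0 ≤ (derivative G).eval x := by
        refine ge_of_tendsto hlim2 ?_
        have : ∀ᶠ t in nhdsWithin (0 : ℝ) (Set.Ioi 0), t < y - x :=
          nhdsWithin_le_nhds (gt_mem_nhds (by linarith))
        filter_upwards [this, self_mem_nhdsWithin] with t ht ht0
        have ht0' : 0 < t := ht0
        have hHneg : H.eval (x + t) < 0 := by
          rw [← hHx]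
          exact hanti ⟨hx0, hxy⟩ ⟨by linarith, by linarith⟩ (by linarith)
        have := hright (x + t) (by linarith) (by linarith) hHneg
        simp only [← hz, sub_zero, smul_eq_mul]
        exact mul_nonneg (inv_nonneg.mpr ht0'.le) this.le
      simp only [derivative_sub, derivative_mul, derivative_C, zero_mul, zero_add, eval_sub,
        eval_mul, eval_C] at h1
      have := mul_neg_of_pos_of_neg hc hHd
      linarith
    · exact hz
  · exact lt_of_lt_of_le (mul_pos (div_pos hG0 hH0) hHx) (hleft x hx0 hxy hHx)

/-- One polynomial of an interlacing family is as good as the sum. -/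
theorem exists_pos_of_sum {ι : Type*} {s : Finset ι} {w : ι → ℝ} {H : ℝ[X]} {G : ι → ℝ[X]}
    {Y : ℝ} (hw : ∀ i ∈ s, 0 < w i) (hH0 : 0 < H.eval 0) (hY : 0 < Y)
    (hH : ∀ x, 0 ≤ x → x < Y → 0 < (negDer H).eval x)
    (hsum : ∀ x, (negDer H).eval x = ∑ i ∈ s, w i * (G i).eval x)
    (hW : ∀ i ∈ s, ∀ x, 0 ≤ (derivative (G i)).eval x * H.eval x
      - (G i).eval x * (derivative H).eval x)
    (hG0 : ∀ i ∈ s, 0 < (G i).eval 0) :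
    ∃ i ∈ s, ∀ x, 0 ≤ x → x < Y → 0 < (G i).eval x := by
  by_contra hcon
  push Not at hcon
  choose! x hx0 hxY hxG using hcon
  have hne : s.Nonempty := by
    by_contra hemp
    rw [Finset.not_nonempty_iff_eq_empty] at hemp
    have := hH 0 le_rfl hY
    rw [hsum, hemp] at this
    simp at this
  -- At the largest of the bad points the sum is positive, hence so is some term `G i`. By the
  -- preceding lemma this `G i` is positive all the way down to `0`, thus also at its own bad point.
  obtain ⟨i₀, hi₀, hmax⟩ := s.exists_max_image x hne
  have h1 := hH (x i₀) (hx0 i₀ hi₀) (hxY i₀ hi₀)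
  rw [hsum] at h1
  obtain ⟨i, hi, hpos⟩ := Finset.exists_lt_of_sum_lt (s := s) (f := fun _ => (0:ℝ))
    (g := fun i => w i * (G i).eval (x i₀)) (by simpa using h1)
  have hGi : 0 < (G i).eval (x i₀) := by
    have := hw i hi
    exact (mul_pos_iff_of_pos_left this).mp hpos
  have := pos_on_of_wronskian (hx0 i₀ hi₀) hH0 (fun z hz hz' => by
    have := hH z hz (hz'.trans_lt (hxY i₀ hi₀))
    simpa [negDer] using this) (hW i hi) (hG0 i hi) hGi (x i) (hx0 i hi) (hmax i hi)
  exact absurd (hxG i hi) (not_le.mpr this)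

end ColSubset

/-! ### Characteristic polynomials of positive semidefinite matrices and rank-one updates -/

namespace ColSubset

section Spectral
variable {ι : Type*} [Fintype ι] [DecidableEq ι]

/-- `M = U diag(lam) Uᵀ` with `U` orthogonal and `lam ≥ 0`. -/
structure Diagonalizes (M U : Matrix ι ι ℝ) (lam : ι → ℝ) : Prop where
  eq : M = U * diagonal lam * Uᵀ
  left : Uᵀ * U = 1
  right : U * Uᵀ = 1
  nonneg : ∀ j, 0 ≤ lam j

theorem diagonalizes_of_posSemidef {M : Matrix ι ι ℝ} (hM : M.PosSemidef) :
    Diagonalizes M (hM.1.eigenvectorUnitary : Matrix ι ι ℝ) hM.1.eigenvalues := by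
  refine ⟨?_, ?_, ?_, hM.eigenvalues_nonneg⟩
  · have := hM.1.spectral_theorem
    rw [Unitary.conjStarAlgAut_apply] at this
    exact this
  · have := Unitary.coe_star_mul_self hM.1.eigenvectorUnitary
    rwa [star_eq_conjTranspose, conjTranspose_eq_transpose_of_trivial] at this
  · have := Unitary.coe_mul_star_self hM.1.eigenvectorUnitary
    rwa [Unitary.coe_star, star_eq_conjTranspose, conjTranspose_eq_transpose_of_trivial] at this

theorem eval_charpolyRev_eq (M : Matrix ι ι ℝ) (y : ℝ) :
    (charpolyRev M).eval y = (1 - y • M).det := by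
  rw [charpolyRev, ← coe_evalRingHom, RingHom.map_det]
  congr 1
  ext i j
  simp [Matrix.one_apply]
  split_ifs <;> simp [mul_comm]

theorem eval_charpoly_eq (M : Matrix ι ι ℝ) {x : ℝ} (hx : x ≠ 0) :
    M.charpoly.eval x = x ^ Fintype.card ι * (charpolyRev M).eval x⁻¹ := by
  rw [eval_charpoly, eval_charpolyRev_eq, ← det_smul]
  congr 1
  rw [smul_sub, smul_smul, mul_inv_cancel₀ hx, one_smul, scalar_apply, ← smul_one_eq_diagonal x]

namespace Diagonalizes
variable {M U : Matrix ι ι ℝ} {lam : ι → ℝ} (D : Diagonalizes M U lam)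
include D

theorem apply (a b : ι) : M a b = ∑ j, U a j * lam j * U b j := by
  rw [D.eq, Matrix.mul_apply]
  simp [Matrix.mul_diagonal]

theorem apply_self (i : ι) : M i i = ∑ j, U i j ^ 2 * lam j := by
  rw [D.apply]
  exact Finset.sum_congr rfl fun j _ => by ring

theorem apply_self_nonneg (i : ι) : 0 ≤ M i i := by
  rw [D.apply_self]
  exact Finset.sum_nonneg fun j _ => mul_nonneg (sq_nonneg _) (D.nonneg j)

theorem symm : Mᵀ = M := by
  rw [D.eq]; simp [Matrix.mul_assoc]

theorem sum_sq (j : ι) : ∑ i, U i j ^ 2 = 1 := by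
  have := congrFun (congrFun D.left j) j
  rw [Matrix.mul_apply, Matrix.one_apply_eq] at this
  rw [← this]
  exact Finset.sum_congr rfl fun i _ => by rw [transpose_apply]; ring

theorem det_conj (V : Matrix ι ι ℝ) : (U * V * Uᵀ).det = V.det := by
  rw [det_mul, det_mul, mul_right_comm, ← det_mul, D.right, det_one, one_mul]

theorem charpolyRev_eq : charpolyRev M = ∏ j, (1 - C (lam j) * X) := by
  apply Polynomial.funext
  intro y
  rw [eval_charpolyRev_eq, eval_prod]
  have : 1 - y • M = U * diagonal (fun j => 1 - lam j * y) * Uᵀ := by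
    have h1 : (diagonal fun j => 1 - lam j * y) = 1 - y • diagonal lam := by
      ext a b
      by_cases h : a = b
      · subst h; simp [mul_comm]
      · simp [h]
    rw [h1, Matrix.mul_sub, Matrix.sub_mul, Matrix.mul_one, D.right, D.eq]
    simp
  rw [this, D.det_conj, det_diagonal]
  simp

theorem trace_eq : M.trace = ∑ j, lam j := by
  rw [D.eq, trace_mul_comm, ← Matrix.mul_assoc, D.left, Matrix.one_mul, trace_diagonal]

theorem leftOf_charpolyRev : LeftOf 0 (charpolyRev M) := by
  rw [D.charpolyRev_eq]
  refine ⟨Splits.prod fun j _ => ?_, fun x hx => ?_⟩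
  · refine Splits.of_natDegree_le_one ?_
    compute_degree
  · rw [eval_prod]
    refine Finset.prod_pos fun j _ => ?_
    have := mul_nonpos_of_nonneg_of_nonpos (D.nonneg j) hx
    simp only [eval_sub, eval_one, eval_mul, eval_C, eval_X]
    linarith

end Diagonalizes

theorem natDegree_one_sub (c : ℝ) : (1 - C c * X : ℝ[X]).natDegree = if c = 0 then 0 else 1 := by
  split_ifs with h
  · simp [h]
  · have : (1 - C c * X : ℝ[X]) = C (-c) * X + C 1 := by simp; ring
    rw [this, natDegree_linear (neg_ne_zero.mpr h)]

theorem natDegree_prod_one_sub {κ : Type*} [Fintype κ] (lam : κ → ℝ) :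
    (∏ j, (1 - C (lam j) * X) : ℝ[X]).natDegree = (Finset.univ.filter fun j => lam j ≠ 0).card := by
  rw [natDegree_prod, Finset.card_filter]
  · refine Finset.sum_congr rfl fun j _ => ?_
    rw [natDegree_one_sub]
    split_ifs <;> simp_all
  · intro j _ h0
    have := congrArg (eval 0) h0
    simp at this

theorem natDegree_charpolyRev {M : Matrix ι ι ℝ} (hM : M.PosSemidef) :
    (charpolyRev M).natDegree = M.rank := by
  rw [(diagonalizes_of_posSemidef hM).charpolyRev_eq, natDegree_prod_one_sub,
    hM.1.rank_eq_card_non_zero_eigs, Fintype.card_subtype]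

/-- The Schur complement of the entry `(i, i)`, and `M` itself if this entry is `0`. -/
noncomputable def schurStep (M : Matrix ι ι ℝ) (i : ι) : Matrix ι ι ℝ :=
  if M i i = 0 then M else M - (M i i)⁻¹ • vecMulVec (fun a => M a i) (M i)

/-- The matrix determinant lemma for a rank-one perturbation. -/
theorem det_diagonal_add_vecMulVec {δ : ι → ℝ} (hδ : ∀ j, δ j ≠ 0) (u v : ι → ℝ) :
    (diagonal δ + vecMulVec u v).det = (∏ j, δ j) * (1 + ∑ j, u j * v j / δ j) := by
  have h := det_add_replicateCol_mul_replicateRow (ι := Unit) (A := diagonal δ)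
    (by rw [det_diagonal, isUnit_iff_ne_zero]; exact Finset.prod_ne_zero_iff.mpr fun j _ => hδ j) u v
  rw [← vecMulVec_eq] at h
  rw [h, det_diagonal]
  congr 1
  rw [det_unique]
  have hinv : (diagonal δ)⁻¹ = diagonal fun j => (δ j)⁻¹ := by
    apply inv_eq_right_inv
    rw [diagonal_mul_diagonal]
    ext a b
    by_cases hab : a = b
    · subst hab; simp [hδ a]
    · simp [hab]
  rw [hinv]
  simp only [Matrix.add_apply, Matrix.one_apply_eq, Matrix.mul_apply, replicateRow_apply,
    replicateCol_apply]
  congr 1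
  refine Finset.sum_congr rfl fun j _ => ?_
  simp [diagonal_apply, div_eq_mul_inv]
  ring

/-- The weighted sum of the `∏_{l ≠ j} (1 - lam l * X)`. -/
noncomputable def weighted (lam α : ι → ℝ) : ℝ[X] :=
  ∑ j, C (α j * lam j) * ∏ l ∈ Finset.univ.erase j, (1 - C (lam l) * X)

/-- In the eigenbasis `1 - y M` is diagonal and the Schur complement adds a rank-one matrix, so the
determinant lemma applies. As `M i i = ∑ U i j ^ 2 * lam j`, the factor `M i i` turns the result
into a sum of partial fractions. -/
theorem Diagonalizes.charpolyRev_schurStep {M U : Matrix ι ι ℝ} {lam : ι → ℝ}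
    (D : Diagonalizes M U lam) {i : ι} (hi : M i i ≠ 0) :
    C (M i i) * charpolyRev (schurStep M i) = weighted lam (fun j => U i j ^ 2) := by
  -- For `y < 0` all the factors `1 - lam j * y` are positive and may be divided by; infinitely many
  -- values determine a polynomial.
  refine eq_of_infinite_eval_eq _ _ ((Set.Iio_infinite (0 : ℝ)).mono fun y hy => ?_)
  have hy' : y < 0 := hy
  have hδ : ∀ j, 1 - lam j * y ≠ 0 := fun j => by
    have := mul_nonpos_of_nonneg_of_nonpos (D.nonneg j) hy'.le
    linarith
  set w := M i i with hw
  set u : ι → ℝ := fun j => lam j * U i j with hu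
  have hcol : ∀ a, M a i = (U *ᵥ u) a := by
    intro a
    rw [D.apply, mulVec, dotProduct]
    exact Finset.sum_congr rfl fun j _ => by rw [hu]; ring
  have hrow : ∀ a, M i a = (U *ᵥ u) a := by
    intro a
    rw [← hcol, ← transpose_apply M, D.symm]
  have key : 1 - y • schurStep M i = U * (diagonal (fun j => 1 - lam j * y) +
      vecMulVec ((y / w) • u) u) * Uᵀ := by
    have h1 : (diagonal fun j => 1 - lam j * y) = 1 - y • diagonal lam := by
      ext a b
      by_cases h : a = b
      · subst h; simp [mul_comm]
      · simp [h]
    have h2 : U * vecMulVec ((y / w) • u) u * Uᵀ = (y / w) • vecMulVec (U *ᵥ u) (U *ᵥ u) := by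
      rw [smul_vecMulVec, Matrix.mul_smul, Matrix.smul_mul, mul_vecMulVec, vecMulVec_mul,
        vecMul_transpose]
    have h3 : schurStep M i = M - w⁻¹ • vecMulVec (U *ᵥ u) (U *ᵥ u) := by
      rw [schurStep, if_neg hi, ← funext hcol, hw]
      congr 3
      ext a
      rw [hrow, hcol]
    rw [h3, h1, Matrix.mul_add, Matrix.add_mul, h2, Matrix.mul_sub, Matrix.sub_mul,
      Matrix.mul_one, D.right, Matrix.mul_smul, Matrix.smul_mul, ← D.eq, smul_sub, smul_smul,
      div_eq_mul_inv]
    abel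
  rw [Set.mem_ofPred_eq, eval_mul, eval_C, eval_charpolyRev_eq, key, D.det_conj, det_diagonal_add_vecMulVec hδ,
    weighted, eval_finsetSum]
  have hwsum : w = ∑ j, U i j ^ 2 * lam j := D.apply_self i
  have e1 : w * (1 + ∑ j, ((y / w) • u) j * u j / (1 - lam j * y)) =
      ∑ j, U i j ^ 2 * lam j / (1 - lam j * y) := by
    rw [mul_add, mul_one, Finset.mul_sum]
    nth_rewrite 1 [hwsum]
    rw [← Finset.sum_add_distrib]
    refine Finset.sum_congr rfl fun j _ => ?_
    have := hδ j
    simp only [hu, Pi.smul_apply, smul_eq_mul]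
    have hw0 : w ≠ 0 := hi
    rw [eq_div_iff (hδ j), add_mul]
    field_simp
    ring
  rw [mul_left_comm, e1, Finset.mul_sum]
  refine Finset.sum_congr rfl fun j _ => ?_
  rw [← Finset.mul_prod_erase _ _ (Finset.mem_univ j)]
  simp only [eval_mul, eval_C, eval_prod, eval_sub, eval_one, eval_X]
  rw [mul_div_assoc', div_eq_iff (hδ j)]
  ring

/-- The weights belonging to each `j` add up to `1`, so what remains is the product rule. -/
theorem sum_weighted (lam : ι → ℝ) (α : ι → ι → ℝ) (hα : ∀ j, ∑ i, α i j = 1) :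
    ∑ i, weighted lam (α i) = negDer (∏ j, (1 - C (lam j) * X)) := by
  simp only [weighted]
  rw [Finset.sum_comm, negDer, derivative_prod_finset, ← Finset.sum_neg_distrib]
  refine Finset.sum_congr rfl fun j _ => ?_
  rw [← Finset.sum_mul, ← map_sum, ← Finset.sum_mul, hα, one_mul]
  simp only [derivative_sub, derivative_one, derivative_mul, derivative_C, derivative_X, zero_mul,
    zero_add, mul_one, zero_sub, mul_neg, neg_neg]
  ring

theorem rank_add_le' {m n : Type*} [Fintype m] [Fintype n] (A B : Matrix m n ℝ) :
    (A + B).rank ≤ A.rank + B.rank := by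
  rw [rank, rank, rank, mulVecLin_add]
  refine (Submodule.finrank_mono ?_).trans (Submodule.finrank_add_le_finrank_add_finrank _ _)
  rintro _ ⟨x, rfl⟩
  exact Submodule.add_mem_sup ⟨x, rfl⟩ ⟨x, rfl⟩

theorem rank_schurStep {κ : Type*} [Fintype κ] (M : Matrix κ κ ℝ) (i : κ) : M.rank ≤ (schurStep M i).rank + 1 := by
  rw [schurStep]
  split_ifs with h
  · omega
  · have h1 := rank_add_le' (M - (M i i)⁻¹ • vecMulVec (fun a => M a i) (M i))
      (vecMulVec ((M i i)⁻¹ • fun a => M a i) (M i))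
    rw [← smul_vecMulVec, sub_add_cancel] at h1
    rw [← smul_vecMulVec]
    have h2 := rank_vecMulVec_le ((M i i)⁻¹ • fun a => M a i) (M i)
    omega

theorem trace_schurStep_le {M : Matrix ι ι ℝ} (hM : M.PosSemidef) (i : ι) :
    (schurStep M i).trace ≤ M.trace := by
  rw [schurStep]
  split_ifs with h
  · exact le_rfl
  · have hD := diagonalizes_of_posSemidef hM
    rw [trace_sub, trace_smul, sub_le_self_iff, smul_eq_mul]
    refine mul_nonneg (inv_nonneg.mpr (hD.apply_self_nonneg i)) ?_
    rw [Matrix.trace]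
    refine Finset.sum_nonneg fun a _ => ?_
    rw [diag_apply, vecMulVec_apply, ← transpose_apply M, hD.symm]
    exact mul_self_nonneg _

end Spectral
end ColSubset

/-! ### Gram matrices of residuals -/

namespace ColSubset

section Residual
variable {n d : ℕ} (A : Matrix (Fin n) (Fin d) ℝ)

/-- The orthogonal projection onto the span of the columns indexed by `S`. -/
noncomputable def proj (S : Finset (Fin d)) : Matrix (Fin n) (Fin n) ℝ :=
  cols A S * pinv (cols A S)

/-- The Gram matrix of the residual. -/
noncomputable def gram (S : Finset (Fin d)) : Matrix (Fin d) (Fin d) ℝ :=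
  (residual A S)ᵀ * residual A S

theorem proj_symm (S : Finset (Fin d)) : (proj A S)ᵀ = proj A S :=
  (isMoorePenrose_pinv (cols A S)).symm_left

theorem proj_mul_apply (S : Finset (Fin d)) {j : Fin d} (hj : j ∈ S) (r : Fin n) :
    (proj A S * A) r j = A r j := by
  have h := congrFun (congrFun (isMoorePenrose_pinv (cols A S)).mul_mul_left r) ⟨j, hj⟩
  exact h

theorem exists_proj_eq (S : Finset (Fin d)) :
    ∃ Y : Matrix (Fin d) (Fin n) ℝ, proj A S = A * Y ∧ ∀ j ∉ S, Y j = 0 := by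
  refine ⟨of fun j => if h : j ∈ S then pinv (cols A S) ⟨j, h⟩ else 0, ?_, fun j hj => ?_⟩
  · ext a b
    rw [proj, Matrix.mul_apply, Matrix.mul_apply, ← Finset.sum_subset (Finset.subset_univ S)]
    · rw [← Finset.sum_coe_sort S]
      refine Finset.sum_congr rfl fun j _ => ?_
      simp [cols]
    · intro j _ hj
      simp [hj]
  · ext b
    simp [hj]

/-- Each of `Q` and the projection fixes the range of the other: `P Q = Q` and `Q P = P`. Both are
symmetric, so transposing the second identity gives `P Q = P`. -/
theorem proj_unique {S : Finset (Fin d)} {Q : Matrix (Fin n) (Fin n) ℝ} (hQ : Qᵀ = Q)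
    (hfix : ∀ j ∈ S, ∀ r, (Q * A) r j = A r j) {Z : Matrix (Fin d) (Fin n) ℝ} (hZ : Q = A * Z)
    (hZ0 : ∀ j ∉ S, Z j = 0) : Q = proj A S := by
  have key : ∀ (P : Matrix (Fin n) (Fin n) ℝ), (∀ j ∈ S, ∀ r, (P * A) r j = A r j) →
      ∀ Y : Matrix (Fin d) (Fin n) ℝ, (∀ j ∉ S, Y j = 0) → P * (A * Y) = A * Y := by
    intro P hP Y hY
    rw [← Matrix.mul_assoc]
    ext a b
    rw [Matrix.mul_apply, Matrix.mul_apply]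
    refine Finset.sum_congr rfl fun j _ => ?_
    by_cases hj : j ∈ S
    · rw [hP j hj]
    · simp [hY j hj]
  obtain ⟨Y, hY, hY0⟩ := exists_proj_eq A S
  have h1 := key (proj A S) (fun j hj r => proj_mul_apply A S hj r) Z hZ0
  have h2 := key Q hfix Y hY0
  rw [← hZ] at h1
  rw [← hY] at h2
  have h3 := congrArg transpose h2
  rw [transpose_mul, proj_symm, hQ] at h3
  rw [← h1, h3]

theorem proj_mul_proj (S : Finset (Fin d)) : proj A S * proj A S = proj A S := by
  have := (isMoorePenrose_pinv (cols A S)).mul_mul_left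
  rw [proj, ← Matrix.mul_assoc, this]

theorem residual_eq (S : Finset (Fin d)) : residual A S = (1 - proj A S) * A := by
  rw [residual, Matrix.sub_mul, Matrix.one_mul, proj]

theorem transpose_mul_residual (S : Finset (Fin d)) : Aᵀ * residual A S = gram A S := by
  rw [gram, residual_eq, transpose_mul, transpose_sub, transpose_one, proj_symm]
  have : (1 - proj A S) * (1 - proj A S) = 1 - proj A S := by
    simp [Matrix.sub_mul, Matrix.mul_sub, proj_mul_proj]
  rw [Matrix.mul_assoc, ← Matrix.mul_assoc (1 - proj A S), this]

theorem gram_posSemidef (S : Finset (Fin d)) : (gram A S).PosSemidef := by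
  have := posSemidef_conjTranspose_mul_self (residual A S)
  rwa [conjTranspose_eq_transpose_of_trivial] at this

theorem gram_symm (S : Finset (Fin d)) : (gram A S)ᵀ = gram A S := by
  rw [gram, transpose_mul, transpose_transpose]

theorem gram_empty : gram A ∅ = Aᵀ * A := by
  rw [← transpose_mul_residual, residual]
  have : cols A ∅ * pinv (cols A ∅) = 0 := by
    ext a b
    rw [Matrix.mul_apply]
    simp
  rw [this, Matrix.zero_mul, sub_zero]

theorem gram_apply_of_mem {S : Finset (Fin d)} {i : Fin d} (hi : i ∈ S) (a : Fin d) :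
    gram A S a i = 0 := by
  rw [← transpose_mul_residual, Matrix.mul_apply]
  refine Finset.sum_eq_zero fun r _ => ?_
  have : residual A S r i = 0 := by
    have := proj_mul_apply A S hi r
    rw [residual_eq, Matrix.sub_mul, Matrix.one_mul, Matrix.sub_apply, this, sub_self]
  rw [this, mul_zero]

theorem gram_eq_proj (S : Finset (Fin d)) : gram A S = Aᵀ * A - Aᵀ * proj A S * A := by
  rw [← transpose_mul_residual, residual_eq, Matrix.sub_mul, Matrix.one_mul, Matrix.mul_sub,
    Matrix.mul_assoc]

/-- A Gram-Schmidt step. The residual `r` of column `i` is orthogonal to the span of `S`, and its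
squared length is the diagonal entry. If the entry is zero, the column lies in the span and the
projection does not change; otherwise the new projection is the old one plus `r rᵀ` divided by the
entry. -/
theorem gram_insert (S : Finset (Fin d)) (i : Fin d) :
    gram A (insert i S) = schurStep (gram A S) i := by
  set r : Fin n → ℝ := fun a => residual A S a i with hr
  have hrA : ∀ j, ∑ a, A a j * r a = gram A S j i := by
    intro j
    rw [← transpose_mul_residual, Matrix.mul_apply]
    rfl
  obtain ⟨Y, hY, hY0⟩ := exists_proj_eq A S
  by_cases h0 : gram A S i i = 0
  · have hr0 : ∀ a, r a = 0 := by
      have h1 : ∑ a, r a * r a = 0 := by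
        rw [← h0, gram, Matrix.mul_apply]; rfl
      rw [Finset.sum_eq_zero_iff_of_nonneg fun a _ => mul_self_nonneg _] at h1
      exact fun a => mul_self_eq_zero.mp (h1 a (Finset.mem_univ a))
    have hP : proj A S = proj A (insert i S) := by
      refine proj_unique A (proj_symm A S) ?_ hY fun j hj => hY0 j fun h => hj (by simp [h])
      intro j hj a
      rcases Finset.mem_insert.mp hj with rfl | hj
      · have := hr0 a
        rw [hr] at this
        simp only [residual_eq, Matrix.sub_mul, Matrix.one_mul, Matrix.sub_apply] at this
        linarith
      · exact proj_mul_apply A S hj a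
    rw [schurStep, if_pos h0, gram_eq_proj, gram_eq_proj, hP]
  · set c := (gram A S i i)⁻¹ with hc
    have hP : proj A S + c • vecMulVec r r = proj A (insert i S) := by
      -- `proj_unique` asks for the new projection as a combination of columns in `insert i S`; this
      -- provides the coefficients for `r`.
      have hr2 : r = A *ᵥ (Pi.single i 1 - Y *ᵥ (fun a => A a i)) := by
        rw [mulVec_sub, mulVec_mulVec, ← hY]
        ext a
        rw [hr, residual_eq, Matrix.sub_mul, Matrix.one_mul, mulVec_single_one]
        rfl
      refine proj_unique A (Z := Y + c • vecMulVec (Pi.single i 1 - Y *ᵥ (fun a => A a i)) r)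
        ?_ ?_ ?_ ?_
      · rw [transpose_add, transpose_smul, proj_symm, transpose_vecMulVec]
      · intro j hj a
        rw [Matrix.add_mul, Matrix.smul_mul, Matrix.add_apply, Matrix.smul_apply,
          vecMulVec_mul, vecMulVec_apply]
        have h1 : (r ᵥ* A) j = gram A S i j := by
          rw [← gram_symm, transpose_apply, ← hrA, vecMul, dotProduct]
          exact Finset.sum_congr rfl fun b _ => mul_comm _ _
        rw [h1]
        rcases Finset.mem_insert.mp hj with rfl | hj
        · rw [smul_eq_mul, mul_comm (r a), ← mul_assoc, hc, inv_mul_cancel₀ h0, one_mul, hr]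
          simp only [residual_eq, Matrix.sub_mul, Matrix.one_mul, Matrix.sub_apply]
          ring
        · rw [gram_apply_of_mem A hj, proj_mul_apply A S hj]
          simp
      · rw [Matrix.mul_add, ← hY, Matrix.mul_smul, mul_vecMulVec, ← hr2]
      · intro j hj
        rw [Finset.mem_insert, not_or] at hj
        ext b
        have : (Y *ᵥ fun a => A a i) j = 0 := by
          rw [mulVec, hY0 j hj.2, zero_dotProduct]
        simp [hY0 j hj.2, vecMulVec_apply, this, hj.1]
    rw [schurStep, if_neg h0, gram_eq_proj A (insert i S), ← hP, Matrix.mul_add, Matrix.add_mul,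
      Matrix.mul_smul, Matrix.smul_mul, mul_vecMulVec, vecMulVec_mul]
    have h1 : Aᵀ *ᵥ r = fun a => gram A S a i := by
      ext a; rw [← hrA]; rfl
    have h2 : r ᵥ* A = gram A S i := by
      ext j
      rw [← gram_symm, transpose_apply, ← hrA, vecMul, dotProduct]
      exact Finset.sum_congr rfl fun b _ => mul_comm _ _
    rw [h1, h2, sub_add_eq_sub_sub, ← gram_eq_proj]

/-- A Schur step lowers the rank by at most one. This keeps the degree of `charpolyRev (gram A S)`
high enough for the `k - S.card` differentiations. -/
theorem rank_gram (S : Finset (Fin d)) : A.rank ≤ (gram A S).rank + S.card := by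
  induction S using Finset.induction_on with
  | empty => rw [gram_empty, rank_transpose_mul_self]; simp
  | insert i S hi ih =>
    rw [gram_insert, Finset.card_insert_of_notMem hi]
    have := rank_schurStep (gram A S) i
    omega

theorem trace_gram_le (S : Finset (Fin d)) : (gram A S).trace ≤ (Aᵀ * A).trace := by
  induction S using Finset.induction_on with
  | empty => rw [gram_empty]
  | insert i S hi ih =>
    rw [gram_insert]
    exact (trace_schurStep_le (gram_posSemidef A S) i).trans ih

end Residual
end ColSubset

/-! ### The polynomials of the greedy algorithm -/

namespace ColSubset

/-- The chain rule for `x ^ d * F(1/x)`. Working with values at `x ≠ 0` instead of reversed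
polynomials avoids all bookkeeping of degrees. -/
theorem eval_polarOp {d : ℕ} {p F : ℝ[X]} (h : ∀ x ≠ 0, p.eval x = x ^ d * F.eval x⁻¹) :
    ∀ x ≠ 0, (polarOp d p).eval x = x ^ d * (negDer F).eval x⁻¹ := by
  intro x hx
  have h1 : HasDerivAt (fun y => y ^ d * F.eval y⁻¹)
      (d * x ^ (d - 1) * F.eval x⁻¹ + x ^ d * ((derivative F).eval x⁻¹ * -(x ^ 2)⁻¹)) x :=
    (hasDerivAt_pow d x).mul ((F.hasDerivAt x⁻¹).comp x (hasDerivAt_inv hx))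
  have h2 : (fun y => p.eval y) =ᶠ[nhds x] fun y => y ^ d * F.eval y⁻¹ := by
    filter_upwards [isOpen_ne.mem_nhds hx] with y hy using h y hy
  have h3 := (p.hasDerivAt x).unique (h1.congr_of_eventuallyEq h2)
  rw [polarOp, negDer]
  simp only [eval_sub, eval_mul, eval_pow, eval_X, eval_C, eval_neg]
  rw [h3, h x hx]
  -- The exponent `d - 1` is truncated, so `d = 0` is separate.
  rcases d with _ | d
  · field_simp
    simp
  · rw [Nat.add_sub_cancel]
    field_simp
    ring

theorem eval_polarOp_iterate {d : ℕ} {p F : ℝ[X]} (h : ∀ x ≠ 0, p.eval x = x ^ d * F.eval x⁻¹)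
    (k : ℕ) : ∀ x ≠ 0, ((polarOp d)^[k] p).eval x = x ^ d * (negDer^[k] F).eval x⁻¹ := by
  induction k with
  | zero => exact h
  | succ k ih =>
    simp only [Function.iterate_succ_apply']
    exact eval_polarOp ih

section
variable {n d : ℕ} (A : Matrix (Fin n) (Fin d) ℝ) (k : ℕ)

/-- The polynomial `F` with `p̂_S(x) = x ^ d * F(1/x)`. -/
noncomputable def hatRev (S : Finset (Fin d)) : ℝ[X] :=
  negDer^[k - S.card] (charpolyRev (gram A S))

theorem eval_pHat (S : Finset (Fin d)) {x : ℝ} (hx : x ≠ 0) :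
    (pHat A k S).eval x = x ^ d * (hatRev A k S).eval x⁻¹ := by
  refine eval_polarOp_iterate (fun x hx => ?_) _ x hx
  rw [pPoly, ← gram, eval_charpoly_eq _ hx, Fintype.card_fin]

variable {A k}

theorem hatRev_leftOf {S : Finset (Fin d)} (hk : k ≤ A.rank) (hS : S.card ≤ k) :
    LeftOf 0 (hatRev A k S) := by
  refine (diagonalizes_of_posSemidef (gram_posSemidef A S)).leftOf_charpolyRev.iterate _ ?_
  rw [natDegree_charpolyRev (gram_posSemidef A S)]
  have := rank_gram A S
  omega

theorem natDegree_hatRev (S : Finset (Fin d)) :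
    (hatRev A k S).natDegree = (gram A S).rank - (k - S.card) := by
  rw [hatRev, natDegree_negDer_iterate, natDegree_charpolyRev (gram_posSemidef A S)]

/-- Here and in the next lemma, roots of `pHat` beyond `ρ` correspond to roots of `hatRev` in the
interval `(0, ρ⁻¹)` by `x ↦ 1/x`. -/
theorem hatRev_pos_of_roots_le {S : Finset (Fin d)} (hk : k ≤ A.rank) (hS : S.card ≤ k) {ρ : ℝ}
    (hρ : 0 < ρ) (h : ∀ x, (pHat A k S).IsRoot x → x ≤ ρ) {y : ℝ} (hy : y < ρ⁻¹) :
    0 < (hatRev A k S).eval y := by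
  refine ((hatRev_leftOf hk hS).of_no_root (a := y) fun x hx hxy h0 => ?_).pos y le_rfl
  have h1 : (pHat A k S).IsRoot x⁻¹ := by
    rw [IsRoot, eval_pHat A k S (inv_ne_zero hx.ne'), inv_inv, h0, mul_zero]
  have h2 := h _ h1
  have h3 : ρ⁻¹ ≤ x := by
    rw [inv_le_comm₀ hρ hx]; exact h2
  linarith

theorem roots_le_of_hatRev_pos {S : Finset (Fin d)} {ρ : ℝ}
    (hρ : 0 < ρ) (h : ∀ y, 0 ≤ y → y < ρ⁻¹ → 0 < (hatRev A k S).eval y) {x : ℝ}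
    (hx : (pHat A k S).IsRoot x) : x ≤ ρ := by
  by_contra hlt
  rw [not_le] at hlt
  have hx0 : 0 < x := hρ.trans hlt
  rw [IsRoot, eval_pHat A k S hx0.ne'] at hx
  have := h x⁻¹ (inv_pos.mpr hx0).le (by rwa [inv_lt_inv₀ hx0 hρ])
  rcases mul_eq_zero.mp hx with h1 | h1
  · exact pow_ne_zero d hx0.ne' h1
  · linarith

theorem negDer_iterate_sum {ι : Type*} (s : Finset ι) (F : ι → ℝ[X]) (k : ℕ) :
    negDer^[k] (∑ i ∈ s, F i) = ∑ i ∈ s, negDer^[k] (F i) := by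
  induction k with
  | zero => rfl
  | succ k ih =>
    simp only [Function.iterate_succ_apply', ih, negDer, derivative_sum, Finset.sum_neg_distrib]

theorem negDer_iterate_C_mul (c : ℝ) (F : ℝ[X]) (k : ℕ) :
    negDer^[k] (C c * F) = C c * negDer^[k] F := by
  induction k with
  | zero => rfl
  | succ k ih => simp [Function.iterate_succ_apply', ih, negDer]

/-- Columns with a zero diagonal entry thus contribute nothing to the sum in `sum_weighted`. -/
theorem weighted_eq_zero {ι : Type*} [Fintype ι] [DecidableEq ι] {lam α : ι → ℝ}
    (hl : ∀ j, 0 ≤ lam j) (hα : ∀ j, 0 ≤ α j) (h : ∑ j, α j * lam j = 0) :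
    weighted lam α = 0 := by
  rw [Finset.sum_eq_zero_iff_of_nonneg fun j _ => mul_nonneg (hα j) (hl j)] at h
  refine Finset.sum_eq_zero fun j hj => ?_
  rw [h j hj, map_zero, zero_mul]

/-- Some column does not increase the largest root. -/
theorem exists_insert_roots_le {S : Finset (Fin d)} (hk : k < A.rank) (hS : S.card < k) {ρ : ℝ}
    (hρ : 0 < ρ) (h : ∀ x, (pHat A k S).IsRoot x → x ≤ ρ) :
    ∃ i ∉ S, ∀ x, (pHat A k (insert i S)).IsRoot x → x ≤ ρ := by
  obtain ⟨κ, hκ⟩ : ∃ κ, k - S.card = κ + 1 := ⟨k - S.card - 1, by omega⟩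
  set M := gram A S with hM
  have hPSD := gram_posSemidef A S
  rw [← hM] at hPSD
  have D := diagonalizes_of_posSemidef hPSD
  generalize (hPSD.1.eigenvectorUnitary : Matrix (Fin d) (Fin d) ℝ) = U at D
  generalize hPSD.1.eigenvalues = lam at D
  have hrank := rank_gram A S
  rw [← hM] at hrank
  have hdeg : (charpolyRev M).natDegree = M.rank := natDegree_charpolyRev hPSD
  -- One differentiation short of `hatRev A k S`, which is therefore `-H'`. The assumption on the
  -- roots makes it positive on `[0, ρ⁻¹)`.
  set H := negDer^[κ] (charpolyRev M) with hH
  have hLH : LeftOf 0 H := D.leftOf_charpolyRev.iterate _ (by omega)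
  -- Only these columns enter the combination: the diagonal entries of members of `S` vanish, and so
  -- do those of columns in their span.
  set s := Finset.univ.filter fun i => 0 < M i i with hs
  have hsM : ∀ i ∈ s, 0 < M i i := fun i hi => (Finset.mem_filter.mp hi).2
  have hnotin : ∀ i ∈ s, i ∉ S := fun i hi hiS => by
    have := hsM i hi
    rw [hM, gram_apply_of_mem A hiS] at this
    exact lt_irrefl _ this
  have hcard : ∀ i ∈ s, k - (insert i S).card = κ := fun i hi => by
    rw [Finset.card_insert_of_notMem (hnotin i hi)]; omega
  have hG : ∀ i ∈ s, hatRev A k (insert i S) = negDer^[κ] (charpolyRev (schurStep M i)) :=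
    fun i hi => by rw [hatRev, gram_insert, hcard i hi]
  have hwG : ∀ i ∈ s, C (M i i) * hatRev A k (insert i S) =
      negDer^[κ] (weighted lam fun j => U i j ^ 2) := fun i hi => by
    rw [hG i hi, ← negDer_iterate_C_mul, D.charpolyRev_schurStep (hsM i hi).ne']
  have hsumpoly : negDer H = ∑ i ∈ s, C (M i i) * hatRev A k (insert i S) := by
    have hcomm : negDer H = negDer^[κ] (negDer (charpolyRev M)) := by
      rw [hH, ← Function.iterate_succ_apply, Function.iterate_succ_apply']
    rw [Finset.sum_congr rfl hwG, ← negDer_iterate_sum, hcomm, D.charpolyRev_eq,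
      ← sum_weighted lam (fun i j => U i j ^ 2) D.sum_sq]
    congr 1
    symm
    refine Finset.sum_subset (Finset.subset_univ s) fun i _ hi => ?_
    refine weighted_eq_zero D.nonneg (fun j => sq_nonneg _) ?_
    rw [← D.apply_self]
    refine le_antisymm ?_ (D.apply_self_nonneg i)
    by_contra hcon
    exact hi (Finset.mem_filter.mpr ⟨Finset.mem_univ i, not_le.mp hcon⟩)
  have hF : hatRev A k S = negDer H := by
    rw [hatRev, hκ, Function.iterate_succ_apply']
  obtain ⟨i, hi, hpos⟩ := exists_pos_of_sum (s := s) (w := fun i => M i i) (H := H)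
    (G := fun i => hatRev A k (insert i S)) (Y := ρ⁻¹) hsM (hLH.pos 0 le_rfl) (inv_pos.mpr hρ)
    (fun x _ hx => by
      rw [← hF]; exact hatRev_pos_of_roots_le hk.le hS.le hρ h hx)
    (fun x => by
      rw [hsumpoly, eval_finsetSum]
      simp)
    (fun i hi x => by
      -- Interlacing holds before differentiation because the weights `U i j ^ 2` are nonnegative;
      -- it survives `κ` derivatives. Dividing the Wronskian by `M i i > 0` passes to `hatRev`.
      have hI := ((interlaces_of_weights D.nonneg (α := fun j => U i j ^ 2)
        fun j => sq_nonneg _).iterate κ (by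
          rw [← D.charpolyRev_eq]; omega)).wronskian_nonneg x
      rw [← D.charpolyRev_eq, ← hH] at hI
      change 0 ≤ (derivative (negDer^[κ] (weighted lam fun j => U i j ^ 2))).eval x * H.eval x -
        (negDer^[κ] (weighted lam fun j => U i j ^ 2)).eval x * (derivative H).eval x at hI
      rw [← hwG i hi] at hI
      simp only [derivative_C_mul, eval_mul, eval_C] at hI
      refine nonneg_of_mul_nonneg_right (a := M i i) ?_ (hsM i hi)
      linarith)
    (fun i hi => by
      refine (hatRev_leftOf hk.le ?_).pos 0 le_rfl
      rw [Finset.card_insert_of_notMem (hnotin i hi)]; omega)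
  exact ⟨i, hnotin i hi, fun x hx => roots_le_of_hatRev_pos hρ hpos hx⟩

/-! ### Runs of the greedy algorithm -/

/-- The columns chosen before iteration `l`. -/
def chosen {k : ℕ} (j : Fin k → Fin d) (l : ℕ) : Finset (Fin d) :=
  (Finset.univ.filter fun m : Fin k => m.val < l).image j

theorem chosenBefore_eq {k : ℕ} (j : Fin k → Fin d) (l : Fin k) :
    chosenBefore j l = chosen j l := rfl

theorem chosen_zero {k : ℕ} (j : Fin k → Fin d) : chosen j 0 = ∅ := by
  simp [chosen]

theorem chosen_succ {k : ℕ} (j : Fin k → Fin d) (l : Fin k) :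
    chosen j (l + 1) = insert (j l) (chosen j l) := by
  ext i
  simp only [chosen, Finset.mem_image, Finset.mem_filter, Finset.mem_univ, true_and,
    Finset.mem_insert]
  constructor
  · rintro ⟨m, hm, rfl⟩
    rcases Nat.lt_succ_iff_lt_or_eq.mp hm with h | h
    · exact Or.inr ⟨m, h, rfl⟩
    · exact Or.inl (congrArg j (Fin.ext h))
  · rintro (rfl | ⟨m, hm, rfl⟩)
    · exact ⟨l, Nat.lt_succ_self _, rfl⟩
    · exact ⟨m, Nat.lt_succ_of_lt hm, rfl⟩

theorem chosen_all {k : ℕ} (j : Fin k → Fin d) : chosen j k = Finset.univ.image j := by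
  simp [chosen]

theorem card_chosen {k : ℕ} {j : Fin k → Fin d} (hj : ∀ l : Fin k, j l ∉ chosenBefore j l) {l : ℕ}
    (hl : l ≤ k) : (chosen j l).card = l := by
  induction l with
  | zero => simp [chosen_zero]
  | succ l ih =>
    have h1 := chosen_succ j ⟨l, hl⟩
    have h2 := hj ⟨l, hl⟩
    rw [chosenBefore_eq] at h2
    change chosen j (l + 1) = _ at h1
    rw [h1, Finset.card_insert_of_notMem h2, ih (by omega)]

/-- In each iteration some column `i` preserves the current bound. The column chosen has a value of
`μ` that is no larger, and each of the two approximations costs at most `ε`. -/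
theorem greedy_roots_le {ε : ℝ} {j : Fin k → Fin d} {μ : Fin k → Fin d → ℝ} (hε : 0 < ε)
    (hk : k < A.rank) (hrun : IsGreedyRun A k ε j μ) {B : ℝ} (hB : 0 < B)
    (h0 : ∀ x, (pHat A k ∅).IsRoot x → x ≤ B) {l : ℕ} (hl : l ≤ k) :
    ∀ x, (pHat A k (chosen j l)).IsRoot x → x ≤ 2 * l * ε + B := by
  induction l with
  | zero => simpa [chosen_zero] using h0
  | succ l ih =>
    have hcard := card_chosen hrun.choice_new (l := l) (by omega)
    obtain ⟨i, hi, hroots⟩ := exists_insert_roots_le (S := chosen j l) hk (by omega)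
      (ρ := 2 * l * ε + B) (by positivity) (ih (by omega))
    obtain ⟨r, hr, hrμ⟩ := hrun.approx ⟨l, hl⟩ i hi
    obtain ⟨r', hr', hrμ'⟩ := hrun.approx ⟨l, hl⟩ _ (hrun.choice_new ⟨l, hl⟩)
    have hmin := hrun.choice_min ⟨l, hl⟩ i hi
    intro x hx
    rw [chosen_succ j ⟨l, hl⟩] at hx
    have h1 := hr'.2 hx
    have h2 := hroots r hr.1
    rw [abs_le] at hrμ hrμ'
    push_cast
    linarith [hrμ.1, hrμ.2, hrμ'.1, hrμ'.2]

end
end ColSubset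

/-! ### The bound for the greedy algorithm -/

namespace ColSubset

section
variable {n d : ℕ} (A : Matrix (Fin n) (Fin d) ℝ)

open scoped Matrix.Norms.L2Operator in
-- By the C*-identity the square is the norm of `M`. Orthogonal factors do not change it, and a
-- diagonal matrix has the supremum norm of its entries.
theorem specNorm_sq {B : Matrix (Fin n) (Fin d) ℝ} {M U : Matrix (Fin d) (Fin d) ℝ} {lam : Fin d → ℝ}
    (hM : Bᵀ * B = M) (D : Diagonalizes M U lam) : specNorm B ^ 2 = ‖lam‖ := by
  have h1 : specNorm B ^ 2 = ‖M‖ := by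
    rw [← hM, ← conjTranspose_eq_transpose_of_trivial, l2_opNorm_conjTranspose_mul_self, specNorm, sq]
  have hU : U ∈ unitaryGroup (Fin d) ℝ := by
    rw [mem_unitaryGroup_iff, star_eq_conjTranspose, conjTranspose_eq_transpose_of_trivial, D.right]
  have hUt : Uᵀ ∈ unitaryGroup (Fin d) ℝ := by
    rw [mem_unitaryGroup_iff, star_eq_conjTranspose, conjTranspose_eq_transpose_of_trivial,
      transpose_transpose, D.left]
  rw [h1, D.eq, CStarRing.norm_mul_mem_unitary _ hUt, CStarRing.norm_mem_unitary_mul _ hU,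
    l2_opNorm_diagonal]

theorem specNorm_residual_sq_le {S : Finset (Fin d)} {k : ℕ} (hS : S.card = k) {ρ : ℝ} (hρ : 0 ≤ ρ)
    (h : ∀ x, (pHat A k S).IsRoot x → x ≤ ρ) : specNorm (residual A S) ^ 2 ≤ ρ := by
  have hPSD := gram_posSemidef A S
  rw [specNorm_sq rfl (diagonalizes_of_posSemidef hPSD), pi_norm_le_iff_of_nonneg hρ]
  intro j
  rw [Real.norm_of_nonneg (hPSD.eigenvalues_nonneg j)]
  apply h
  have e : pHat A k S = (gram A S).charpoly := by
    rw [pHat, hS, Nat.sub_self]; rfl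
  rw [e, hPSD.1.charpoly_eq, IsRoot, eval_prod]
  refine Finset.prod_eq_zero (Finset.mem_univ j) ?_
  simp

/-- A general commutative monoid covers products of linear factors and, by way of `Multiplicative`,
sums and cardinalities. -/
theorem prod_eigenvalues {R : Type*} [CommMonoid R] (f : ℝ → R) :
    ∏ i, f ((isHermitian_conjTranspose_mul_self A).eigenvalues i) =
      ∏ i ∈ Finset.range d, f (lam A i) := by
  have h1 : ∏ i ∈ Finset.range d, f (lam A i) =
      ∏ i : Fin (Fintype.card (Fin d)),
        f ((isHermitian_conjTranspose_mul_self A).eigenvalues₀ i) := by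
    rw [← Fin.prod_univ_eq_prod_range (fun i => f (lam A i)) d]
    refine Fintype.prod_equiv (finCongr (Fintype.card_fin d).symm) _ _ fun i => ?_
    simp [lam]
    rfl
  rw [h1]
  exact Fintype.prod_equiv (Fintype.equivOfCardEq (Fintype.card_fin _)).symm _ _ fun i => rfl

theorem lam_antitone {i j : ℕ} (hij : i ≤ j) (hj : j < d) : lam A j ≤ lam A i := by
  rw [lam, lam, dif_pos (by simpa using hj), dif_pos (by simpa using hij.trans_lt hj)]
  exact (isHermitian_conjTranspose_mul_self A).eigenvalues₀_antitone (Fin.mk_le_mk.mpr hij)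

theorem lam_nonneg (i : ℕ) : 0 ≤ lam A i := by
  rw [lam]
  split_ifs with h
  · have h1 := (posSemidef_conjTranspose_mul_self A).eigenvalues_nonneg
      ((Fintype.equivOfCardEq (Fintype.card_fin _)) ⟨i, h⟩)
    simpa [IsHermitian.eigenvalues] using h1
  · exact le_rfl

theorem card_lam_ne_zero : ((Finset.range d).filter fun i => lam A i ≠ 0).card = A.rank := by
  rw [← rank_conjTranspose_mul_self A,
    (isHermitian_conjTranspose_mul_self A).rank_eq_card_non_zero_eigs, Fintype.card_subtype,
    Finset.card_filter, Finset.card_filter]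
  have := prod_eigenvalues A (fun x => Multiplicative.ofAdd (if x ≠ 0 then 1 else 0 : ℕ))
  rw [← ofAdd_sum, ← ofAdd_sum] at this
  exact (Multiplicative.ofAdd.injective this).symm

theorem rank_le : A.rank ≤ d := by
  have := A.rank_le_card_width
  simpa using this

/-- The eigenvalues are nonnegative and non-increasing, so the nonzero ones form an initial segment;
its length is the rank. -/
theorem lam_ne_zero_iff {i : ℕ} (hi : i < d) : lam A i ≠ 0 ↔ i < A.rank := by
  have hsub : (Finset.range d).filter (fun i => lam A i ≠ 0) ⊆ Finset.range A.rank := by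
    intro i hi
    rw [Finset.mem_filter, Finset.mem_range] at hi
    rw [Finset.mem_range, ← card_lam_ne_zero A, ← Nat.succ_le_iff, ← Finset.card_range (i.succ)]
    refine Finset.card_le_card fun a ha => ?_
    have ha' : a ≤ i := Nat.lt_succ_iff.mp (Finset.mem_range.mp ha)
    rw [Finset.mem_filter, Finset.mem_range]
    refine ⟨ha'.trans_lt hi.1, ?_⟩
    have h1 := lam_antitone A ha' hi.1
    have h2 := (lam_nonneg A i).lt_of_ne' hi.2
    exact (h2.trans_le h1).ne'
  have heq := Finset.eq_of_subset_of_card_le hsub (by rw [card_lam_ne_zero, Finset.card_range])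
  have := Finset.ext_iff.mp heq i
  simpa [hi] using this

theorem charpolyRev_gram_empty :
    charpolyRev (gram A ∅) = ∏ i ∈ Finset.range A.rank, (1 - C (lam A i) * X) := by
  have hPSD := posSemidef_conjTranspose_mul_self A
  have e : gram A ∅ = Aᴴ * A := by rw [gram_empty, conjTranspose_eq_transpose_of_trivial]
  rw [e, (diagonalizes_of_posSemidef hPSD).charpolyRev_eq,
    prod_eigenvalues A (fun x => (1 - C x * X : ℝ[X]))]
  symm
  refine Finset.prod_subset (fun i hi => ?_) fun i hi hi' => ?_
  · exact Finset.mem_range.mpr ((Finset.mem_range.mp hi).trans_le (rank_le A))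
  · rw [Finset.mem_range] at hi hi'
    have := mt (lam_ne_zero_iff A hi).mp hi'
    rw [not_not] at this
    rw [this]; simp

theorem specNorm_sq_eq_lamFirst (hd : 0 < d) : specNorm A ^ 2 = lamFirst A := by
  have hPSD := posSemidef_conjTranspose_mul_self A
  have e : Aᵀ * A = Aᴴ * A := by rw [conjTranspose_eq_transpose_of_trivial]
  rw [specNorm_sq e (diagonalizes_of_posSemidef hPSD)]
  have hval : ∀ i, ∃ l < d, hPSD.1.eigenvalues i = lam A l := by
    intro i
    refine ⟨((Fintype.equivOfCardEq (Fintype.card_fin _)).symm i).val, ?_, ?_⟩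
    · exact (Fin.is_lt _).trans_eq (Fintype.card_fin d)
    · rw [lam, dif_pos (Fin.is_lt _)]; rfl
  apply le_antisymm
  · rw [lamFirst, pi_norm_le_iff_of_nonneg (lam_nonneg A 0)]
    intro i
    rw [Real.norm_of_nonneg (hPSD.eigenvalues_nonneg i)]
    obtain ⟨l, hl, h⟩ := hval i
    rw [h]
    exact lam_antitone A (Nat.zero_le l) hl
  · have h0 : (0 : ℕ) < Fintype.card (Fin d) := by simpa using hd
    have := norm_le_pi_norm hPSD.1.eigenvalues ((Fintype.equivOfCardEq (Fintype.card_fin _)) ⟨0, h0⟩)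
    rw [Real.norm_of_nonneg (hPSD.eigenvalues_nonneg _)] at this
    refine le_trans (le_of_eq ?_) this
    rw [lamFirst, lam, dif_pos h0]
    simp [IsHermitian.eigenvalues]

/-! ### The reciprocal eigenvalues and the initial polynomial -/

variable {A}

theorem rank_pos_of_lt {k : ℕ} (hk : k < A.rank) : 0 < d :=
  (Nat.zero_le k).trans_lt (hk.trans_le (rank_le A))

theorem lam_pos {i : ℕ} (hi : i < A.rank) : 0 < lam A i :=
  (lam_nonneg A i).lt_of_ne' ((lam_ne_zero_iff A (hi.trans_le (rank_le A))).mpr hi)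

theorem lamLast_pos {k : ℕ} (hk : k < A.rank) : 0 < lamLast A := lam_pos (by omega)

theorem inv_lam_mem {i : ℕ} (hi : i < A.rank) :
    (lamFirst A)⁻¹ ≤ (lam A i)⁻¹ ∧ (lam A i)⁻¹ ≤ (lamLast A)⁻¹ := by
  have hr := rank_le A
  have h1 : lam A i ≤ lamFirst A := lam_antitone A (Nat.zero_le i) (by omega)
  have h2 : lamLast A ≤ lam A i := lam_antitone A (by omega) (by omega)
  exact ⟨inv_anti₀ (lam_pos hi) h1, inv_anti₀ (lamLast_pos hi) h2⟩

theorem inv_lamFirst_lt {k : ℕ} (hk : k < A.rank) (h : lamLast A < lamFirst A) :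
    (lamFirst A)⁻¹ < (lamLast A)⁻¹ :=
  inv_strictAnti₀ (lamLast_pos hk) h

theorem rank_mul_alphaInv {k : ℕ} (hk : k < A.rank) :
    A.rank * alphaInv A = ∑ i ∈ Finset.range A.rank, (lam A i)⁻¹ := by
  have : (A.rank : ℝ) ≠ 0 := by
    have : A.rank ≠ 0 := by omega
    exact_mod_cast this
  rw [alphaInv]; field_simp

/-- Both extreme reciprocals occur in the mean and they differ, so the inequalities are strict. -/
theorem alphaInv_bounds {k : ℕ} (hk : k < A.rank) (h : lamLast A < lamFirst A) :
    (lamFirst A)⁻¹ < alphaInv A ∧ alphaInv A < (lamLast A)⁻¹ := by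
  have ht : (0 : ℝ) < A.rank := by exact_mod_cast (Nat.zero_le k).trans_lt hk
  have hlt := inv_lamFirst_lt hk h
  have hsum := rank_mul_alphaInv hk
  constructor
  · refine lt_of_mul_lt_mul_left ?_ ht.le
    rw [hsum]
    have : ∑ i ∈ Finset.range A.rank, (lamFirst A)⁻¹ < ∑ i ∈ Finset.range A.rank, (lam A i)⁻¹ :=
      Finset.sum_lt_sum (fun i hi => (inv_lam_mem (Finset.mem_range.mp hi)).1)
        ⟨A.rank - 1, Finset.mem_range.mpr (by omega), hlt⟩
    simpa using this
  · refine lt_of_mul_lt_mul_left ?_ ht.le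
    rw [hsum]
    have : ∑ i ∈ Finset.range A.rank, (lam A i)⁻¹ < ∑ i ∈ Finset.range A.rank, (lamLast A)⁻¹ :=
      Finset.sum_lt_sum (fun i hi => (inv_lam_mem (Finset.mem_range.mp hi)).2)
        ⟨0, Finset.mem_range.mpr (by omega), hlt⟩
    simpa using this

theorem beta_bounds {k : ℕ} (hk : k < A.rank) (h : lamLast A < lamFirst A) :
    0 < beta A ∧ beta A < 1 := by
  obtain ⟨h1, h2⟩ := alphaInv_bounds hk h
  have h3 := inv_lamFirst_lt hk h
  rw [beta]
  constructor
  · apply div_pos <;> linarith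
  · rw [div_lt_one] <;> linarith

/-- Then the rank is at least 2, hence `n, d ≥ 2`, and the logarithm in the running time is bounded
away from zero. -/
theorem pos_of_beta_le {k : ℕ} (hk : k < A.rank) (h : lamLast A < lamFirst A)
    (hβ : beta A * A.rank ≤ k) : 0 < k := by
  have ht : (0 : ℝ) < A.rank := by exact_mod_cast (Nat.zero_le k).trans_lt hk
  have := mul_pos (beta_bounds hk h).1 ht
  exact_mod_cast this.trans_le hβ

/-- The roots of `det(1 - y AᵀA)` are the numbers `λ_i⁻¹`, between `λ₁⁻¹` and `λ_t⁻¹`, and `β` is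
the weight of `λ₁⁻¹` when their mean `α⁻¹` is written as a convex combination of these two. So
`leftOf_iterate_of_roots` applies, with `(1 - β)(u₁ - u₀) = α⁻¹ - λ₁⁻¹`. -/
theorem hatRev_empty_leftOf {k : ℕ} (hk : k < A.rank) (h : lamLast A < lamFirst A)
    (hβ : beta A * A.rank ≤ k) :
    ∀ y < (lamFirst A)⁻¹ + (alphaInv A - (lamFirst A)⁻¹) * gamma A k,
      LeftOf y (hatRev A k ∅) := by
  obtain ⟨h1, h2⟩ := alphaInv_bounds hk h
  have h3 := inv_lamFirst_lt hk h
  obtain ⟨hb0, hb1⟩ := beta_bounds hk h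
  have hbeta : beta A * ((lamLast A)⁻¹ - (lamFirst A)⁻¹) = (lamLast A)⁻¹ - alphaInv A := by
    have : (lamLast A)⁻¹ - (lamFirst A)⁻¹ ≠ 0 := by linarith
    rw [beta, div_mul_cancel₀ _ this]
  have hroots : (charpolyRev (gram A ∅)).roots =
      Finset.univ.val.map fun i : Fin A.rank => (lam A i)⁻¹ := by
    have hne : ∀ i : Fin A.rank, lam A i ≠ 0 := fun i => (lam_pos i.isLt).ne'
    rw [charpolyRev_gram_empty, ← Fin.prod_univ_eq_prod_range (fun i => (1 - C (lam A i) * X : ℝ[X])),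
      roots_prod]
    · rw [Multiset.bind_congr (g := fun i : Fin A.rank => {(lam A i)⁻¹}),
        Multiset.bind_singleton]
      intro i _
      have e : (1 - C (lam A i) * X : ℝ[X]) = C (-lam A i) * X + C 1 := by simp; ring
      rw [e, roots_C_mul_X_add_C _ (neg_ne_zero.mpr (hne i))]
      simp
    · rw [Finset.prod_ne_zero_iff]
      intro i _ h0
      have := congrArg (eval 0) h0
      simp at this
  have hleft : ∀ a < (lamFirst A)⁻¹, LeftOf a (charpolyRev (gram A ∅)) := by
    intro a ha
    have hL := (diagonalizes_of_posSemidef (gram_posSemidef A ∅)).leftOf_charpolyRev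
    refine hL.of_no_root fun x hx hxa h0 => ?_
    have : x ∈ (charpolyRev (gram A ∅)).roots := (mem_roots hL.ne_zero).mpr h0
    rw [hroots] at this
    obtain ⟨i, _, rfl⟩ := Multiset.mem_map.mp this
    have := (inv_lam_mem i.isLt).1
    linarith
  intro y hy
  have key := leftOf_iterate_of_roots (k := k) hleft hroots h3 (fun i => (inv_lam_mem i.isLt).1)
    (fun i => (inv_lam_mem i.isLt).2) (β := beta A) (by
      rw [hbeta, mul_sub, rank_mul_alphaInv hk, Finset.sum_sub_distrib,
        ← Fin.sum_univ_eq_sum_range (fun i => (lam A i)⁻¹)]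
      simp) hb0 hb1 hβ hk y (by
      have : (1 - beta A) * ((lamLast A)⁻¹ - (lamFirst A)⁻¹) = alphaInv A - (lamFirst A)⁻¹ := by
        linarith
      rw [this]
      exact hy)
  simpa [hatRev] using key

theorem greedy_bound {k : ℕ} {ε : ℝ} (h : lamLast A < lamFirst A) (hβ : beta A * A.rank ≤ k)
    (hk : k < A.rank) (hε : 0 < ε) {j : Fin k → Fin d} {μ : Fin k → Fin d → ℝ}
    (hrun : IsGreedyRun A k ε j μ) :
    (Finset.univ.image j).card = k ∧
      specNorm (residual A (Finset.univ.image j)) ^ 2 ≤ 2 * k * ε + specNorm A ^ 2 /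
        (1 + (specNorm A ^ 2 * alphaInv A - 1) * gamma A k) := by
  have hcard : (Finset.univ.image j).card = k := by
    rw [← chosen_all, card_chosen hrun.choice_new le_rfl]
  refine ⟨hcard, ?_⟩
  have hl1 : 0 < lamFirst A := lam_pos (by omega)
  obtain ⟨h1, h2⟩ := alphaInv_bounds hk h
  have hγ : 0 ≤ gamma A k := sq_nonneg _
  -- As `‖A‖² = λ₁`, the claimed bound for the initial largest root is `Y⁻¹`.
  set Y := (lamFirst A)⁻¹ + (alphaInv A - (lamFirst A)⁻¹) * gamma A k with hY
  have hY0 : 0 < Y := by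
    have := mul_nonneg (sub_nonneg.mpr h1.le) hγ
    have := inv_pos.mpr hl1
    linarith
  have hB : specNorm A ^ 2 / (1 + (specNorm A ^ 2 * alphaInv A - 1) * gamma A k) = Y⁻¹ := by
    rw [specNorm_sq_eq_lamFirst A (rank_pos_of_lt hk)]
    have e : 1 + (lamFirst A * alphaInv A - 1) * gamma A k = lamFirst A * Y := by
      rw [hY]; field_simp
    rw [e, div_mul_eq_div_div, div_self hl1.ne', one_div]
  rw [hB]
  refine specNorm_residual_sq_le A hcard (by positivity) fun x hx => ?_
  rw [← chosen_all] at hx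
  refine greedy_roots_le hε hk hrun (inv_pos.mpr hY0) (fun x hx => ?_) le_rfl x hx
  refine roots_le_of_hatRev_pos (inv_pos.mpr hY0) (fun y _ hy => ?_) hx
  rw [inv_inv] at hy
  exact (hatRev_empty_leftOf hk h hβ y hy).pos y le_rfl

end
end ColSubset

/-! ### Reasoning about programs -/

namespace ColSubset

/-- `c`, started on `s`, halts within time `B` on a memory that satisfies `Q`. -/
def Ens (c : Prog) (s : Mem) (B : ℝ) (Q : Mem → Prop) : Prop :=
  ∃ T s', c.Runs s T s' ∧ (T : ℝ) ≤ B ∧ Q s'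

theorem Ens.mono {c : Prog} {s : Mem} {B B' : ℝ} {Q Q' : Mem → Prop} (h : Ens c s B Q)
    (hB : B ≤ B') (hQ : ∀ s', Q s' → Q' s') : Ens c s B' Q' := by
  obtain ⟨T, s', h1, h2, h3⟩ := h
  exact ⟨T, s', h1, h2.trans hB, hQ s' h3⟩

theorem Ens.seq {c c' : Prog} {s : Mem} {B B' : ℝ} {Q Q' : Mem → Prop} (h : Ens c s B Q)
    (h' : ∀ s', Q s' → Ens c' s' B' Q') : Ens (.seq c c') s (B + B') Q' := by
  obtain ⟨T, s', h1, h2, h3⟩ := h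
  obtain ⟨T', s'', h4, h5, h6⟩ := h' s' h3
  exact ⟨T + T', s'', h1.seq h4, by push_cast; linarith, h6⟩

theorem Ens.nset {a : ℕ} {i e : NExpr} {s : Mem} {B : ℝ} {Q : Mem → Prop}
    (hB : ((i.cost + e.cost + 1 : ℕ) : ℝ) ≤ B) (h : Q (s.setNat a (i.eval s) (e.eval s))) :
    Ens (.nset a i e) s B Q :=
  ⟨_, _, .nset a i e s, hB, h⟩

theorem Ens.rset {a : ℕ} {i j : NExpr} {e : RExpr} {s : Mem} {B : ℝ} {Q : Mem → Prop}
    (hB : ((i.cost + j.cost + e.cost + 1 : ℕ) : ℝ) ≤ B)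
    (h : Q (s.setReal a (i.eval s) (j.eval s) (e.eval s))) : Ens (.rset a i j e) s B Q :=
  ⟨_, _, .rset a i j e s, hB, h⟩

theorem Ens.skip {s : Mem} {B : ℝ} {Q : Mem → Prop} (hB : 1 ≤ B) (h : Q s) : Ens .skip s B Q :=
  ⟨1, s, .skip s, by simpa using hB, h⟩

theorem Ens.ite {b : Test} {c c' : Prog} {s : Mem} {B : ℝ} {Q : Mem → Prop}
    (h : b.Holds s → Ens c s B Q) (h' : ¬ b.Holds s → Ens c' s B Q) :
    Ens (.ite b c c') s (B + b.cost + 1) Q := by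
  by_cases hb : b.Holds s
  · obtain ⟨T, s', h1, h2, h3⟩ := h hb
    exact ⟨_, s', .ite_true hb h1, by push_cast; linarith, h3⟩
  · obtain ⟨T, s', h1, h2, h3⟩ := h' hb
    exact ⟨_, s', .ite_false hb h1, by push_cast; linarith, h3⟩

/-- The invariant carries the number of completed iterations, which determines when the test fails;
the last summand pays for the failing test. -/
theorem Ens.loop {b : Test} {c : Prog} {t : ℝ} {I : ℕ → Mem → Prop} {N : ℕ}
    (hstep : ∀ i < N, ∀ s, I i s → b.Holds s ∧ Ens c s t (I (i + 1)))
    (hend : ∀ s, I N s → ¬ b.Holds s) {s : Mem} (h0 : I 0 s) :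
    Ens (.loop b c) s (N * (t + b.cost + 1) + (b.cost + 1)) (I N) := by
  suffices H : ∀ r i, i + r = N → ∀ s, I i s →
      Ens (.loop b c) s (r * (t + b.cost + 1) + (b.cost + 1)) (I N) from H N 0 (by omega) s h0
  intro r
  induction r with
  | zero =>
    intro i hi s hs
    obtain rfl : i = N := by omega
    exact ⟨_, s, Prog.Runs.loop_stop (hend s hs), by push_cast; linarith, hs⟩
  | succ r ih =>
    intro i hi s hs
    obtain ⟨hb, T, s', h1, h2, h3⟩ := hstep i (by omega) s hs
    obtain ⟨T', s'', h4, h5, h6⟩ := ih (i + 1) (by omega) s' h3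
    exact ⟨_, s'', .loop_step hb h1 h4, by push_cast; linarith, h6⟩

/-- Only the arrays named in `X` (arrays of naturals) and `Y` (arrays of reals) may differ; the
name `100` stands for all names from `100` on. -/
structure Eqv (X Y : List ℕ) (s s' : Mem) : Prop where
  natEq : ∀ a, a ∉ X ∧ (a < 100 ∨ 100 ∉ X) → s'.nat a = s.nat a
  realEq : ∀ a, a ∉ Y ∧ (a < 100 ∨ 100 ∉ Y) → s'.real a = s.real a

namespace Eqv
variable {X Y X' Y' : List ℕ} {s s' s'' : Mem}

theorem nat (h : Eqv X Y s s') (a : ℕ) (ha : a ∉ X ∧ (a < 100 ∨ 100 ∉ X) := by decide) :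
    s'.nat a = s.nat a := h.natEq a ha

theorem real (h : Eqv X Y s s') (a : ℕ) (ha : a ∉ Y ∧ (a < 100 ∨ 100 ∉ Y) := by decide) :
    s'.real a = s.real a := h.realEq a ha

theorem refl (X Y : List ℕ) (s : Mem) : Eqv X Y s s := ⟨fun _ _ => rfl, fun _ _ => rfl⟩

theorem trans (h : Eqv X Y s s') (h' : Eqv X Y s' s'') : Eqv X Y s s'' :=
  ⟨fun a h1 => (h'.natEq a h1).trans (h.natEq a h1),
    fun a h1 => (h'.realEq a h1).trans (h.realEq a h1)⟩

theorem weaken (h : Eqv X Y s s') (hX : X ⊆ X' := by decide) (hY : Y ⊆ Y' := by decide) :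
    Eqv X' Y' s s' :=
  ⟨fun a h1 => h.natEq a ⟨fun h3 => h1.1 (hX h3), h1.2.imp_right fun h2 h3 => h2 (hX h3)⟩,
    fun a h1 => h.realEq a ⟨fun h3 => h1.1 (hY h3), h1.2.imp_right fun h2 h3 => h2 (hY h3)⟩⟩

theorem setNat (s : Mem) (a i v : ℕ) : Eqv [a] [] s (s.setNat a i v) :=
  ⟨fun b ⟨hb, _⟩ => by
    funext x
    have : b ≠ a := by simpa using hb
    simp [Mem.setNat, this], fun _ _ => rfl⟩

theorem setReal (s : Mem) (a i j : ℕ) (v : ℝ) : Eqv [] [a] s (s.setReal a i j v) :=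
  ⟨fun _ _ => rfl, fun b ⟨hb, _⟩ => by
    funext x y
    have : b ≠ a := by simpa using hb
    simp [Mem.setReal, this]⟩

end Eqv

theorem setNat_real (s : Mem) (a i v : ℕ) : (s.setNat a i v).real = s.real := rfl

theorem setNat_nat (s : Mem) (a i v b x : ℕ) :
    (s.setNat a i v).nat b x = if b = a ∧ x = i then v else s.nat b x := rfl

theorem setReal_real (s : Mem) (a i j : ℕ) (v : ℝ) (b x y : ℕ) :
    (s.setReal a i j v).real b x y = if b = a ∧ x = i ∧ y = j then v else s.real b x y := rfl

/-- The variable `a`, i.e. the cell `a[0]`. -/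
abbrev V (a : ℕ) : NExpr := .cell a (.lit 0)

/-- The real variable `a`, i.e. the cell `a[0, 0]`. -/
abbrev RV (a : ℕ) : RExpr := .cell a (.lit 0) (.lit 0)

/-- `for v < e do c`. -/
def forN (v : ℕ) (e : NExpr) (c : Prog) : Prog :=
  .seq (.nset v (.lit 0) (.lit 0))
    (.loop (.nlt (V v) e) (.seq c (.nset v (.lit 0) (.add (V v) (.lit 1)))))

/-- The bound `e` is evaluated anew before every iteration, hence the demand that the invariant fix
its value. The body must leave the counter as it was. -/
theorem Ens.forN {v : ℕ} {e : NExpr} {c : Prog} {t : ℝ} {I : ℕ → Mem → Prop} {N : ℕ} {s : Mem}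
    (h0 : I 0 (s.setNat v 0 0))
    (hv : ∀ i s1, I i s1 → s1.nat v 0 = i ∧ e.eval s1 = N)
    (hstep : ∀ i < N, ∀ s1, I i s1 →
      Ens c s1 t fun s2 => s2.nat v 0 = i ∧ I (i + 1) (s2.setNat v 0 (i + 1))) :
    Ens (forN v e c) s (N * (t + (e.cost + 10)) + (e.cost + 10)) (I N) := by
  have h1 : Ens (.nset v (.lit 0) (.lit 0)) s 3 (I 0) :=
    Ens.nset (by norm_num [NExpr.cost]) (by simpa [NExpr.eval] using h0)
  refine (h1.seq fun s' hs' => Ens.loop (t := t + 6) (I := I) (N := N) ?_ ?_ hs').mono ?_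
    fun _ h => h
  · intro i hi s1 hI
    obtain ⟨h2, h3⟩ := hv i s1 hI
    refine ⟨by simpa [Test.Holds, NExpr.eval, h2, h3] using hi, ?_⟩
    refine (hstep i hi s1 hI).seq fun s2 hs2 => Ens.nset (by norm_num [NExpr.cost]) ?_
    simpa [NExpr.eval, hs2.1] using hs2.2
  · intro s1 hI
    obtain ⟨h2, h3⟩ := hv N s1 hI
    simp [Test.Holds, NExpr.eval, h2, h3]
  · simp only [Test.cost, NExpr.cost]
    push_cast
    linarith [Nat.cast_nonneg (α := ℝ) e.cost]

/-- A `for` loop with an invariant on the arrays of reals. -/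
theorem Ens.forR {v : ℕ} {e : NExpr} {c : Prog} {t : ℝ} {N : ℕ} {s : Mem} {X Y : List ℕ}
    {J : ℕ → (ℕ → ℕ → ℕ → ℝ) → Prop} (hE : ∀ s1, Eqv (v :: X) Y s s1 → e.eval s1 = N)
    (h0 : J 0 s.real)
    (hstep : ∀ i < N, ∀ s1, Eqv (v :: X) Y s s1 → s1.nat v 0 = i → J i s1.real →
      Ens c s1 t fun s2 => Eqv X Y s1 s2 ∧ J (i + 1) s2.real)
    (hvX : v < 100 ∧ v ∉ X := by decide) :
    Ens (ColSubset.forN v e c) s (N * (t + (e.cost + 10)) + (e.cost + 10))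
      fun s' => Eqv (v :: X) Y s s' ∧ J N s'.real := by
  refine (Ens.forN (I := fun i s1 => (Eqv (v :: X) Y s s1 ∧ J i s1.real) ∧ s1.nat v 0 = i)
    ?_ ?_ ?_).mono le_rfl fun _ h => h.1
  · refine ⟨⟨(Eqv.setNat s v 0 0).weaken (by simp) (by simp), h0⟩, ?_⟩
    simp [setNat_nat]
  · exact fun i s1 h => ⟨h.2, hE s1 h.1.1⟩
  · intro i hi s1 h
    refine (hstep i hi s1 h.1.1 h.2 h.1.2).mono le_rfl fun s2 h2 => ?_
    refine ⟨by rw [h2.1.natEq v ⟨hvX.2, .inl hvX.1⟩]; exact h.2, ⟨?_, h2.2⟩, by simp [setNat_nat]⟩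
    exact (h.1.1.trans (h2.1.weaken (by simp) (by simp))).trans
      ((Eqv.setNat s2 v 0 (i + 1)).weaken (by simp) (by simp))

/-- `acc := ∑ v < e, val`. -/
def sumN (v : ℕ) (e : NExpr) (acc : ℕ) (val : RExpr) : Prog :=
  .seq (.rset acc (.lit 0) (.lit 0) (.lit 0))
    (forN v e (.rset acc (.lit 0) (.lit 0) (.add (RV acc) val)))

theorem Ens.sumN {v acc : ℕ} {e : NExpr} {val : RExpr} {N : ℕ} {s : Mem} (f : ℕ → ℝ)
    (hE : ∀ s1, Eqv [v] [acc] s s1 → e.eval s1 = N)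
    (hval : ∀ i < N, ∀ s1, Eqv [v] [acc] s s1 → s1.nat v 0 = i → val.eval s1 = f i)
    (hv : v < 100 := by decide) :
    Ens (ColSubset.sumN v e acc val) s (N * (val.cost + e.cost + 17) + (e.cost + 14))
      fun s' => Eqv [v] [acc] s s' ∧ s'.real acc 0 0 = ∑ i ∈ Finset.range N, f i := by
  have h1 : Ens (.rset acc (.lit 0) (.lit 0) (.lit 0)) s 4
      fun s' => Eqv [v] [acc] s s' ∧ s'.real acc 0 0 = 0 :=
    Ens.rset (by norm_num [NExpr.cost, RExpr.cost])
      ⟨(Eqv.setReal _ _ _ _ _).weaken (by simp) (by simp), by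
        simp [setReal_real, NExpr.eval, RExpr.eval]⟩
  refine (h1.seq (B' := N * ((val.cost + 7) + (e.cost + 10)) + (e.cost + 10))
    fun s' hs' => (Ens.forR (X := []) (Y := [acc]) (t := val.cost + 7) (N := N)
    (J := fun i r => r acc 0 0 = ∑ i ∈ Finset.range i, f i)
    (fun s1 h => hE s1 (hs'.1.trans h)) (by simpa using hs'.2) ?_ ⟨hv, by simp⟩).mono le_rfl
      fun s'' h => ⟨hs'.1.trans h.1, h.2⟩).mono ?_ fun _ h => h
  · intro i hi s1 h2 h3 h4
    refine Ens.rset ?_ ⟨(Eqv.setReal _ _ _ _ _).weaken (by simp) (by simp), ?_⟩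
    · simp only [NExpr.cost, RExpr.cost]; push_cast; linarith
    · rw [setReal_real, Finset.sum_range_succ, ← h4, ← hval i hi s1 (hs'.1.trans h2) h3]
      simp [NExpr.eval, RExpr.eval]
  · linarith

/-- A nested loop that fills cells of the array `a`, one in each iteration. -/
theorem Ens.fill {v : ℕ} {e : NExpr} {c : Prog} {t : ℝ} {N a : ℕ} {s : Mem} {X Y : List ℕ}
    (p q : ℕ → ℕ) (f : ℕ → ℝ) (hE : ∀ s1, Eqv (v :: X) (a :: Y) s s1 → e.eval s1 = N)
    (hinj : ∀ i < N, ∀ j < N, p i = p j → q i = q j → i = j)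
    (hstep : ∀ i < N, ∀ s1, Eqv (v :: X) (a :: Y) s s1 → s1.nat v 0 = i →
      (∀ x y, (∀ j < i, ¬ (x = p j ∧ y = q j)) → s1.real a x y = s.real a x y) →
      Ens c s1 t fun s2 => Eqv X (a :: Y) s1 s2 ∧
        ∀ x y, s2.real a x y = if x = p i ∧ y = q i then f i else s1.real a x y)
    (hvX : v < 100 ∧ v ∉ X := by decide) :
    Ens (ColSubset.forN v e c) s (N * (t + (e.cost + 10)) + (e.cost + 10))
      fun s' => Eqv (v :: X) (a :: Y) s s' ∧ (∀ i < N, s'.real a (p i) (q i) = f i) ∧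
        ∀ x y, (∀ i < N, ¬ (x = p i ∧ y = q i)) → s'.real a x y = s.real a x y := by
  refine Ens.forR (J := fun N r => (∀ i < N, r a (p i) (q i) = f i) ∧
    ∀ x y, (∀ i < N, ¬ (x = p i ∧ y = q i)) → r a x y = s.real a x y) hE (by simp) ?_ hvX
  intro i hi s1 h1 h2 h3
  refine (hstep i hi s1 h1 h2 h3.2).mono le_rfl fun s2 h4 => ⟨h4.1, ?_, ?_⟩
  · intro j hj
    rw [h4.2]
    split_ifs with h
    · rw [hinj j (by omega) i hi h.1 h.2]
    · refine h3.1 j (lt_of_le_of_ne (Nat.lt_succ_iff.mp hj) ?_)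
      rintro rfl
      exact h ⟨rfl, rfl⟩
  · intro x y h
    rw [h4.2, if_neg (h i (Nat.lt_succ_self i))]
    exact h3.2 x y fun j hj => h j (Nat.lt_succ_of_lt hj)

theorem Ens.fill2 {v w : ℕ} {e e' : NExpr} {c : Prog} {t : ℝ} {N N' a : ℕ} {s : Mem} {X Y : List ℕ}
    (p q : ℕ → ℕ → ℕ) (f : ℕ → ℕ → ℝ)
    (hE : ∀ s1, Eqv (v :: w :: X) (a :: Y) s s1 → e.eval s1 = N ∧ e'.eval s1 = N')
    (hinj : ∀ i < N, ∀ i' < N, ∀ j < N', ∀ j' < N', p i j = p i' j' → q i j = q i' j' →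
      i = i' ∧ j = j')
    (hstep : ∀ i < N, ∀ j < N', ∀ s1, Eqv (v :: w :: X) (a :: Y) s s1 → s1.nat v 0 = i →
      s1.nat w 0 = j → s1.real a (p i j) (q i j) = s.real a (p i j) (q i j) →
      Ens c s1 t fun s2 => Eqv X (a :: Y) s1 s2 ∧
        ∀ x y, s2.real a x y = if x = p i j ∧ y = q i j then f i j else s1.real a x y)
    (hvX : (v < 100 ∧ v ∉ w :: X) ∧ w < 100 ∧ w ∉ X := by decide) :
    Ens (ColSubset.forN v e (ColSubset.forN w e' c)) s
      (N * ((N' * (t + (e'.cost + 10)) + (e'.cost + 10)) + (e.cost + 10)) + (e.cost + 10))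
      fun s' => Eqv (v :: w :: X) (a :: Y) s s' ∧
        (∀ i < N, ∀ j < N', s'.real a (p i j) (q i j) = f i j) ∧
        ∀ x y, (∀ i < N, ∀ j < N', ¬ (x = p i j ∧ y = q i j)) → s'.real a x y = s.real a x y := by
  refine Ens.forR (J := fun N r => (∀ i < N, ∀ j < N', r a (p i j) (q i j) = f i j) ∧
    ∀ x y, (∀ i < N, ∀ j < N', ¬ (x = p i j ∧ y = q i j)) → r a x y = s.real a x y)
    (fun s1 h => (hE s1 h).1) (by simp) ?_ hvX.1
  intro i hi s1 h1 h2 h3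
  have hne : ∀ i' < i, ∀ j < N', ∀ j' < N', ¬ (p i' j = p i j' ∧ q i' j = q i j') :=
    fun i' hi' j hj j' hj' h => by
      have := (hinj i' (hi'.trans hi) i hi j hj j' hj' h.1 h.2).1
      omega
  refine (Ens.fill (v := w) (X := X) (Y := Y) (t := t) (N := N') (p i) (q i) (f i)
    (fun s2 h4 => (hE s2 (h1.trans (h4.weaken (by simp) (by simp)))).2)
    (fun j hj j' hj' h h' => (hinj i hi i hi j hj j' hj' h h').2) ?_ hvX.2).mono le_rfl
      fun s2 h4 => ⟨h4.1, ?_, ?_⟩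
  · intro j hj s2 h4 h5 h6
    refine hstep i hi j hj s2 (h1.trans (h4.weaken (by simp) (by simp))) ?_ h5 ?_
    · rw [h4.natEq v ⟨hvX.1.2, .inl hvX.1.1⟩, h2]
    · rw [h6 _ _ fun j' hj' h => by
        have := (hinj i hi i hi j hj j' (hj'.trans hj) h.1 h.2).2
        omega]
      exact h3.2 _ _ fun i' hi' j' hj' h => hne i' hi' j' hj' j hj ⟨h.1.symm, h.2.symm⟩
  · intro i' hi' j hj
    rcases Nat.lt_succ_iff_lt_or_eq.mp hi' with h | rfl
    · rw [h4.2.2 _ _ fun j' hj' => hne i' h j hj j' hj']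
      exact h3.1 i' h j hj
    · exact h4.2.1 j hj
  · intro x y h
    rw [h4.2.2 _ _ (h i (Nat.lt_succ_self i))]
    exact h3.2 x y fun i' hi' => h i' (Nat.lt_succ_of_lt hi')

/-- An assignment, as the body of `Ens.fill`. -/
theorem Ens.fillBody {a : ℕ} {ei ej : NExpr} {val : RExpr} {s : Mem} {B : ℝ} {X Y : List ℕ}
    {x₀ y₀ : ℕ} {z : ℝ} (hB : ((ei.cost + ej.cost + val.cost + 1 : ℕ) : ℝ) ≤ B)
    (hi : ei.eval s = x₀) (hj : ej.eval s = y₀) (hz : val.eval s = z) :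
    Ens (.rset a ei ej val) s B fun s2 => Eqv X (a :: Y) s s2 ∧
      ∀ x y, s2.real a x y = if x = x₀ ∧ y = y₀ then z else s.real a x y := by
  refine Ens.rset hB ⟨(Eqv.setReal _ _ _ _ _).weaken (by simp) (by simp), fun x y => ?_⟩
  rw [setReal_real, hi, hj, hz]
  simp

/-- An assignment of a value that is computed from a sum, as the body of `Ens.fill`. -/
theorem Ens.fillSum {a v acc : ℕ} {e ei ej : NExpr} {val out : RExpr} {s : Mem} {B : ℝ} {N : ℕ}
    {x₀ y₀ : ℕ} {z : ℝ} (f : ℕ → ℝ)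
    (hE : ∀ s1, Eqv [v] [acc] s s1 → e.eval s1 = N)
    (hval : ∀ i < N, ∀ s1, Eqv [v] [acc] s s1 → s1.nat v 0 = i → val.eval s1 = f i)
    (hout : ∀ s1, Eqv [v] [acc] s s1 → s1.real acc 0 0 = ∑ i ∈ Finset.range N, f i →
      ei.eval s1 = x₀ ∧ ej.eval s1 = y₀ ∧ out.eval s1 = z)
    (hB : (N * (val.cost + e.cost + 17) + (e.cost + 14) : ℝ) +
      ((ei.cost + ej.cost + out.cost + 1 : ℕ) : ℝ) ≤ B)
    (hv : v < 100 ∧ a < 100 ∧ a ≠ acc := by decide) :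
    Ens (.seq (ColSubset.sumN v e acc val) (.rset a ei ej out)) s B fun s2 => Eqv [v] [a, acc] s s2 ∧
      ∀ x y, s2.real a x y = if x = x₀ ∧ y = y₀ then z else s.real a x y := by
  refine ((Ens.sumN f hE hval hv.1).seq (B' := ((ei.cost + ej.cost + out.cost + 1 : ℕ) : ℝ))
    fun s1 h1 => ?_).mono hB fun _ h => h
  obtain ⟨h2, h3, h4⟩ := hout s1 h1.1 h1.2
  refine (Ens.fillBody (X := []) (Y := []) le_rfl h2 h3 h4).mono le_rfl fun s2 h5 => ?_
  refine ⟨(h1.1.weaken (by simp) (by simp)).trans (h5.1.weaken (by simp) (by simp)), fun x y => ?_⟩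
  rw [h5.2, h1.1.realEq a ⟨by simpa using hv.2.2, .inl hv.2.1⟩]

/-! #### Renaming of the arrays of a program -/

/-- The multiplication program supplied by `MatMulExponent` may use any names. Moving them to `100`
and beyond keeps them away from the working arrays of the algorithm. -/
def NExpr.shift : NExpr → NExpr
  | .lit c => .lit c
  | .cell a i => .cell (a + 100) i.shift
  | .add e f => .add e.shift f.shift
  | .sub e f => .sub e.shift f.shift

def RExpr.shift : RExpr → RExpr
  | .lit c => .lit c
  | .ofNat e => .ofNat e.shift
  | .cell a i j => .cell (a + 100) i.shift j.shift
  | .add e f => .add e.shift f.shift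
  | .sub e f => .sub e.shift f.shift
  | .mul e f => .mul e.shift f.shift
  | .div e f => .div e.shift f.shift

def Test.shift : Test → Test
  | .nlt e f => .nlt e.shift f.shift
  | .rlt e f => .rlt e.shift f.shift
  | .not b => .not b.shift

def Prog.shift : Prog → Prog
  | .skip => .skip
  | .nset a i e => .nset (a + 100) i.shift e.shift
  | .rset a i j e => .rset (a + 100) i.shift j.shift e.shift
  | .seq c c' => .seq c.shift c'.shift
  | .ite b c c' => .ite b.shift c.shift c'.shift
  | .loop b c => .loop b.shift c.shift

/-- The part of the memory with names from `100` on. -/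
def Mem.upper (s : Mem) : Mem := ⟨fun a => s.nat (a + 100), fun a => s.real (a + 100)⟩

theorem Mem.upper_setNat (s : Mem) (a i v : ℕ) :
    (s.setNat (a + 100) i v).upper = s.upper.setNat a i v := by
  simp only [Mem.upper, Mem.setNat, Mem.mk.injEq, and_true]
  funext b x
  by_cases h : b = a <;> simp [h]

theorem Mem.upper_setReal (s : Mem) (a i j : ℕ) (v : ℝ) :
    (s.setReal (a + 100) i j v).upper = s.upper.setReal a i j v := by
  simp only [Mem.upper, Mem.setReal, Mem.mk.injEq, true_and]
  funext b x
  by_cases h : b = a <;> simp [h]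

theorem NExpr.eval_shift (s : Mem) (e : NExpr) : e.shift.eval s = e.eval s.upper := by
  induction e with
  | lit c => rfl
  | cell a i ih => simp [NExpr.shift, NExpr.eval, ih, Mem.upper]
  | add e f h1 h2 => simp [NExpr.shift, NExpr.eval, h1, h2]
  | sub e f h1 h2 => simp [NExpr.shift, NExpr.eval, h1, h2]

theorem NExpr.cost_shift (e : NExpr) : e.shift.cost = e.cost := by
  induction e <;> simp_all [NExpr.shift, NExpr.cost]

theorem RExpr.eval_shift (s : Mem) (e : RExpr) : e.shift.eval s = e.eval s.upper := by
  induction e with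
  | lit c => rfl
  | ofNat e => simp [RExpr.shift, RExpr.eval, NExpr.eval_shift]
  | cell a i j => simp [RExpr.shift, RExpr.eval, NExpr.eval_shift, Mem.upper]
  | add e f h1 h2 => simp [RExpr.shift, RExpr.eval, h1, h2]
  | sub e f h1 h2 => simp [RExpr.shift, RExpr.eval, h1, h2]
  | mul e f h1 h2 => simp [RExpr.shift, RExpr.eval, h1, h2]
  | div e f h1 h2 => simp [RExpr.shift, RExpr.eval, h1, h2]

theorem RExpr.cost_shift (e : RExpr) : e.shift.cost = e.cost := by
  induction e <;> simp_all [RExpr.shift, RExpr.cost, NExpr.cost_shift]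

theorem Test.holds_shift (s : Mem) (b : Test) : b.shift.Holds s ↔ b.Holds s.upper := by
  induction b with
  | nlt e f => simp [Test.shift, Test.Holds, NExpr.eval_shift]
  | rlt e f => simp [Test.shift, Test.Holds, RExpr.eval_shift]
  | not b ih => simp [Test.shift, Test.Holds, ih]

theorem Test.cost_shift (b : Test) : b.shift.cost = b.cost := by
  induction b <;> simp_all [Test.shift, Test.cost, RExpr.cost_shift, NExpr.cost_shift]

theorem Prog.Runs.shift {c : Prog} {s s' : Mem} {T : ℕ} (h : c.Runs s T s') :
    ∀ s1 : Mem, s1.upper = s → ∃ s2, c.shift.Runs s1 T s2 ∧ s2.upper = s' ∧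
      Eqv [100] [100] s1 s2 := by
  induction h with
  | skip s => exact fun s1 h => ⟨s1, .skip s1, h, Eqv.refl _ _ _⟩
  | nset a i e s =>
    rintro s1 rfl
    have := Prog.Runs.nset (a + 100) i.shift e.shift s1
    rw [NExpr.cost_shift, NExpr.cost_shift, NExpr.eval_shift, NExpr.eval_shift] at this
    refine ⟨_, this, Mem.upper_setNat _ _ _ _, ?_, fun _ _ => rfl⟩
    · rintro b ⟨hb, hb'⟩
      funext x
      simp [Mem.setNat, show b ≠ a + 100 by simp at hb'; omega]
  | rset a i j e s =>
    rintro s1 rfl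
    have := Prog.Runs.rset (a + 100) i.shift j.shift e.shift s1
    rw [NExpr.cost_shift, NExpr.cost_shift, NExpr.eval_shift, NExpr.eval_shift,
      RExpr.cost_shift, RExpr.eval_shift] at this
    refine ⟨_, this, Mem.upper_setReal _ _ _ _ _, fun _ _ => rfl, ?_⟩
    · rintro b ⟨hb, hb'⟩
      funext x y
      simp [Mem.setReal, show b ≠ a + 100 by simp at hb'; omega]
  | seq _ _ ih ih' =>
    intro s1 h
    obtain ⟨s2, h1, h2, h3⟩ := ih s1 h
    obtain ⟨s3, h4, h5, h6⟩ := ih' s2 h2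
    exact ⟨s3, h1.seq h4, h5, h3.trans h6⟩
  | ite_true hb _ ih =>
    rintro s1 rfl
    obtain ⟨s2, h1, h2, h3⟩ := ih s1 rfl
    refine ⟨s2, ?_, h2, h3⟩
    rw [← Test.cost_shift]
    exact .ite_true ((Test.holds_shift _ _).mpr hb) h1
  | ite_false hb _ ih =>
    rintro s1 rfl
    obtain ⟨s2, h1, h2, h3⟩ := ih s1 rfl
    refine ⟨s2, ?_, h2, h3⟩
    rw [← Test.cost_shift]
    exact .ite_false (mt (Test.holds_shift _ _).mp hb) h1
  | loop_stop hb =>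
    rintro s1 rfl
    refine ⟨s1, ?_, rfl, Eqv.refl _ _ _⟩
    rw [← Test.cost_shift]
    exact Prog.Runs.loop_stop (mt (Test.holds_shift _ _).mp hb)
  | loop_step hb _ _ ih ih' =>
    rintro s1 rfl
    obtain ⟨s2, h1, h2, h3⟩ := ih s1 rfl
    obtain ⟨s3, h4, h5, h6⟩ := ih' s2 h2
    refine ⟨s3, ?_, h5, h3.trans h6⟩
    rw [← Test.cost_shift]
    exact .loop_step ((Test.holds_shift _ _).mpr hb) h1 h4

/-- `mm` multiplies the matrices stored in the arrays `100` and `101`. -/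
def Multiplies (mm : Prog) (C w : ℝ) : Prop :=
  ∀ (m : ℕ), 0 < m → ∀ s : Mem, s.nat 100 0 = m →
    Ens mm s (C * (m : ℝ) ^ w) fun s' => Eqv [100] [100] s s' ∧ ∀ a < m, ∀ b < m,
      s'.real 102 a b = ∑ c ∈ Finset.range m, s.real 100 a c * s.real 101 c b

theorem MatMulExponent.exists_multiplies {w : ℝ} (h : MatMulExponent w) :
    ∃ (mm : Prog) (C : ℝ), 0 ≤ C ∧ Multiplies mm C w := by
  obtain ⟨P, C, hP⟩ := h
  -- The absolute value supplies a nonnegative constant, which the later estimates need.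
  refine ⟨P.shift, |C|, abs_nonneg C, fun m hm s hs => ?_⟩
  obtain ⟨T, s', h1, h2, h3⟩ := hP m hm (of fun a b => s.real 100 a b) (of fun a b => s.real 101 a b)
    s.upper hs (fun _ _ => rfl) (fun _ _ => rfl)
  obtain ⟨s2, h4, h5, h6⟩ := h1.shift s rfl
  refine ⟨T, s2, h4, h2.trans ?_, h6, fun a ha b hb => ?_⟩
  · exact mul_le_mul_of_nonneg_right (le_abs_self C) (by positivity)
  · have := h3 ⟨a, ha⟩ ⟨b, hb⟩
    rw [← h5, Matrix.mul_apply] at this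
    rw [← Fin.sum_univ_eq_sum_range (fun c => s.real 100 a c * s.real 101 c b)]
    exact this

end ColSubset

/-! ### Coefficients of the characteristic polynomials, and Budan's criterion -/

namespace ColSubset

section FaddeevLeVerrier
variable {ι κ : Type*} [Fintype ι] [DecidableEq ι] [Fintype κ]

/-- `∏_{l ≠ j} (1 - lam l * X)`. -/
noncomputable def prodErase (lam : ι → ℝ) (j : ι) : ℝ[X] :=
  ∏ l ∈ Finset.univ.erase j, (1 - C (lam l) * X)

theorem one_sub_mul_prodErase (lam : ι → ℝ) (j : ι) :
    (1 - C (lam j) * X) * prodErase lam j = ∏ l, (1 - C (lam l) * X) :=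
  Finset.mul_prod_erase _ _ (Finset.mem_univ j)

theorem coeff_zero_prodErase (lam : ι → ℝ) (j : ι) : (prodErase lam j).coeff 0 = 1 := by
  rw [coeff_zero_eq_eval_zero, prodErase, eval_prod]
  simp

/-- Synthetic division of the full product by `1 - lam j * X`. -/
theorem coeff_succ_prodErase (lam : ι → ℝ) (j : ι) (b : ℕ) :
    (prodErase lam j).coeff (b + 1) =
      lam j * (prodErase lam j).coeff b + (∏ l, (1 - C (lam l) * X)).coeff (b + 1) := by
  rw [← one_sub_mul_prodErase lam j, sub_mul, one_mul, coeff_sub, mul_assoc, coeff_C_mul,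
    coeff_X_mul]
  ring

theorem coeff_weighted (lam α : ι → ℝ) (b : ℕ) :
    (weighted lam α).coeff b = ∑ j, α j * lam j * (prodErase lam j).coeff b := by
  rw [weighted, finsetSum_coeff]
  exact Finset.sum_congr rfl fun j _ => coeff_C_mul _

/-- The matrix `U diag(lam l * b_l) Uᵀ`, where `b_l` is the `b`-th coefficient of
`∏_{l' ≠ l} (1 - lam l' * X)`. -/
noncomputable def coeffMat (U : Matrix ι ι ℝ) (lam : ι → ℝ) (b : ℕ) : Matrix ι ι ℝ :=
  U * diagonal (fun l => lam l * (prodErase lam l).coeff b) * Uᵀ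

variable {M U : Matrix ι ι ℝ} {lam : ι → ℝ}

theorem Diagonalizes.coeffMat_zero (D : Diagonalizes M U lam) : coeffMat U lam 0 = M := by
  rw [coeffMat, D.eq]
  simp only [coeff_zero_prodErase, mul_one]

/-- By `charpolyRev_schurStep` this is a coefficient of `M i i * charpolyRev (schurStep M i)`: the
diagonals of the `coeffMat` describe all candidate columns simultaneously. -/
theorem coeffMat_apply_self (i : ι) (b : ℕ) :
    coeffMat U lam b i i = (weighted lam fun j => U i j ^ 2).coeff b := by
  rw [coeff_weighted, coeffMat, Matrix.mul_apply]
  refine Finset.sum_congr rfl fun j _ => ?_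
  rw [mul_diagonal, transpose_apply]
  ring

/-- Newton's identities in the form of Faddeev and LeVerrier: the trace of `coeffMat` is the `b`-th
coefficient of `-F'`, that is, `-(b + 1)` times the next coefficient of `F`. -/
theorem Diagonalizes.coeff_succ (D : Diagonalizes M U lam) (b : ℕ) :
    (charpolyRev M).coeff (b + 1) = (0 - ∑ i, coeffMat U lam b i i) / ((b : ℝ) + 1) := by
  have h : ∑ i, coeffMat U lam b i i = (negDer (charpolyRev M)).coeff b := by
    simp only [coeffMat_apply_self]
    rw [D.charpolyRev_eq, ← sum_weighted lam (fun i j => U i j ^ 2) D.sum_sq, finsetSum_coeff]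
  have hb : (b : ℝ) + 1 ≠ 0 := by positivity
  rw [h, negDer, coeff_neg, coeff_derivative]
  field_simp
  ring

/-- The recursion is `B ↦ M B + c M`. Keeping `B = L W` in factored form, only `W` has to be
updated, through the small square matrix `R L`. -/
theorem Diagonalizes.coeffMat_succ (D : Diagonalizes M U lam) {L : Matrix ι κ ℝ}
    {R W : Matrix κ ι ℝ} (hLR : L * R = M) {b : ℕ} (hW : L * W = coeffMat U lam b) :
    L * (R * L * W + (charpolyRev M).coeff (b + 1) • R) = coeffMat U lam (b + 1) := by
  have h1 : L * (R * L * W + (charpolyRev M).coeff (b + 1) • R) =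
      M * (L * W) + (charpolyRev M).coeff (b + 1) • M := by
    rw [Matrix.mul_add, Matrix.mul_smul, hLR, ← Matrix.mul_assoc, ← Matrix.mul_assoc, hLR,
      Matrix.mul_assoc]
  have h2 : M * coeffMat U lam b =
      U * diagonal (fun l => lam l * (lam l * (prodErase lam l).coeff b)) * Uᵀ := by
    rw [coeffMat, D.eq]
    calc _ = U * diagonal lam * (Uᵀ * U) *
          diagonal (fun l => lam l * (prodErase lam l).coeff b) * Uᵀ := by
            simp only [Matrix.mul_assoc]
      _ = _ := by rw [D.left, Matrix.mul_one, Matrix.mul_assoc U, diagonal_mul_diagonal]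
  rw [h1, hW, h2]
  nth_rewrite 2 [D.eq]
  rw [← Matrix.smul_mul, ← Matrix.mul_smul, ← Matrix.add_mul, ← Matrix.mul_add, coeffMat,
    D.charpolyRev_eq]
  congr 2
  ext a a'
  by_cases h : a = a'
  · subst h
    simp only [Matrix.add_apply, diagonal_apply_eq, Matrix.smul_apply, coeff_succ_prodErase,
      smul_eq_mul]
    ring
  · simp [h]

end FaddeevLeVerrier

/-! ### Taylor shifts and Budan's criterion -/

section Budan

/-- The partial results of Horner's rule, shifted by `x`, for the reversed polynomial of `F`. -/
noncomputable def horner (F : ℝ[X]) (x : ℝ) : ℕ → ℝ[X]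
  | 0 => 0
  | j + 1 => (X + C x) * horner F x j + C (F.coeff j)

theorem coeff_zero_horner_succ (F : ℝ[X]) (x : ℝ) (j : ℕ) :
    (horner F x (j + 1)).coeff 0 = x * (horner F x j).coeff 0 + F.coeff j := by
  simp [horner, add_mul]

theorem coeff_succ_horner_succ (F : ℝ[X]) (x : ℝ) (j b : ℕ) :
    (horner F x (j + 1)).coeff (b + 1) =
      x * (horner F x j).coeff (b + 1) + (horner F x j).coeff b := by
  simp [horner, add_mul, coeff_X_mul]
  ring

theorem coeff_horner_of_le (F : ℝ[X]) (x : ℝ) {j b : ℕ} (h : j ≤ b) :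
    (horner F x j).coeff b = 0 := by
  induction j generalizing b with
  | zero => simp [horner]
  | succ j ih =>
    obtain ⟨b, rfl⟩ : ∃ c, b = c + 1 := ⟨b - 1, by omega⟩
    rw [coeff_succ_horner_succ, ih (by omega), ih (by omega)]
    simp

theorem coeff_horner_self (F : ℝ[X]) (x : ℝ) (j : ℕ) :
    (horner F x (j + 1)).coeff j = F.coeff 0 := by
  induction j with
  | zero => simp [horner]
  | succ j ih => rw [coeff_succ_horner_succ, ih, coeff_horner_of_le F x le_rfl]; simp

/-- For `u = y + x` this is the truncated reversed polynomial `u ^ j * F(1/u)`; `horner` is its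
expansion in powers of `y = u - x`. -/
theorem eval_horner (F : ℝ[X]) (x y : ℝ) (j : ℕ) (h : y + x ≠ 0) :
    (horner F x (j + 1)).eval y = (y + x) ^ j * ∑ i ∈ Finset.range (j + 1), F.coeff i * (y + x)⁻¹ ^ i := by
  induction j with
  | zero => simp [horner]
  | succ j ih =>
    rw [horner, eval_add, eval_mul, ih, Finset.sum_range_succ _ (j + 1)]
    simp only [eval_add, eval_X, eval_C]
    rw [mul_add, ← mul_assoc, ← pow_succ', inv_pow]
    have : (y + x) ^ (j + 1) * (F.coeff (j + 1) * ((y + x) ^ (j + 1))⁻¹) = F.coeff (j + 1) := by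
      field_simp
    rw [this]

theorem coeff_nonneg_mul {p q : ℝ[X]} (hp : ∀ b, 0 ≤ p.coeff b) (hq : ∀ b, 0 ≤ q.coeff b) (b : ℕ) :
    0 ≤ (p * q).coeff b := by
  rw [coeff_mul]
  exact Finset.sum_nonneg fun c _ => mul_nonneg (hp _) (hq _)

theorem coeff_nonneg_X_add_C {c : ℝ} (hc : 0 ≤ c) (b : ℕ) : 0 ≤ (X + C c : ℝ[X]).coeff b := by
  rcases b with _ | _ | b <;> simp [coeff_X, coeff_C, hc]

/-- Budan's criterion for a real-rooted polynomial. -/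
theorem budan {F : ℝ[X]} (hF : LeftOf 0 F) {M : ℕ} (hM : F.natDegree ≤ M) {x : ℝ} (hx : 0 < x) :
    (∀ b < M + 1, 0 ≤ (horner F x (M + 1)).coeff b) ↔ ∀ y, 0 ≤ y → y < x⁻¹ → 0 < F.eval y := by
  have hev : ∀ y, y + x ≠ 0 → (horner F x (M + 1)).eval y = (y + x) ^ M * F.eval (y + x)⁻¹ := by
    intro y hy
    rw [eval_horner F x y M hy, eval_eq_sum_range' (Nat.lt_succ_of_le hM)]
  constructor
  · intro h y hy0 hy
    rcases hy0.eq_or_lt with rfl | hy0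
    · exact hF.pos 0 le_rfl
    have hu : x < y⁻¹ := (lt_inv_comm₀ hy0 hx).mp hy
    have h1 := hev (y⁻¹ - x) (by rw [sub_add_cancel]; positivity)
    rw [sub_add_cancel, inv_inv] at h1
    -- The top coefficient is `F(0) > 0`, so nonnegative coefficients give a strictly positive value
    -- at the positive point `y⁻¹ - x`.
    have h2 : 0 < (horner F x (M + 1)).eval (y⁻¹ - x) := by
      rw [eval_eq_sum_range' (n := M + 1) (by
        refine Nat.lt_succ_of_le (natDegree_le_iff_coeff_eq_zero.mpr fun b hb => ?_)
        exact coeff_horner_of_le F x hb)]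
      refine Finset.sum_pos' (fun b hb => mul_nonneg (h b (Finset.mem_range.mp hb))
        (pow_nonneg (by linarith) _)) ⟨M, Finset.self_mem_range_succ M, ?_⟩
      rw [coeff_horner_self, coeff_zero_eq_eval_zero]
      exact mul_pos (hF.pos 0 le_rfl) (pow_pos (by linarith) _)
    rw [h1] at h2
    exact (pos_iff_pos_of_mul_pos h2).mp (by positivity)
  · intro h b _
    have hr : ∀ r ∈ F.roots, 0 < r ∧ r⁻¹ ≤ x := by
      intro r hr
      have h1 := hF.lt_root hr
      refine ⟨h1, ?_⟩
      rw [inv_le_comm₀ h1 hx]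
      by_contra hlt
      have h2 := h r h1.le (not_le.mp hlt)
      rw [((mem_roots hF.ne_zero).mp hr).eq_zero] at h2
      exact lt_irrefl _ h2
    have hcard : Multiset.card F.roots ≤ M := by
      rw [splits_iff_card_roots.mp hF.splits]; exact hM
    -- A root `r` of `F` becomes the root `1/r` of the reversed polynomial. After the shift its
    -- factor is `X + (x - 1/r)`, with nonnegative coefficients because `1/r ≤ x`.
    have key : ∀ s : Multiset ℝ, (∀ r ∈ s, 0 < r ∧ r⁻¹ ≤ x) → ∀ u : ℝ, u ≠ 0 →
        (∀ b, 0 ≤ ((s.map fun r => X + C (x - r⁻¹)).prod : ℝ[X]).coeff b) ∧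
        (s.map fun r => (u⁻¹ - r)).prod * u ^ Multiset.card s =
          (s.map fun r => (0 - r)).prod * ((s.map fun r => X + C (x - r⁻¹)).prod : ℝ[X]).eval (u - x) := by
      intro s
      induction s using Multiset.induction_on with
      | empty =>
        intro _ u _
        refine ⟨fun b => ?_, by simp⟩
        simp only [Multiset.map_zero, Multiset.prod_zero, coeff_one]
        split_ifs <;> simp
      | cons r s ih =>
        intro hs u hu
        obtain ⟨h1, h2⟩ := ih (fun r hr => hs r (Multiset.mem_cons_of_mem hr)) u hu
        have hr := hs r (Multiset.mem_cons_self r s)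
        simp only [Multiset.map_cons, Multiset.prod_cons, Multiset.card_cons]
        refine ⟨coeff_nonneg_mul (coeff_nonneg_X_add_C (by linarith [hr.2])) h1, ?_⟩
        rw [eval_mul, eval_add, eval_X, eval_C, pow_succ]
        have e : (u⁻¹ - r) * u = (0 - r) * (u - x + (x - r⁻¹)) := by
          have := hr.1.ne'
          field_simp
          ring
        linear_combination (s.map fun r => (u⁻¹ - r)).prod * u ^ Multiset.card s * e +
          (0 - r) * (u - x + (x - r⁻¹)) * h2
    -- `M` may exceed the degree of `F`; the excess shows as zero roots of the reversed polynomial,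
    -- which are factors `X + x`.
    have hpoly : horner F x (M + 1) = C (F.eval 0) * ((X + C x) ^ (M - Multiset.card F.roots) *
        (F.roots.map fun r => X + C (x - r⁻¹)).prod) := by
      refine eq_of_infinite_eval_eq _ _ ((Set.Ioi_infinite (0 : ℝ)).mono fun y hy => ?_)
      have hy' : 0 < y := hy
      have hu : y + x ≠ 0 := by positivity
      have h2 := (key F.roots hr (y + x) hu).2
      rw [add_sub_cancel_right] at h2
      rw [Set.mem_ofPred_eq, hev y hu, hF.splits.eval_eq_prod_roots, hF.splits.eval_eq_prod_roots]
      simp only [eval_mul, eval_C, eval_pow, eval_add, eval_X]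
      have hp : (y + x) ^ M = (y + x) ^ (M - Multiset.card F.roots) *
          (y + x) ^ Multiset.card F.roots := by
        rw [← pow_add, Nat.sub_add_cancel hcard]
      rw [hp]
      linear_combination (y + x) ^ (M - Multiset.card F.roots) * F.leadingCoeff * h2
    rw [hpoly, coeff_C_mul]
    refine mul_nonneg (hF.pos 0 le_rfl).le (coeff_nonneg_mul (fun b => ?_) (key _ hr 1 one_ne_zero).1 b)
    induction (M - Multiset.card F.roots) generalizing b with
    | zero => rw [pow_zero, coeff_one]; split_ifs <;> simp
    | succ n ih => rw [pow_succ]; exact coeff_nonneg_mul ih (coeff_nonneg_X_add_C hx.le) b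

theorem LeftOf.C_mul {a w : ℝ} {F : ℝ[X]} (h : LeftOf a F) (hw : 0 < w) : LeftOf a (C w * F) :=
  ⟨h.splits.C_mul w, fun x hx => by
    rw [eval_mul, eval_C]; exact mul_pos hw (h.pos x hx)⟩

end Budan

/-! ### Existence and an a priori bound for the largest root -/

section
variable {n d k : ℕ} {A : Matrix (Fin n) (Fin d) ℝ}

theorem trace_eq_sum_lam (A : Matrix (Fin n) (Fin d) ℝ) :
    (Aᵀ * A).trace = ∑ i ∈ Finset.range A.rank, lam A i := by
  have hPSD := posSemidef_conjTranspose_mul_self A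
  have e : Aᵀ * A = Aᴴ * A := by rw [conjTranspose_eq_transpose_of_trivial]
  have h1 := prod_eigenvalues A (fun x => Multiplicative.ofAdd x)
  rw [← ofAdd_sum, ← ofAdd_sum] at h1
  rw [e, (diagonalizes_of_posSemidef hPSD).trace_eq, Multiplicative.ofAdd.injective h1]
  symm
  refine Finset.sum_subset (fun i hi => ?_) fun i hi hi' => ?_
  · exact Finset.mem_range.mpr ((Finset.mem_range.mp hi).trans_le (rank_le A))
  · rw [Finset.mem_range] at hi hi'
    exact not_not.mp (mt (lam_ne_zero_iff A hi).mp hi')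

/-- This bounds the initial interval of the bisection, in the end by `ε X²`. -/
theorem trace_le (hk : k < A.rank) : (Aᵀ * A).trace ≤ A.rank * specNorm A ^ 2 := by
  rw [trace_eq_sum_lam, specNorm_sq_eq_lamFirst A (rank_pos_of_lt hk)]
  have h := Finset.sum_le_sum (s := Finset.range A.rank) (f := fun i => lam A i)
    (g := fun _ => lamFirst A) fun i hi =>
      lam_antitone A (Nat.zero_le i) ((Finset.mem_range.mp hi).trans_le (rank_le A))
  simpa using h

theorem trace_gram_pos (hk : k < A.rank) {S : Finset (Fin d)} (hS : S.card ≤ k) :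
    0 < (gram A S).trace := by
  refine (gram_posSemidef A S).trace_nonneg.lt_of_ne' fun h0 => ?_
  have h1 := rank_gram A S
  rw [(gram_posSemidef A S).trace_eq_zero_iff.mp h0, rank_zero] at h1
  omega

/-- No eigenvalue exceeds the trace, so the characteristic polynomial has no reversed root up to
`y`, and differentiation preserves this. -/
theorem hatRev_pos_of_lt_inv_trace (hk : k < A.rank) {S : Finset (Fin d)} (hS : S.card ≤ k) {y : ℝ}
    (hy : y < ((gram A S).trace)⁻¹) : 0 < (hatRev A k S).eval y := by
  have hT := trace_gram_pos hk hS
  have D := diagonalizes_of_posSemidef (gram_posSemidef A S)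
  generalize ((gram_posSemidef A S).1.eigenvectorUnitary : Matrix (Fin d) (Fin d) ℝ) = U at D
  generalize (gram_posSemidef A S).1.eigenvalues = lam at D
  have hlam : ∀ j, lam j ≤ (gram A S).trace := fun j =>
    D.trace_eq ▸ Finset.single_le_sum (fun j _ => D.nonneg j) (Finset.mem_univ j)
  have hL : LeftOf y (charpolyRev (gram A S)) := by
    refine D.leftOf_charpolyRev.of_no_root fun x hx hxy => ?_
    rw [D.charpolyRev_eq, eval_prod]
    refine Finset.prod_ne_zero_iff.mpr fun j _ => ?_
    simp only [eval_sub, eval_one, eval_mul, eval_C, eval_X]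
    have h1 : lam j * x ≤ (gram A S).trace * x := mul_le_mul_of_nonneg_right (hlam j) hx.le
    have h2 : (gram A S).trace * x < 1 := by
      have := mul_lt_mul_of_pos_left (hxy.trans_lt hy) hT
      rwa [mul_inv_cancel₀ hT.ne'] at this
    linarith
  refine (hL.iterate (k - S.card) ?_).pos y le_rfl
  rw [natDegree_charpolyRev (gram_posSemidef A S)]
  have := rank_gram A S
  omega

/-- Since `k < A.rank`, `hatRev` has positive degree and thus a positive root `y`, which yields the
root `1/y`. `pHat` is nonzero because its roots are bounded above, so there is a largest one. -/
theorem exists_isGreatest_root (hk : k < A.rank) {S : Finset (Fin d)} (hS : S.card ≤ k) :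
    ∃ r, IsGreatest {y | (pHat A k S).IsRoot y} r ∧ 0 ≤ r ∧ r ≤ (gram A S).trace := by
  have hT := trace_gram_pos hk hS
  have hle : ∀ x, (pHat A k S).IsRoot x → x ≤ (gram A S).trace := fun x hx =>
    roots_le_of_hatRev_pos hT (fun y _ hy => hatRev_pos_of_lt_inv_trace hk hS hy) hx
  have hL := hatRev_leftOf (A := A) hk.le hS
  have hrank := rank_gram A S
  obtain ⟨y, hy⟩ : ∃ y, y ∈ (hatRev A k S).roots := by
    refine Multiset.card_pos_iff_exists_mem.mp ?_
    rw [splits_iff_card_roots.mp hL.splits, natDegree_hatRev]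
    omega
  have hy0 := hL.lt_root hy
  have hroot : (pHat A k S).IsRoot y⁻¹ := by
    rw [IsRoot, eval_pHat A k S (inv_ne_zero hy0.ne'), inv_inv,
      ((mem_roots hL.ne_zero).mp hy).eq_zero, mul_zero]
  have hne : pHat A k S ≠ 0 := by
    intro h0
    have := hle ((gram A S).trace + 1) (by rw [h0]; simp)
    linarith
  obtain ⟨r, hr, hmax⟩ := (pHat A k S).roots.toFinset.exists_max_image id
    ⟨y⁻¹, by rw [Multiset.mem_toFinset, mem_roots hne]; exact hroot⟩
  rw [Multiset.mem_toFinset, mem_roots hne] at hr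
  have hmax' : ∀ x, (pHat A k S).IsRoot x → x ≤ r := fun x hx =>
    hmax x (by rw [Multiset.mem_toFinset, mem_roots hne]; exact hx)
  exact ⟨r, ⟨hr, hmax'⟩, (inv_pos.mpr hy0).le.trans (hmax' _ hroot), hle r hr⟩

/-- The factor `w` is there because the algorithm knows the polynomial only up to the positive
factor `M i i`. -/
theorem budan_iff_root_le (hk : k < A.rank) {S : Finset (Fin d)} (hS : S.card ≤ k) {r : ℝ}
    (hr : IsGreatest {y | (pHat A k S).IsRoot y} r) {w : ℝ} (hw : 0 < w) {M : ℕ}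
    (hM : (hatRev A k S).natDegree ≤ M) {x : ℝ} (hx : 0 < x) :
    (∀ b < M + 1, 0 ≤ (horner (C w * hatRev A k S) x (M + 1)).coeff b) ↔ r ≤ x := by
  rw [budan ((hatRev_leftOf hk.le hS).C_mul hw) ((natDegree_C_mul_le _ _).trans hM) hx]
  simp only [eval_mul, eval_C, mul_pos_iff_of_pos_left hw]
  constructor
  · exact fun h => roots_le_of_hatRev_pos hx h hr.1
  · exact fun h y _ hy => hatRev_pos_of_roots_le hk.le hS hx (fun z hz => (hr.2 hz).trans h) hy

end
end ColSubset

/-! ### Block multiplication -/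

namespace ColSubset

/-- The upper left `p × q` corner of an array. -/
def toMat (p q : ℕ) (f : ℕ → ℕ → ℝ) : Matrix (Fin p) (Fin q) ℝ := of fun i j => f i j

theorem toMat_mul_apply {p q r : ℕ} (f g : ℕ → ℕ → ℝ) (i : Fin p) (j : Fin r) :
    (toMat p q f * toMat q r g) i j = ∑ c ∈ Finset.range q, f i c * g c j := by
  rw [Matrix.mul_apply, ← Fin.sum_univ_eq_sum_range (fun c => f i c * g c j)]
  rfl

/-- `W[·, base + ·] := N * W[·, base + ·] + c[j + 1] * R[·, base + ·]`, `base := base + m`. -/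
def blockProg (mm : Prog) : Prog :=
  .seq (.nset 100 (.lit 0) (V 4)) <|
  .seq (forN 8 (V 4) (forN 9 (V 4) (.rset 100 (V 8) (V 9) (.cell 5 (V 8) (V 9))))) <|
  .seq (forN 8 (V 4) (forN 9 (V 4)
    (.rset 101 (V 8) (V 9) (.cell 6 (V 8) (.add (V 11) (V 9)))))) <|
  .seq mm <|
  .seq (forN 8 (V 4) (forN 9 (V 4) (.rset 6 (V 8) (.add (V 11) (V 9))
    (.add (.cell 102 (V 8) (V 9))
      (.mul (.cell 8 (.add (V 7) (.lit 1)) (.lit 0)) (.cell 3 (V 8) (.add (V 11) (V 9))))))))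
  (.nset 11 (.lit 0) (.add (V 11) (V 4)))

theorem blockProg_ens {mm : Prog} {C w : ℝ} (hmm : Multiplies mm C w) {s : Mem} {m j base : ℕ}
    (hm : 0 < m) (h4 : s.nat 4 0 = m) (h11 : s.nat 11 0 = base) (h7 : s.nat 7 0 = j) :
    Ens (blockProg mm) s (C * (m : ℝ) ^ w + 300 * (m : ℝ) ^ 2) fun s' =>
      Eqv [8, 9, 11, 100] [6, 100, 101] s s' ∧ s'.nat 11 0 = base + m ∧
      (∀ a < m, ∀ b < m, s'.real 6 a (base + b) =
        (∑ c ∈ Finset.range m, s.real 5 a c * s.real 6 c (base + b)) +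
          s.real 8 (j + 1) 0 * s.real 3 a (base + b)) ∧
      ∀ x y, y < base ∨ base + m ≤ y → s'.real 6 x y = s.real 6 x y := by
  have A1 : Ens (.nset 100 (.lit 0) (V 4)) s 4 fun s1 =>
      Eqv [8, 9, 11, 100] [6, 100, 101] s s1 ∧ (s1.nat 11 0 = base ∧ s1.nat 100 0 = m) ∧
      s1.real 6 = s.real 6 :=
    Ens.nset (by norm_num [NExpr.cost]) ⟨(Eqv.setNat _ _ _ _).weaken, ⟨by simp [setNat_nat, h11], by
      simp [setNat_nat, NExpr.eval, h4]⟩, rfl⟩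
  have A2 : ∀ s1, (Eqv [8, 9, 11, 100] [6, 100, 101] s s1 ∧
      (s1.nat 11 0 = base ∧ s1.nat 100 0 = m) ∧ s1.real 6 = s.real 6) →
      Ens (forN 8 (V 4) (forN 9 (V 4) (.rset 100 (V 8) (V 9) (.cell 5 (V 8) (V 9))))) s1
      (m * ((m * (10 + 12) + 12) + 12) + 12) fun s2 =>
      Eqv [8, 9, 11, 100] [6, 100, 101] s s2 ∧ (s2.nat 11 0 = base ∧ s2.nat 100 0 = m) ∧
      s2.real 6 = s.real 6 ∧ ∀ a < m, ∀ b < m, s2.real 100 a b = s.real 5 a b := by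
    rintro s1 ⟨e1, h1, h2⟩
    refine (Ens.fill2 (a := 100) (X := []) (Y := []) (t := 10) (N := m) (N' := m) (fun a _ => a)
      (fun _ b => b) (fun a b => s.real 5 a b)
      (fun s2 e2 => ?_) (by intros; omega) ?_).mono (le_of_eq (by norm_num [NExpr.cost])) fun s2 h => ?_
    · simp [NExpr.eval, e2.nat 4, e1.nat 4, h4]
    · intro a _ b _ s2 e2 hv hw _
      exact Ens.fillBody (by norm_num [NExpr.cost, RExpr.cost]) (by simp [NExpr.eval, hv])
        (by simp [NExpr.eval, hw])
        (by simp [NExpr.eval, RExpr.eval, hv, hw, e2.real 5, e1.real 5])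
    · exact ⟨e1.trans h.1.weaken, by simp [h.1.nat 11, h.1.nat 100, h1], by simp [h.1.real 6, h2],
        h.2.1⟩
  have A3 : ∀ s2, (Eqv [8, 9, 11, 100] [6, 100, 101] s s2 ∧
      (s2.nat 11 0 = base ∧ s2.nat 100 0 = m) ∧
      s2.real 6 = s.real 6 ∧ ∀ a < m, ∀ b < m, s2.real 100 a b = s.real 5 a b) →
      Ens (forN 8 (V 4) (forN 9 (V 4)
        (.rset 101 (V 8) (V 9) (.cell 6 (V 8) (.add (V 11) (V 9)))))) s2
      (m * ((m * (13 + 12) + 12) + 12) + 12) fun s3 =>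
      Eqv [8, 9, 11, 100] [6, 100, 101] s s3 ∧ (s3.nat 11 0 = base ∧ s3.nat 100 0 = m) ∧
      s3.real 6 = s.real 6 ∧ (∀ a < m, ∀ b < m, s3.real 100 a b = s.real 5 a b) ∧
      ∀ a < m, ∀ b < m, s3.real 101 a b = s.real 6 a (base + b) := by
    rintro s1 ⟨e1, h1, h2, h3⟩
    refine (Ens.fill2 (a := 101) (X := []) (Y := []) (t := 13) (N := m) (N' := m) (fun a _ => a)
      (fun _ b => b) (fun a b => s.real 6 a (base + b))
      (fun s2 e2 => ?_) (by intros; omega) ?_).mono (le_of_eq (by norm_num [NExpr.cost])) fun s2 h => ?_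
    · simp [NExpr.eval, e2.nat 4, e1.nat 4, h4]
    · intro a _ b _ s2 e2 hv hw _
      exact Ens.fillBody (by norm_num [NExpr.cost, RExpr.cost]) (by simp [NExpr.eval, hv])
        (by simp [NExpr.eval, hw])
        (by simp [NExpr.eval, RExpr.eval, hv, hw, e2.real 6, e2.nat 11, h1, h2])
    · exact ⟨e1.trans h.1.weaken, by simp [h.1.nat 11, h.1.nat 100, h1], by simp [h.1.real 6, h2],
        by simpa [h.1.real 100] using h3, h.2.1⟩
  have A4 : ∀ s3, (Eqv [8, 9, 11, 100] [6, 100, 101] s s3 ∧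
      (s3.nat 11 0 = base ∧ s3.nat 100 0 = m) ∧
      s3.real 6 = s.real 6 ∧ (∀ a < m, ∀ b < m, s3.real 100 a b = s.real 5 a b) ∧
      ∀ a < m, ∀ b < m, s3.real 101 a b = s.real 6 a (base + b)) →
      Ens mm s3 (C * (m : ℝ) ^ w) fun s4 =>
      Eqv [8, 9, 11, 100] [6, 100, 101] s s4 ∧ s4.nat 11 0 = base ∧
      s4.real 6 = s.real 6 ∧ ∀ a < m, ∀ b < m,
        s4.real 102 a b = ∑ c ∈ Finset.range m, s.real 5 a c * s.real 6 c (base + b) := by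
    rintro s1 ⟨e1, h1, h2, h3, h5⟩
    refine (hmm m hm s1 h1.2).mono le_rfl fun s2 h => ⟨e1.trans h.1.weaken, by simp [h.1.nat 11, h1],
      by simp [h.1.real 6, h2], fun a ha b hb => ?_⟩
    rw [h.2 a ha b hb]
    exact Finset.sum_congr rfl fun c hc => by
      rw [h3 a ha c (Finset.mem_range.mp hc), h5 c (Finset.mem_range.mp hc) b hb]
  have A5 : ∀ s4, (Eqv [8, 9, 11, 100] [6, 100, 101] s s4 ∧ s4.nat 11 0 = base ∧
      s4.real 6 = s.real 6 ∧ ∀ a < m, ∀ b < m,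
        s4.real 102 a b = ∑ c ∈ Finset.range m, s.real 5 a c * s.real 6 c (base + b)) →
      Ens (forN 8 (V 4) (forN 9 (V 4) (.rset 6 (V 8) (.add (V 11) (V 9))
        (.add (.cell 102 (V 8) (V 9)) (.mul (.cell 8 (.add (V 7) (.lit 1)) (.lit 0))
          (.cell 3 (V 8) (.add (V 11) (V 9)))))))) s4
      (m * ((m * (30 + 12) + 12) + 12) + 12) fun s' =>
      Eqv [8, 9, 11, 100] [6, 100, 101] s s' ∧ s'.nat 11 0 = base ∧
      (∀ a < m, ∀ b < m, s'.real 6 a (base + b) =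
        (∑ c ∈ Finset.range m, s.real 5 a c * s.real 6 c (base + b)) +
          s.real 8 (j + 1) 0 * s.real 3 a (base + b)) ∧
      ∀ x y, y < base ∨ base + m ≤ y → s'.real 6 x y = s.real 6 x y := by
    rintro s1 ⟨e1, h1, h2, h3⟩
    refine (Ens.fill2 (a := 6) (X := []) (Y := []) (t := 30) (N := m) (N' := m) (fun a _ => a)
      (fun _ b => base + b) (fun a b => (∑ c ∈ Finset.range m, s.real 5 a c * s.real 6 c (base + b)) +
          s.real 8 (j + 1) 0 * s.real 3 a (base + b))
      (fun s2 e2 => ?_) (by intros; omega) ?_).mono (le_of_eq (by norm_num [NExpr.cost]))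
        fun s2 h => ?_
    · simp [NExpr.eval, e2.nat 4, e1.nat 4, h4]
    · intro a ha b hb s2 e2 hv hw _
      exact Ens.fillBody (by norm_num [NExpr.cost, RExpr.cost]) (by simp [NExpr.eval, hv])
        (by simp [NExpr.eval, hw, e2.nat 11, h1])
        (by simp [NExpr.eval, RExpr.eval, hv, hw, e2.real 102, e2.real 8, e1.real 8, e2.real 3,
          e1.real 3, e2.nat 7, e1.nat 7, e2.nat 11, h1, h7, h3 a ha b hb])
    · refine ⟨e1.trans h.1.weaken, by simp [h.1.nat 11, h1], h.2.1, fun x y hxy => ?_⟩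
      rw [h.2.2 x y (by intros; omega), h2]
  have A6 : ∀ s4, (Eqv [8, 9, 11, 100] [6, 100, 101] s s4 ∧ s4.nat 11 0 = base ∧
      (∀ a < m, ∀ b < m, s4.real 6 a (base + b) =
        (∑ c ∈ Finset.range m, s.real 5 a c * s.real 6 c (base + b)) +
          s.real 8 (j + 1) 0 * s.real 3 a (base + b)) ∧
      ∀ x y, y < base ∨ base + m ≤ y → s4.real 6 x y = s.real 6 x y) →
      Ens (.nset 11 (.lit 0) (.add (V 11) (V 4))) s4 7 fun s' =>
      Eqv [8, 9, 11, 100] [6, 100, 101] s s' ∧ s'.nat 11 0 = base + m ∧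
      (∀ a < m, ∀ b < m, s'.real 6 a (base + b) =
        (∑ c ∈ Finset.range m, s.real 5 a c * s.real 6 c (base + b)) +
          s.real 8 (j + 1) 0 * s.real 3 a (base + b)) ∧
      ∀ x y, y < base ∨ base + m ≤ y → s'.real 6 x y = s.real 6 x y := by
    rintro s1 ⟨e1, h1, h2⟩
    exact Ens.nset (by norm_num [NExpr.cost]) ⟨e1.trans (Eqv.setNat _ _ _ _).weaken, by
      simp [setNat_nat, NExpr.eval, h1, e1.nat 4, h4], h2⟩
  refine (A1.seq fun s1 h1 => (A2 s1 h1).seq fun s2 h2 => (A3 s2 h2).seq fun s3 h3 =>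
    (A4 s3 h3).seq fun s4 h4 => (A5 s4 h4).seq fun s5 h5 => A6 s5 h5).mono ?_ fun _ h => h
  -- With `m = 1 + u` the inequality becomes the nonnegativity of a polynomial in `u` with
  -- nonnegative coefficients. The same device settles later estimates.
  obtain ⟨u, hu⟩ : ∃ u : ℝ, (m : ℝ) = 1 + u := ⟨m - 1, by ring⟩
  have : (1 : ℝ) ≤ m := by exact_mod_cast hm
  have : 0 ≤ u := by linarith
  rw [← sub_nonneg, hu]
  ring_nf
  positivity

end ColSubset

/-! ### The Faddeev–LeVerrier recursion -/

namespace ColSubset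

/-- The last block may extend beyond column `d`, into cells with arbitrary contents, which does no
harm. By `m ≤ d` rounding up costs at most a factor 2. -/
theorem exists_blocks {d m : ℕ} (hm : 0 < m) (hmd : m ≤ d) :
    ∃ N : ℕ, d ≤ m * N ∧ (∀ i < N, m * i < d) ∧ (N : ℝ) * m ≤ 2 * d := by
  have h1 := Nat.div_add_mod (d + m - 1) m
  have h2 := Nat.mod_lt (d + m - 1) hm
  refine ⟨(d + m - 1) / m, by omega, fun i hi => ?_, ?_⟩
  · have := Nat.mul_le_mul_left m (Nat.succ_le_of_lt hi)
    rw [Nat.mul_succ] at this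
    omega
  · rw [mul_comm]
    exact_mod_cast (by omega : m * ((d + m - 1) / m) ≤ 2 * d)

/-- `W := N * W + c[j + 1] * R`. -/
def wProg (mm : Prog) : Prog :=
  .seq (.nset 11 (.lit 0) (.lit 0)) (.loop (.nlt (V 11) (V 1)) (blockProg mm))

theorem wProg_ens {mm : Prog} {C w : ℝ} (hC : 0 ≤ C) (hmm : Multiplies mm C w) {s : Mem}
    {m d j : ℕ} (hm : 0 < m) (hmd : m ≤ d) (h4 : s.nat 4 0 = m) (h1 : s.nat 1 0 = d)
    (h7 : s.nat 7 0 = j) :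
    Ens (wProg mm) s (2 * d / m * (C * (m : ℝ) ^ w + 320 * (m : ℝ) ^ 2)) fun s' =>
      Eqv [8, 9, 11, 100] [6, 100, 101] s s' ∧ ∀ a < m, ∀ i < d, s'.real 6 a i =
        (∑ c ∈ Finset.range m, s.real 5 a c * s.real 6 c i) +
          s.real 8 (j + 1) 0 * s.real 3 a i := by
  obtain ⟨N, hN1, hN2, hN3⟩ := exists_blocks hm hmd
  have A1 : Ens (.nset 11 (.lit 0) (.lit 0)) s 3 fun s1 =>
      Eqv [8, 9, 11, 100] [6, 100, 101] s s1 ∧ s1.nat 11 0 = m * 0 ∧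
      (∀ a < m, ∀ i < m * 0, s1.real 6 a i =
        (∑ c ∈ Finset.range m, s.real 5 a c * s.real 6 c i) +
          s.real 8 (j + 1) 0 * s.real 3 a i) ∧
      ∀ a, ∀ i, m * 0 ≤ i → s1.real 6 a i = s.real 6 a i :=
    Ens.nset (by norm_num [NExpr.cost]) ⟨(Eqv.setNat _ _ _ _).weaken,
      by simp [setNat_nat, NExpr.eval], by simp, fun _ _ _ => rfl⟩
  refine (A1.seq fun s1 h1' => (Ens.loop (N := N) (t := C * (m : ℝ) ^ w + 300 * (m : ℝ) ^ 2) (I := fun i s1 =>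
    Eqv [8, 9, 11, 100] [6, 100, 101] s s1 ∧ s1.nat 11 0 = m * i ∧
      (∀ a < m, ∀ i' < m * i, s1.real 6 a i' =
        (∑ c ∈ Finset.range m, s.real 5 a c * s.real 6 c i') +
          s.real 8 (j + 1) 0 * s.real 3 a i') ∧
      ∀ a, ∀ i', m * i ≤ i' → s1.real 6 a i' = s.real 6 a i') ?_ ?_ h1').mono le_rfl
        fun s2 h2 => ⟨h2.1, fun a ha i hi => h2.2.2.1 a ha i (hi.trans_le hN1)⟩).mono ?_
          fun _ h => h
  · rintro i hi s1 ⟨e1, h2, h3, h5⟩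
    refine ⟨by simpa [Test.Holds, NExpr.eval, h2, e1.nat 1, h1] using hN2 i hi, ?_⟩
    refine (blockProg_ens hmm hm (by rw [e1.nat 4, h4]) h2 (j := j) (by rw [e1.nat 7, h7])).mono
      le_rfl fun s2 ⟨e2, h6, h8, h9⟩ => ⟨e1.trans e2, by rw [h6]; ring, fun a ha x hx => ?_,
        fun a x hx => ?_⟩
    · rw [Nat.mul_succ] at hx
      rcases lt_or_ge x (m * i) with h | h
      · rw [h9 _ _ (.inl h), h3 a ha x h]
      · obtain ⟨b, rfl⟩ := Nat.exists_eq_add_of_le h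
        rw [h8 a ha b (by omega), e1.real 5, e1.real 8, e1.real 3]
        simp only [h5 _ _ h]
    · rw [Nat.mul_succ] at hx
      rw [h9 _ _ (.inr hx), h5 _ _ (by omega)]
  · rintro s1 ⟨e1, h2, -⟩
    simpa [Test.Holds, NExpr.eval, h2, e1.nat 1, h1] using hN1
  · simp only [Test.cost, NExpr.cost]
    have hm1 : (1 : ℝ) ≤ m := by exact_mod_cast hm
    have hd1 : (m : ℝ) ≤ d := by exact_mod_cast hmd
    have hN : (N : ℝ) ≤ 2 * d / m := by rw [le_div_iff₀ (by linarith)]; exact hN3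
    have hw : 0 ≤ C * (m : ℝ) ^ w := by positivity
    have h2 : 2 ≤ 2 * (d : ℝ) / m := by rw [le_div_iff₀ (by linarith)]; linarith
    have h3 : (1 : ℝ) ≤ (m : ℝ) ^ 2 := one_le_pow₀ hm1
    have h4 : (N : ℝ) * (C * (m : ℝ) ^ w + 310 * (m : ℝ) ^ 2) ≤
        2 * d / m * (C * (m : ℝ) ^ w + 310 * (m : ℝ) ^ 2) :=
      mul_le_mul_of_nonneg_right hN (by positivity)
    have h5 : (N : ℝ) * (C * (m : ℝ) ^ w + 300 * (m : ℝ) ^ 2 + 6) ≤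
        (N : ℝ) * (C * (m : ℝ) ^ w + 310 * (m : ℝ) ^ 2) :=
      mul_le_mul_of_nonneg_left (by linarith) (by positivity)
    have h6 : 2 * (10 * 1) ≤ 2 * (d : ℝ) / m * (10 * (m : ℝ) ^ 2) :=
      mul_le_mul h2 (by linarith) (by norm_num) (by linarith)
    push_cast
    linarith

/-- One step of the Faddeev–LeVerrier recursion. -/
def stepProg (mm : Prog) : Prog :=
  .seq (forN 6 (V 1) (.seq
    (sumN 10 (V 4) 11 (.mul (.cell 4 (V 6) (V 10)) (.cell 6 (V 10) (V 6))))
    (.rset 7 (V 6) (V 7) (RV 11)))) <|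
  .seq (.seq (sumN 10 (V 1) 11 (.cell 7 (V 10) (V 7)))
    (.rset 8 (.add (V 7) (.lit 1)) (.lit 0)
      (.div (.sub (.lit 0) (RV 11)) (.add (.ofNat (V 7)) (.lit 1))))) <|
  wProg mm

/-- The order is forced: the diagonal of `L W` comes from the old `W`, its sum gives the next
coefficient, and this coefficient enters the new `W`. -/
theorem stepProg_ens {mm : Prog} {C w : ℝ} (hC : 0 ≤ C) (hmm : Multiplies mm C w) {s : Mem}
    {m d j : ℕ} (hm : 0 < m) (hmd : m ≤ d) (h4 : s.nat 4 0 = m) (h1 : s.nat 1 0 = d)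
    (h7 : s.nat 7 0 = j) :
    Ens (stepProg mm) s (2 * d / m * (C * (m : ℝ) ^ w + 320 * (m : ℝ) ^ 2) + 200 * d * m) fun s' =>
      Eqv [6, 8, 9, 10, 11, 100] [6, 7, 8, 11, 100, 101] s s' ∧
      (∀ i < d, s'.real 7 i j = ∑ c ∈ Finset.range m, s.real 4 i c * s.real 6 c i) ∧
      (∀ x y, y ≠ j → s'.real 7 x y = s.real 7 x y) ∧
      s'.real 8 (j + 1) 0 = (0 - ∑ i ∈ Finset.range d, s'.real 7 i j) / ((j : ℝ) + 1) ∧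
      (∀ x, x ≠ j + 1 → s'.real 8 x 0 = s.real 8 x 0) ∧
      ∀ a < m, ∀ i < d, s'.real 6 a i =
        (∑ c ∈ Finset.range m, s.real 5 a c * s.real 6 c i) +
          s'.real 8 (j + 1) 0 * s.real 3 a i := by
  have A1 : Ens (forN 6 (V 1) (.seq
      (sumN 10 (V 4) 11 (.mul (.cell 4 (V 6) (V 10)) (.cell 6 (V 10) (V 6))))
      (.rset 7 (V 6) (V 7) (RV 11)))) s (d * ((m * 30 + 24) + 12) + 12) fun s1 =>
      Eqv [6, 10] [7, 11] s s1 ∧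
      (∀ i < d, s1.real 7 i j = ∑ c ∈ Finset.range m, s.real 4 i c * s.real 6 c i) ∧
      (∀ x y, y ≠ j → s1.real 7 x y = s.real 7 x y) := by
    refine (Ens.fill (a := 7) (X := [10]) (Y := [11]) (t := m * 30 + 24) (N := d) (fun i => i)
      (fun _ => j) (fun i => ∑ c ∈ Finset.range m, s.real 4 i c * s.real 6 c i)
      (fun s2 e2 => ?_) (by intros; omega) ?_).mono (le_of_eq (by norm_num [NExpr.cost]))
        fun s2 h => ⟨h.1, h.2.1, fun x y hy => h.2.2 x y (by intros; omega)⟩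
    · simp [NExpr.eval, e2.nat 1, h1]
    · intro i hi s1 e1 hv _
      refine (Ens.fillSum (N := m) (x₀ := i) (y₀ := j) (fun c => s.real 4 i c * s.real 6 c i)
        (fun s2 e2 => ?_) (fun c hc s2 e2 hc' => ?_) (fun s2 e2 h2 => ?_) ?_).mono le_rfl
          fun s2 h2 => ⟨h2.1, h2.2⟩
      · simp [NExpr.eval, e2.nat 4, e1.nat 4, h4]
      · simp [NExpr.eval, RExpr.eval, e2.real 4, e1.real 4, e2.real 6, e1.real 6, e2.nat 6, hv, hc']
      · simp [NExpr.eval, RExpr.eval, e2.nat 6, hv, e2.nat 7, e1.nat 7, h7, h2]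
      · norm_num [NExpr.cost, RExpr.cost]
        linarith
  have A2 : ∀ s1, (Eqv [6, 10] [7, 11] s s1 ∧
      (∀ i < d, s1.real 7 i j = ∑ c ∈ Finset.range m, s.real 4 i c * s.real 6 c i) ∧
      (∀ x y, y ≠ j → s1.real 7 x y = s.real 7 x y)) →
      Ens (.seq (sumN 10 (V 1) 11 (.cell 7 (V 10) (V 7)))
        (.rset 8 (.add (V 7) (.lit 1)) (.lit 0)
        (.div (.sub (.lit 0) (RV 11)) (.add (.ofNat (V 7)) (.lit 1))))) s1 (d * 30 + 40) fun s2 =>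
      Eqv [6, 10] [7, 8, 11] s s2 ∧
      (∀ i < d, s2.real 7 i j = ∑ c ∈ Finset.range m, s.real 4 i c * s.real 6 c i) ∧
      (∀ x y, y ≠ j → s2.real 7 x y = s.real 7 x y) ∧
      s2.real 8 (j + 1) 0 = (0 - ∑ i ∈ Finset.range d, s2.real 7 i j) / ((j : ℝ) + 1) ∧
      (∀ x, x ≠ j + 1 → s2.real 8 x 0 = s.real 8 x 0) := by
    rintro s1 ⟨e1, h2, h3⟩
    refine (Ens.fillSum (N := d) (x₀ := j + 1) (y₀ := 0)
      (z := (0 - ∑ i ∈ Finset.range d, s1.real 7 i j) / ((j : ℝ) + 1)) (fun c => s1.real 7 c j)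
      (fun s2 e2 => ?_) (fun c hc s2 e2 hc' => ?_) (fun s2 e2 h2 => ?_) ?_).mono le_rfl
        fun s2 h => ?_
    · simp [NExpr.eval, e2.nat 1, e1.nat 1, h1]
    · simp [NExpr.eval, RExpr.eval, e2.real 7, e2.nat 7, e1.nat 7, h7, hc']
    · simp [NExpr.eval, RExpr.eval, e2.nat 7, e1.nat 7, h7, h2]
    · norm_num [NExpr.cost, RExpr.cost]
      linarith
    · refine ⟨e1.weaken.trans h.1.weaken, by simpa [h.1.real 7] using h2,
        by simpa [h.1.real 7] using h3, by simp [h.2, h.1.real 7], fun x hx => ?_⟩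
      rw [h.2, if_neg (by simp [hx]), e1.real 8]
  refine (A1.seq fun s1 h1' => (A2 s1 h1').seq fun s2 ⟨e2, h2, h3, h5, h6⟩ =>
    (wProg_ens (j := j) hC hmm hm hmd (by rw [e2.nat 4, h4]) (by rw [e2.nat 1, h1])
      (by rw [e2.nat 7, h7])).mono le_rfl fun s3 ⟨e3, h8⟩ =>
      ⟨e2.weaken.trans e3.weaken, ?_⟩).mono ?_ fun _ h => h
  · obtain ⟨u, hu⟩ : ∃ u : ℝ, (m : ℝ) = 1 + u := ⟨m - 1, by ring⟩
    obtain ⟨v, hv⟩ : ∃ v : ℝ, (d : ℝ) = 1 + v := ⟨d - 1, by ring⟩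
    have hu0 : 0 ≤ u := by
      have : (1 : ℝ) ≤ m := by exact_mod_cast hm
      linarith
    have hv0 : 0 ≤ v := by
      have : (1 : ℝ) ≤ d := by exact_mod_cast hm.trans_le hmd
      linarith
    have : (d * ((m * 30 + 24) + 12) + 12) + (d * 30 + 40) ≤ 200 * (d : ℝ) * m := by
      rw [← sub_nonneg, hu, hv]
      ring_nf
      positivity
    linarith
  · rw [e3.real 7, e3.real 8]
    refine ⟨h2, h3, h5, h6, ?_⟩
    rw [e2.real 5, e2.real 6, e2.real 3] at h8
    exact h8

end ColSubset

/-! ### The coefficients of the characteristic polynomials -/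

namespace ColSubset

/-- The coefficients of `charpolyRev M` and the diagonals of the matrices `coeffMat`, for
`M = L * R`. -/
def coeffProg (mm : Prog) : Prog :=
  .seq (forN 8 (V 4) (forN 9 (V 4) (.seq
    (sumN 10 (V 1) 11 (.mul (.cell 3 (V 8) (V 10)) (.cell 4 (V 10) (V 9))))
    (.rset 5 (V 8) (V 9) (RV 11))))) <|
  .seq (forN 8 (V 4) (forN 6 (V 1) (.rset 6 (V 8) (V 6) (.cell 3 (V 8) (V 6))))) <|
  .seq (.rset 8 (.lit 0) (.lit 0) (.lit 1)) <|
  forN 7 (.add (V 4) (.lit 1)) (stepProg mm)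

/-- Each of the `m + 1` steps costs `d/m` products of size `m`, in total `O(d m^w)`. The preparation
and the traces take `O(d m²)`, which `w ≥ 2` absorbs. -/
theorem coeffProg_ens {mm : Prog} {C w : ℝ} (hw : 2 ≤ w) (hC : 0 ≤ C) (hmm : Multiplies mm C w)
    {s : Mem} {m d : ℕ} (hm : 0 < m) (hmd : m ≤ d) (h4 : s.nat 4 0 = m) (h1 : s.nat 1 0 = d)
    {M U : Matrix (Fin d) (Fin d) ℝ} {lam : Fin d → ℝ} (D : Diagonalizes M U lam)
    (hM : toMat d m (s.real 4) * toMat m d (s.real 3) = M) :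
    Ens (coeffProg mm) s ((4 * C + 3000) * (d * (m : ℝ) ^ w)) fun s' =>
      Eqv [6, 7, 8, 9, 10, 11, 100] [5, 6, 7, 8, 11, 100, 101] s s' ∧
      (∀ (i : Fin d), ∀ j < m + 1,
        s'.real 7 i j = (weighted lam fun a => U i a ^ 2).coeff j) ∧
      ∀ j < m + 1, s'.real 8 j 0 = (charpolyRev M).coeff j := by
  have hm1 : (1 : ℝ) ≤ m := by exact_mod_cast hm
  have hd1 : (1 : ℝ) ≤ d := by exact_mod_cast hm.trans_le hmd
  have A1 : Ens (forN 8 (V 4) (forN 9 (V 4) (.seq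
      (sumN 10 (V 1) 11 (.mul (.cell 3 (V 8) (V 10)) (.cell 4 (V 10) (V 9))))
      (.rset 5 (V 8) (V 9) (RV 11))))) s
      (m * ((m * ((d * 30 + 24) + 12) + 12) + 12) + 12) fun s1 =>
      Eqv [6, 8, 9, 10] [5, 6, 8, 11] s s1 ∧ ∀ a < m, ∀ b < m,
        s1.real 5 a b = ∑ c ∈ Finset.range d, s.real 3 a c * s.real 4 c b := by
    refine (Ens.fill2 (a := 5) (X := [10]) (Y := [11]) (t := d * 30 + 24) (N := m) (N' := m)
      (fun a _ => a) (fun _ b => b)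
      (fun a b => ∑ c ∈ Finset.range d, s.real 3 a c * s.real 4 c b)
      (fun s2 e2 => ?_) (by intros; omega) ?_).mono (le_of_eq (by norm_num [NExpr.cost]))
        fun s2 h => ⟨h.1.weaken, h.2.1⟩
    · simp [NExpr.eval, e2.nat 4, h4]
    · intro a _ b _ s1 e1 hv hv' _
      refine (Ens.fillSum (N := d) (x₀ := a) (y₀ := b) (fun c => s.real 3 a c * s.real 4 c b)
        (fun s2 e2 => ?_) (fun c hc s2 e2 hc' => ?_) (fun s2 e2 h2 => ?_) ?_).mono le_rfl
          fun s2 h2 => ⟨h2.1, h2.2⟩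
      · simp [NExpr.eval, e2.nat 1, e1.nat 1, h1]
      · simp [NExpr.eval, RExpr.eval, e2.real 4, e1.real 4, e2.real 3, e1.real 3, e2.nat 8,
          e2.nat 9, hv, hv', hc']
      · simp [NExpr.eval, RExpr.eval, e2.nat 8, hv, e2.nat 9, hv', h2]
      · norm_num [NExpr.cost, RExpr.cost]
        linarith
  have A2 : ∀ s1, (Eqv [6, 8, 9, 10] [5, 6, 8, 11] s s1 ∧ ∀ a < m, ∀ b < m,
        s1.real 5 a b = ∑ c ∈ Finset.range d, s.real 3 a c * s.real 4 c b) →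
      Ens (forN 8 (V 4) (forN 6 (V 1) (.rset 6 (V 8) (V 6) (.cell 3 (V 8) (V 6))))) s1
        (m * ((d * (10 + 12) + 12) + 12) + 12) fun s2 =>
        Eqv [6, 8, 9, 10] [5, 6, 8, 11] s s2 ∧ (∀ a < m, ∀ b < m,
          s2.real 5 a b = ∑ c ∈ Finset.range d, s.real 3 a c * s.real 4 c b) ∧
        ∀ a < m, ∀ i < d, s2.real 6 a i = s.real 3 a i := by
    rintro s1 ⟨e1, h2⟩
    refine (Ens.fill2 (a := 6) (X := []) (Y := []) (t := 10) (N := m) (N' := d)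
      (fun a _ => a) (fun _ b => b) (fun a i => s.real 3 a i)
      (fun s2 e2 => ?_) (by intros; omega) ?_).mono (le_of_eq (by norm_num [NExpr.cost]))
        fun s2 h => ⟨e1.trans h.1.weaken, by simpa [h.1.real 5] using h2, h.2.1⟩
    · simp [NExpr.eval, e2.nat 4, h4, e2.nat 1, h1, e1.nat 1, e1.nat 4]
    · intro a _ b _ s2 e2 hv hw _
      exact Ens.fillBody (by norm_num [NExpr.cost, RExpr.cost]) (by simp [NExpr.eval, hv])
        (by simp [NExpr.eval, hw])
        (by simp [NExpr.eval, RExpr.eval, hv, hw, e2.real 3, e1.real 3])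
  have A3 : ∀ s2, (Eqv [6, 8, 9, 10] [5, 6, 8, 11] s s2 ∧ (∀ a < m, ∀ b < m,
          s2.real 5 a b = ∑ c ∈ Finset.range d, s.real 3 a c * s.real 4 c b) ∧
        ∀ a < m, ∀ i < d, s2.real 6 a i = s.real 3 a i) →
      Ens (.rset 8 (.lit 0) (.lit 0) (.lit 1)) s2 4 fun s3 =>
        Eqv [6, 8, 9, 10] [5, 6, 8, 11] s s3 ∧
        toMat m m (s3.real 5) = toMat m d (s.real 3) * toMat d m (s.real 4) ∧
        toMat m d (s3.real 6) = toMat m d (s.real 3) ∧ s3.real 8 0 0 = 1 := by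
    rintro s1 ⟨e1, h2, h3⟩
    refine Ens.rset (by norm_num [NExpr.cost, RExpr.cost]) ⟨e1.trans (Eqv.setReal _ _ _ _ _).weaken,
      ?_, ?_, by simp [setReal_real, NExpr.eval, RExpr.eval]⟩
    · ext a b
      rw [toMat_mul_apply, ← h2 a a.2 b b.2]
      simp [toMat, setReal_real]
    · ext a b
      simp [toMat, setReal_real, h3]
  have A4 : ∀ s3, (Eqv [6, 8, 9, 10] [5, 6, 8, 11] s s3 ∧
        toMat m m (s3.real 5) = toMat m d (s.real 3) * toMat d m (s.real 4) ∧
        toMat m d (s3.real 6) = toMat m d (s.real 3) ∧ s3.real 8 0 0 = 1) →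
      Ens (forN 7 (.add (V 4) (.lit 1)) (stepProg mm)) s3
        (((m + 1 : ℕ) : ℝ) * ((2 * d / m * (C * (m : ℝ) ^ w + 320 * (m : ℝ) ^ 2) + 200 * d * m) +
          (((NExpr.add (V 4) (.lit 1)).cost : ℝ) + 10)) +
          (((NExpr.add (V 4) (.lit 1)).cost : ℝ) + 10)) fun s' =>
      Eqv [6, 7, 8, 9, 10, 11, 100] [5, 6, 7, 8, 11, 100, 101] s s' ∧
      (∀ (i : Fin d), ∀ j < m + 1,
        s'.real 7 i j = (weighted lam fun a => U i a ^ 2).coeff j) ∧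
      ∀ j < m + 1, s'.real 8 j 0 = (charpolyRev M).coeff j := by
    rintro s3 ⟨e3, hN, hW, hc⟩
    have hL : toMat d m (s3.real 4) = toMat d m (s.real 4) := by rw [e3.real 4]
    -- The invariant: the diagonals up to `j - 1`, the coefficients up to `j`, and `L W = coeffMat U
    -- lam j`.
    refine (Ens.forR (X := [6, 8, 9, 10, 11, 100]) (Y := [6, 7, 8, 11, 100, 101]) (N := m + 1)
      (J := fun j r => (∀ i : Fin d, ∀ j' < j,
          r 7 i j' = (weighted lam fun a => U i a ^ 2).coeff j') ∧
        (∀ j' < j + 1, r 8 j' 0 = (charpolyRev M).coeff j') ∧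
        toMat d m (s.real 4) * toMat m d (r 6) = coeffMat U lam j)
      (fun s2 e2 => ?_) ?_ ?_).mono le_rfl fun s2 h => ⟨e3.weaken.trans h.1.weaken, h.2.1,
        fun j hj => h.2.2.1 j (by omega)⟩
    · simp [NExpr.eval, e2.nat 4, h4, e3.nat 4]
    · refine ⟨by simp, fun j hj => ?_, ?_⟩
      · obtain rfl : j = 0 := by omega
        rw [hc, D.charpolyRev_eq, coeff_zero_eq_eval_zero, eval_prod]
        simp
      · rw [hW, hM, D.coeffMat_zero]
    · rintro j hj s1 e1 hv ⟨g1, g2, g3⟩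
      refine (stepProg_ens (j := j) hC hmm hm hmd (by rw [e1.nat 4, e3.nat 4, h4])
        (by rw [e1.nat 1, e3.nat 1, h1]) hv).mono le_rfl fun s2 ⟨e2, k1, k2, k3, k4, k5⟩ => ?_
      have q : ∀ i : Fin d, s2.real 7 i j = coeffMat U lam j i i := fun i => by
        rw [← g3, toMat_mul_apply, k1 i i.2, e1.real 4, e3.real 4]
      have cc : s2.real 8 (j + 1) 0 = (charpolyRev M).coeff (j + 1) := by
        rw [k3, D.coeff_succ, ← Fin.sum_univ_eq_sum_range fun i => s2.real 7 i j]
        simp only [q]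
      refine ⟨e2.weaken, fun i j' hj' => ?_, fun j' hj' => ?_, ?_⟩
      · rcases Nat.lt_succ_iff_lt_or_eq.mp hj' with h | rfl
        · rw [k2 _ _ h.ne, g1 i j' h]
        · rw [q, coeffMat_apply_self]
      · rcases Nat.lt_succ_iff_lt_or_eq.mp hj' with h | rfl
        · rw [k4 _ h.ne, g2 j' h]
        · exact cc
      · rw [← D.coeffMat_succ hM g3]
        congr 1
        ext a i
        rw [Matrix.add_apply, Matrix.smul_apply, ← hN, toMat_mul_apply]
        have := k5 a a.2 i i.2
        rw [cc, e1.real 5, e1.real 3, e3.real 3] at this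
        exact this
  refine (A1.seq fun s1 h1' => (A2 s1 h1').seq fun s2 h2' => (A3 s2 h2').seq fun s3 h3' =>
    A4 s3 h3').mono ?_ fun _ h => h
  have hmw : (m : ℝ) ^ 2 ≤ (m : ℝ) ^ w := by
    rw [← Real.rpow_natCast]
    exact Real.rpow_le_rpow_of_exponent_le hm1 (by exact_mod_cast hw)
  have hm0 : (m : ℝ) ≠ 0 := by linarith
  have e : (m : ℝ) * (2 * d / m * (C * (m : ℝ) ^ w + 320 * (m : ℝ) ^ 2)) =
    2 * d * (C * (m : ℝ) ^ w + 320 * (m : ℝ) ^ 2) := by field_simp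
  have e' : 2 * d / m * (C * (m : ℝ) ^ w + 320 * (m : ℝ) ^ 2) ≤
    2 * d * (C * (m : ℝ) ^ w + 320 * (m : ℝ) ^ 2) := by
    refine mul_le_mul_of_nonneg_right (div_le_self (by positivity) hm1) (by positivity)
  have key : (m * ((m * ((d * 30 + 24) + 12) + 12) + 12) + 12) +
      ((m * ((d * (10 + 12) + 12) + 12) + 12) + (4 + ((m + 1) * (200 * d * m + 14) + 14))) ≤
      1700 * (d * (m : ℝ) ^ 2) := by
    obtain ⟨u, hu⟩ : ∃ u : ℝ, (m : ℝ) = 1 + u := ⟨m - 1, by ring⟩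
    obtain ⟨v, hv⟩ : ∃ v : ℝ, (d : ℝ) = 1 + v := ⟨d - 1, by ring⟩
    have hu0 : 0 ≤ u := by linarith
    have hv0 : 0 ≤ v := by linarith
    rw [← sub_nonneg, hu, hv]
    ring_nf
    positivity
  have h5 : (d : ℝ) * (m : ℝ) ^ 2 ≤ d * (m : ℝ) ^ w := mul_le_mul_of_nonneg_left hmw (by linarith)
  have h6 : 0 ≤ (d : ℝ) * (m : ℝ) ^ w := by positivity
  simp only [NExpr.cost]
  push_cast
  generalize 2 * (d : ℝ) / m * (C * (m : ℝ) ^ w + 320 * (m : ℝ) ^ 2) = Y at e e' ⊢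
  linarith

end ColSubset

/-! ### A step of the bisection -/

namespace ColSubset

/-- The loops of `bisectProg` that expand `horner G x`. -/
def hornerProg : Prog :=
  .seq (forN 8 (.add (V 17) (.lit 1)) (.rset 10 (V 8) (.lit 0) (.cell 9 (V 18) (V 8)))) <|
  .seq (forN 9 (.add (V 17) (.lit 1)) (.rset 10 (.lit 0) (.add (V 9) (.lit 1)) (.lit 0))) <|
  forN 8 (.add (V 17) (.lit 1)) (forN 9 (.add (V 17) (.lit 1))
    (.rset 10 (.add (V 8) (.lit 1)) (.add (V 9) (.lit 1))
      (.add (.mul (RV 15) (.cell 10 (V 8) (.add (V 9) (.lit 1)))) (.cell 10 (V 8) (V 9)))))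

/-- Column `b + 1` of row `j` of the table holds the `b`-th coefficient of `horner G x j`. Column
`0` holds the coefficients of `G`, so that one rule, `x T[j, b+1] + T[j, b]`, also covers the
constant coefficient. -/
theorem hornerProg_ens {s : Mem} {M κ : ℕ} (h17 : s.nat 17 0 = M) (h18 : s.nat 18 0 = κ)
    {G : ℝ[X]} (hG : ∀ a < M + 1, s.real 9 κ a = G.coeff a) :
    Ens hornerProg s (200 * ((M : ℝ) + 1) ^ 2) fun s' => Eqv [8, 9] [10] s s' ∧
      ∀ b < M + 1, s'.real 10 (M + 1) (b + 1) = (horner G (s.real 15 0 0) (M + 1)).coeff b := by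
  have A1 : Ens (forN 8 (.add (V 17) (.lit 1)) (.rset 10 (V 8) (.lit 0) (.cell 9 (V 18) (V 8)))) s
      ((M + 1) * (9 + (4 + 10)) + (4 + 10)) fun s1 => Eqv [8, 9] [10] s s1 ∧
      ∀ a < M + 1, s1.real 10 a 0 = G.coeff a := by
    refine (Ens.fill (a := 10) (X := []) (Y := []) (t := 9) (N := M + 1) (fun a => a) (fun _ => 0)
      (fun a => G.coeff a) (fun s2 e2 => ?_) (by intros; omega) ?_).mono
        (le_of_eq (by norm_num [NExpr.cost])) fun s2 h => ⟨h.1.weaken, h.2.1⟩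
    · simp [NExpr.eval, e2.nat 17, h17]
    · intro a ha s1 e1 hv _
      exact Ens.fillBody (by norm_num [NExpr.cost, RExpr.cost]) (by simp [NExpr.eval, hv])
        (by simp [NExpr.eval])
        (by simp [NExpr.eval, RExpr.eval, hv, e1.real 9, e1.nat 18, h18, hG a ha])
  have A2 : ∀ s1, (Eqv [8, 9] [10] s s1 ∧ ∀ a < M + 1, s1.real 10 a 0 = G.coeff a) →
      Ens (forN 9 (.add (V 17) (.lit 1)) (.rset 10 (.lit 0) (.add (V 9) (.lit 1)) (.lit 0))) s1
      ((M + 1) * (7 + (4 + 10)) + (4 + 10)) fun s2 => Eqv [8, 9] [10] s s2 ∧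
      (∀ a < M + 1, s2.real 10 a 0 = G.coeff a) ∧ ∀ b < M + 1, s2.real 10 0 (b + 1) = 0 := by
    rintro s1 ⟨e1, h1⟩
    refine (Ens.fill (a := 10) (X := []) (Y := []) (t := 7) (N := M + 1) (fun _ => 0)
      (fun b => b + 1) (fun b => 0) (fun s2 e2 => ?_) (by intros; omega) ?_).mono
        (le_of_eq (by norm_num [NExpr.cost])) fun s2 h => ⟨e1.trans h.1.weaken, fun a ha => ?_,
          h.2.1⟩
    · simp [NExpr.eval, e2.nat 17, e1.nat 17, h17]
    · intro a ha s2 e2 hv _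
      exact Ens.fillBody (by norm_num [NExpr.cost, RExpr.cost]) (by simp [NExpr.eval])
        (by simp [NExpr.eval, hv]) (by simp [RExpr.eval])
    · rw [h.2.2 _ _ (by intros; omega), h1 a ha]
  have A3 : ∀ s2, (Eqv [8, 9] [10] s s2 ∧
      (∀ a < M + 1, s2.real 10 a 0 = G.coeff a) ∧ ∀ b < M + 1, s2.real 10 0 (b + 1) = 0) →
      Ens (forN 8 (.add (V 17) (.lit 1)) (forN 9 (.add (V 17) (.lit 1))
        (.rset 10 (.add (V 8) (.lit 1)) (.add (V 9) (.lit 1))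
        (.add (.mul (RV 15) (.cell 10 (V 8) (.add (V 9) (.lit 1)))) (.cell 10 (V 8) (V 9)))))) s2
      ((M + 1) * (((M + 1) * (27 + (4 + 10)) + (4 + 10)) + (4 + 10)) + (4 + 10)) fun s' =>
      Eqv [8, 9] [10] s s' ∧
      ∀ b < M + 1, s'.real 10 (M + 1) (b + 1) = (horner G (s.real 15 0 0) (M + 1)).coeff b := by
    rintro s2 ⟨e2, h1, h2⟩
    refine (Ens.forR (X := [9]) (Y := [10]) (N := M + 1)
      (t := (M + 1) * (27 + (4 + 10)) + (4 + 10)) (J := fun j r =>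
        (∀ a < M + 1, r 10 a 0 = G.coeff a) ∧
        ∀ b < M + 1, r 10 j (b + 1) = (horner G (s.real 15 0 0) j).coeff b)
      (fun s3 e3 => ?_) ⟨h1, by simpa [horner] using h2⟩ ?_).mono
        (le_of_eq (by norm_num [NExpr.cost])) fun s3 h => ⟨e2.trans h.1, h.2.2⟩
    · simp [NExpr.eval, e3.nat 17, e2.nat 17, h17]
    · rintro j hj s3 e3 hv ⟨g1, g2⟩
      refine (Ens.fill (a := 10) (X := []) (Y := []) (t := 27) (N := M + 1) (fun _ => j + 1)
        (fun b => b + 1) (fun b => (horner G (s.real 15 0 0) (j + 1)).coeff b)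
        (fun s4 e4 => ?_) (by intros; omega) ?_).mono (le_of_eq (by norm_num [NExpr.cost]))
          fun s4 h => ⟨h.1, fun a ha => ?_, h.2.1⟩
      · simp [NExpr.eval, e4.nat 17, e3.nat 17, e2.nat 17, h17]
      · intro b hb s4 e4 hw hun
        have hx : s4.real 15 0 0 = s.real 15 0 0 := by rw [e4.real 15, e3.real 15, e2.real 15]
        have hv4 : s4.nat 8 0 = j := by rw [e4.nat 8, hv]
        refine Ens.fillBody (by norm_num [NExpr.cost, RExpr.cost]) (by simp [NExpr.eval, hv4])
          (by simp [NExpr.eval, hw]) ?_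
        simp only [NExpr.eval, RExpr.eval, hv4, hw, hx]
        rw [hun _ _ (by intros; omega), hun _ _ (by intros; omega), g2 b hb]
        rcases b with _ | b
        · rw [g1 j hj, coeff_zero_horner_succ]
        · rw [g2 b (by omega), coeff_succ_horner_succ]
      · rw [h.2.2 _ _ (by intros; omega), g1 a ha]
  refine (A1.seq fun s1 h1' => (A2 s1 h1').seq fun s2 h2' => A3 s2 h2').mono ?_ fun _ h => h
  have : 0 ≤ (M : ℝ) := by positivity
  rw [← sub_nonneg]
  ring_nf
  positivity

/-- One step of the bisection. -/
def bisectProg : Prog :=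
  .seq (.rset 15 (.lit 0) (.lit 0) (.div (.add (RV 13) (RV 14)) (.lit 2))) <|
  .seq hornerProg <|
  .seq (.nset 15 (.lit 0) (.lit 0)) <|
  .seq (forN 9 (.add (V 17) (.lit 1))
    (.ite (.rlt (.cell 10 (.add (V 17) (.lit 1)) (.add (V 9) (.lit 1))) (.lit 0))
      (.nset 15 (.lit 0) (.lit 1)) .skip)) <|
  .ite (.nlt (V 15) (.lit 1)) (.rset 14 (.lit 0) (.lit 0) (RV 15))
    (.rset 13 (.lit 0) (.lit 0) (RV 15))

theorem bisectProg_ens {s : Mem} {M κ : ℕ} (h17 : s.nat 17 0 = M) (h18 : s.nat 18 0 = κ)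
    {G : ℝ[X]} (hG : ∀ a < M + 1, s.real 9 κ a = G.coeff a) {lo hi x : ℝ}
    (hlo : s.real 13 0 0 = lo) (hhi : s.real 14 0 0 = hi) (hx : (lo + hi) / 2 = x) :
    Ens bisectProg s (300 * ((M : ℝ) + 1) ^ 2) fun s' => Eqv [8, 9, 15] [10, 13, 14, 15] s s' ∧
      (((∀ b < M + 1, 0 ≤ (horner G x (M + 1)).coeff b) ∧
          s'.real 13 0 0 = lo ∧ s'.real 14 0 0 = x) ∨
        ((¬ ∀ b < M + 1, 0 ≤ (horner G x (M + 1)).coeff b) ∧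
          s'.real 13 0 0 = x ∧ s'.real 14 0 0 = hi)) := by
  have A1 : Ens (.rset 15 (.lit 0) (.lit 0) (.div (.add (RV 13) (RV 14)) (.lit 2))) s 12 fun s1 =>
      Eqv [8, 9, 15] [10, 15] s s1 ∧ s1.real 15 0 0 = x :=
    Ens.rset (by norm_num [NExpr.cost, RExpr.cost]) ⟨(Eqv.setReal _ _ _ _ _).weaken, by
      simp [setReal_real, NExpr.eval, RExpr.eval, hlo, hhi, hx]⟩
  have A2 : ∀ s1, (Eqv [8, 9, 15] [10, 15] s s1 ∧ s1.real 15 0 0 = x) →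
      Ens hornerProg s1 (200 * ((M : ℝ) + 1) ^ 2) fun s2 =>
      Eqv [8, 9, 15] [10, 15] s s2 ∧ s2.real 15 0 0 = x ∧
      ∀ b < M + 1, s2.real 10 (M + 1) (b + 1) = (horner G x (M + 1)).coeff b := by
    rintro s1 ⟨e1, h1⟩
    refine (hornerProg_ens (by rw [e1.nat 17, h17]) (by rw [e1.nat 18, h18])
      (by rw [e1.real 9]; exact hG)).mono le_rfl fun s2 h => ⟨e1.trans h.1.weaken, ?_, ?_⟩
    · rw [h.1.real 15, h1]
    · rw [← h1]; exact h.2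
  have A3 : ∀ s2, (Eqv [8, 9, 15] [10, 15] s s2 ∧ s2.real 15 0 0 = x ∧
      ∀ b < M + 1, s2.real 10 (M + 1) (b + 1) = (horner G x (M + 1)).coeff b) →
      Ens (.nset 15 (.lit 0) (.lit 0)) s2 3 fun s3 =>
      (Eqv [8, 9, 15] [10, 15] s s3 ∧ s3.real 15 0 0 = x ∧
      ∀ b < M + 1, s3.real 10 (M + 1) (b + 1) = (horner G x (M + 1)).coeff b) ∧
      s3.nat 15 0 = 0 := by
    rintro s2 ⟨e2, h2, h3⟩
    exact Ens.nset (by norm_num [NExpr.cost]) ⟨⟨e2.trans (Eqv.setNat _ _ _ _).weaken, h2, h3⟩, by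
      simp [setNat_nat, NExpr.eval]⟩
  have A4 : ∀ s3, ((Eqv [8, 9, 15] [10, 15] s s3 ∧ s3.real 15 0 0 = x ∧
      ∀ b < M + 1, s3.real 10 (M + 1) (b + 1) = (horner G x (M + 1)).coeff b) ∧
      s3.nat 15 0 = 0) →
      Ens (forN 9 (.add (V 17) (.lit 1))
      (.ite (.rlt (.cell 10 (.add (V 17) (.lit 1)) (.add (V 9) (.lit 1))) (.lit 0))
      (.nset 15 (.lit 0) (.lit 1)) .skip)) s3 ((M + 1) * (30 + (4 + 10)) + (4 + 10)) fun s4 =>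
      Eqv [8, 9, 15] [10, 15] s s4 ∧ s4.real 15 0 0 = x ∧
      (s4.nat 15 0 < 1 ↔ ∀ b < M + 1, 0 ≤ (horner G x (M + 1)).coeff b) := by
    rintro s3 ⟨⟨e3, h3, h4⟩, h5⟩
    refine (Ens.forN (N := M + 1) (t := 15 + 14 + 1) (I := fun i s4 => (Eqv [9, 15] [] s3 s4 ∧
      (s4.nat 15 0 < 1 ↔ ∀ b < i, 0 ≤ (horner G x (M + 1)).coeff b)) ∧ s4.nat 9 0 = i)
      ?_ ?_ ?_).mono (le_of_eq (by norm_num [NExpr.cost])) fun s4 h =>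
        ⟨e3.trans h.1.1.weaken, by rw [h.1.1.real 15, h3], h.1.2⟩
    · exact ⟨⟨(Eqv.setNat _ _ _ _).weaken, by simp [setNat_nat, h5]⟩, by simp [setNat_nat]⟩
    · exact fun i s4 h => ⟨h.2, by simp [NExpr.eval, h.1.1.nat 17, e3.nat 17, h17]⟩
    · rintro i hi s4 ⟨⟨e4, h6⟩, h7⟩
      have hev : RExpr.eval s4 (.cell 10 (.add (V 17) (.lit 1)) (.add (V 9) (.lit 1))) =
          (horner G x (M + 1)).coeff i := by
        simp [NExpr.eval, RExpr.eval, e4.nat 17, e3.nat 17, h17, h7, e4.real 10, h4 i hi]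
      refine (Ens.ite (B := 15) (Q := fun s5 => s5.nat 9 0 = i ∧ Eqv [9, 15] [] s3 s5 ∧
        (s5.nat 15 0 < 1 ↔ ∀ b < i + 1, 0 ≤ (horner G x (M + 1)).coeff b))
        (fun hb => ?_) (fun hb => ?_)).mono (by norm_num [Test.cost, RExpr.cost, NExpr.cost])
          fun s5 h => ⟨h.1, ⟨h.2.1.trans (Eqv.setNat _ _ _ _).weaken, ?_⟩, by simp [setNat_nat]⟩
      · rw [Test.Holds, hev] at hb
        simp only [RExpr.eval, Int.cast_zero] at hb
        refine Ens.nset (by norm_num [NExpr.cost]) ⟨by simp [setNat_nat, h7],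
          e4.trans (Eqv.setNat _ _ _ _).weaken, ?_⟩
        simp only [setNat_nat, NExpr.eval, and_self, if_true, lt_irrefl, false_iff]
        intro h
        exact (h i (Nat.lt_succ_self i)).not_gt hb
      · rw [Test.Holds, hev] at hb
        simp only [RExpr.eval, Int.cast_zero, not_lt] at hb
        refine Ens.skip (by norm_num) ⟨h7, e4, ?_⟩
        rw [h6, Nat.forall_lt_succ_right]
        exact ⟨fun h => ⟨h, hb⟩, fun h => h.1⟩
      · simpa [setNat_nat] using h.2.2
  have A5 : ∀ s4, (Eqv [8, 9, 15] [10, 15] s s4 ∧ s4.real 15 0 0 = x ∧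
      (s4.nat 15 0 < 1 ↔ ∀ b < M + 1, 0 ≤ (horner G x (M + 1)).coeff b)) →
      Ens (.ite (.nlt (V 15) (.lit 1)) (.rset 14 (.lit 0) (.lit 0) (RV 15))
        (.rset 13 (.lit 0) (.lit 0) (RV 15))) s4 20 fun s' =>
      Eqv [8, 9, 15] [10, 13, 14, 15] s s' ∧
      (((∀ b < M + 1, 0 ≤ (horner G x (M + 1)).coeff b) ∧
          s'.real 13 0 0 = lo ∧ s'.real 14 0 0 = x) ∨
        ((¬ ∀ b < M + 1, 0 ≤ (horner G x (M + 1)).coeff b) ∧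
          s'.real 13 0 0 = x ∧ s'.real 14 0 0 = hi)) := by
    rintro s4 ⟨e4, h4, h5⟩
    refine (Ens.ite (B := 10) (fun hb => ?_) (fun hb => ?_)).mono
      (by norm_num [Test.cost, NExpr.cost]) fun _ h => h
    · rw [Test.Holds] at hb
      simp only [NExpr.eval] at hb
      refine Ens.rset (by norm_num [NExpr.cost, RExpr.cost])
        ⟨e4.weaken.trans (Eqv.setReal _ _ _ _ _).weaken, .inl ⟨h5.mp hb, ?_, ?_⟩⟩
      · simp [setReal_real, e4.real 13, hlo]
      · simp [setReal_real, NExpr.eval, RExpr.eval, h4]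
    · rw [Test.Holds] at hb
      simp only [NExpr.eval] at hb
      refine Ens.rset (by norm_num [NExpr.cost, RExpr.cost])
        ⟨e4.weaken.trans (Eqv.setReal _ _ _ _ _).weaken, .inr ⟨mt h5.mpr hb, ?_, ?_⟩⟩
      · simp [setReal_real, NExpr.eval, RExpr.eval, h4]
      · simp [setReal_real, e4.real 14, hhi]
  refine (A1.seq fun s1 h1 => (A2 s1 h1).seq fun s2 h2 => (A3 s2 h2).seq fun s3 h3 =>
    (A4 s3 h3).seq fun s4 h4 => A5 s4 h4).mono ?_ fun _ h => h
  have : 0 ≤ (M : ℝ) := by positivity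
  rw [← sub_nonneg]
  ring_nf
  positivity

end ColSubset

/-! ### The approximation of the largest root -/

namespace ColSubset

theorem coeff_negDer (F : ℝ[X]) (a : ℕ) :
    (negDer F).coeff a = (0 - ((a : ℝ) + 1)) * F.coeff (a + 1) := by
  rw [negDer, coeff_neg, coeff_derivative]
  ring

/-- The least `N` satisfies `2 ^ (N - 1) < X ^ 2` unless it is zero, so `N ≤ 1 + 2 log X / log 2`;
the summand `1` is absorbed since `log X ≥ log 2 > 0.69`. -/
theorem exists_bisection_steps {ε h X : ℝ} (hε : 0 < ε) (hX : 2 ≤ X) (hh : h ≤ ε * X ^ 2) :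
    ∃ N : ℕ, h / 2 ^ N ≤ ε ∧ (∀ i < N, ε < h / 2 ^ i) ∧ (N : ℝ) ≤ 5 * Real.log X := by
  have hex : ∃ N : ℕ, h / 2 ^ N ≤ ε := by
    obtain ⟨N, hN⟩ := pow_unbounded_of_one_lt (h / ε) one_lt_two
    refine ⟨N, ?_⟩
    rw [div_le_iff₀ (by positivity), ← div_le_iff₀' hε]
    exact hN.le
  have hlog2 := Real.log_two_gt_d9
  have hlog : Real.log 2 ≤ Real.log X := Real.log_le_log (by norm_num) hX
  classical
  refine ⟨Nat.find hex, Nat.find_spec hex, fun i hi => not_le.mp (Nat.find_min hex hi), ?_⟩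
  rcases hN : Nat.find hex with _ | N
  · rw [Nat.cast_zero]; linarith
  · have h1 : ε < h / 2 ^ N := not_le.mp (Nat.find_min hex (by omega))
    rw [lt_div_iff₀ (by positivity)] at h1
    have h2 : (2 : ℝ) ^ N < X ^ 2 := lt_of_mul_lt_mul_left (h1.trans_le hh) hε.le
    have h3 := Real.log_lt_log (by positivity) h2
    rw [Real.log_pow, Real.log_pow] at h3
    push_cast at h3 ⊢
    nlinarith

/-- The derivatives of the polynomial whose coefficients are in the row `0` of the array `9`. -/
def derivProg : Prog :=
  forN 16 (V 18) (forN 8 (V 4) (.rset 9 (.add (V 16) (.lit 1)) (V 8)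
    (.mul (.sub (.lit 0) (.add (.ofNat (V 8)) (.lit 1))) (.cell 9 (V 16) (.add (V 8) (.lit 1))))))

/-- Each differentiation uses up one coefficient, so row `j` is meaningful only for indices `a` with
`a + j ≤ m`. -/
theorem derivProg_ens {s : Mem} {m κ : ℕ} (h4 : s.nat 4 0 = m) (h18 : s.nat 18 0 = κ)
    {F : ℝ[X]} (hF : ∀ a < m + 1, s.real 9 0 a = F.coeff a) :
    Ens derivProg s (κ * (m * (22 + 12) + 12 + 12) + 12) fun s' => Eqv [8, 16] [9] s s' ∧
      ∀ a, a + κ ≤ m → s'.real 9 κ a = (negDer^[κ] F).coeff a := by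
  refine (Ens.forR (X := [8]) (Y := [9]) (N := κ) (t := m * (22 + 12) + 12)
    (J := fun j r => ∀ a, a + j ≤ m → r 9 j a = (negDer^[j] F).coeff a)
    (fun s3 e3 => ?_) (fun a ha => hF a (by omega)) ?_).mono (le_of_eq (by norm_num [NExpr.cost]))
      fun s3 h => ⟨h.1.weaken, h.2⟩
  · simp [NExpr.eval, e3.nat 18, h18]
  · rintro j hj s1 e1 hv g
    refine (Ens.fill (a := 9) (X := []) (Y := []) (t := 22) (N := m) (fun _ => j + 1)
      (fun b => b) (fun b => (0 - ((b : ℝ) + 1)) * s1.real 9 j (b + 1))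
      (fun s2 e2 => ?_) (by intros; omega) ?_).mono (le_of_eq (by norm_num [NExpr.cost]))
        fun s2 h => ⟨h.1, fun a ha => ?_⟩
    · simp [NExpr.eval, e2.nat 4, e1.nat 4, h4]
    · intro b hb s2 e2 hw hun
      have hv2 : s2.nat 16 0 = j := by rw [e2.nat 16, hv]
      refine Ens.fillBody (by norm_num [NExpr.cost, RExpr.cost]) (by simp [NExpr.eval, hv2])
        (by simp [NExpr.eval, hw]) ?_
      simp only [NExpr.eval, RExpr.eval, hv2, hw]
      rw [hun _ _ (by intros; omega)]
      simp
    · rw [h.2.1 a (by omega), g (a + 1) (by omega), Function.iterate_succ_apply', coeff_negDer]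

/-- The bisection loop. -/
def rootLoop : Prog := .loop (.rlt (RV 1) (.sub (RV 14) (RV 13))) bisectProg

theorem rootLoop_ens {s : Mem} {M κ : ℕ} (h17 : s.nat 17 0 = M) (h18 : s.nat 18 0 = κ)
    {G : ℝ[X]} (hG : ∀ a < M + 1, s.real 9 κ a = G.coeff a) {r ε X h : ℝ}
    (hp : ∀ x, 0 < x → ((∀ b < M + 1, 0 ≤ (horner G x (M + 1)).coeff b) ↔ r ≤ x))
    (h1 : s.real 1 0 0 = ε) (h13 : s.real 13 0 0 = 0) (h14 : s.real 14 0 0 = h)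
    (hr : 0 ≤ r) (hrh : r ≤ h) (hε : 0 < ε) (hX : 2 ≤ X) (hh : h ≤ ε * X ^ 2) :
    Ens rootLoop s (5 * Real.log X * (320 * ((M : ℝ) + 1) ^ 2) + 12) fun s' =>
      Eqv [8, 9, 15] [10, 13, 14, 15] s s' ∧ |s'.real 14 0 0 - r| ≤ ε := by
  obtain ⟨N, hN1, hN2, hN3⟩ := exists_bisection_steps hε hX hh
  refine (Ens.loop (N := N) (t := 300 * ((M : ℝ) + 1) ^ 2) (I := fun i s1 =>
    Eqv [8, 9, 15] [10, 13, 14, 15] s s1 ∧ 0 ≤ s1.real 13 0 0 ∧ s1.real 13 0 0 ≤ r ∧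
      r ≤ s1.real 14 0 0 ∧ s1.real 14 0 0 - s1.real 13 0 0 = h / 2 ^ i) ?_ ?_ ?_).mono ?_ ?_
  · rintro i hi s1 ⟨e1, k1, k2, k3, k4⟩
    have hlt := hN2 i hi
    refine ⟨?_, ?_⟩
    · simp only [Test.Holds, RExpr.eval, NExpr.eval, k4, e1.real 1, h1]
      exact hlt
    · refine (bisectProg_ens (M := M) (κ := κ) (G := G) (by rw [e1.nat 17, h17]) (by rw [e1.nat 18, h18])
        (by rw [e1.real 9]; exact hG) rfl rfl rfl).mono le_rfl fun s2 ⟨e2, k5⟩ => ⟨e1.trans e2, ?_⟩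
      -- The criterion needs a positive midpoint: the interval lies in `[0, ∞)` and is longer than
      -- `ε`.
      rw [hp _ (by linarith)] at k5
      rw [pow_succ, ← div_div, ← k4]
      rcases k5 with ⟨k5, k6, k7⟩ | ⟨k5, k6, k7⟩
      · rw [k6, k7]
        exact ⟨k1, k2, k5, by ring⟩
      · rw [k6, k7]
        exact ⟨by linarith, by linarith, k3, by ring⟩
  · rintro s1 ⟨e1, k1, k2, k3, k4⟩
    simp only [Test.Holds, RExpr.eval, NExpr.eval, k4, e1.real 1, h1, not_lt]
    exact hN1
  · exact ⟨Eqv.refl _ _ _, h13.ge, by rw [h13]; exact hr, by rw [h14]; exact hrh, by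
      rw [h13, h14]; simp⟩
  · have e : ((Test.rlt (RV 1) (.sub (RV 14) (RV 13))).cost : ℝ) = 11 := by
      norm_num [Test.cost, RExpr.cost, NExpr.cost]
    rw [e]
    have hM : (1 : ℝ) ≤ ((M : ℝ) + 1) ^ 2 := one_le_pow₀ (by linarith [Nat.cast_nonneg (α := ℝ) M])
    have : (N : ℝ) * (300 * ((M : ℝ) + 1) ^ 2 + 11 + 1) ≤
        5 * Real.log X * (320 * ((M : ℝ) + 1) ^ 2) :=
      mul_le_mul hN3 (by linarith) (by positivity) ((Nat.cast_nonneg N).trans hN3)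
    linarith
  · rintro s1 ⟨e1, k1, k2, k3, k4⟩
    refine ⟨e1, ?_⟩
    -- The upper end is returned; it is at least `r` and exceeds it by at most the length of the
    -- interval.
    rw [abs_of_nonneg (by linarith)]
    linarith

/-- An approximation of the largest root, for the column `i`. -/
def rootProg : Prog :=
  .seq (forN 8 (.add (V 4) (.lit 1)) (.ite (.rlt (.lit 0) (.cell 7 (V 6) (.lit 0)))
    (.rset 9 (.lit 0) (V 8) (.cell 7 (V 6) (V 8)))
    (.rset 9 (.lit 0) (V 8) (.cell 8 (V 8) (.lit 0))))) <|
  .seq derivProg <|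
  .seq (.rset 13 (.lit 0) (.lit 0) (.lit 0)) <|
  .seq (.rset 14 (.lit 0) (.lit 0) (.sub (.lit 0) (.cell 8 (.lit 1) (.lit 0)))) <|
  .seq rootLoop <|
  .rset 2 (V 5) (V 6) (RV 14)

/-- The bisection starts on `[0, tr M]`, the trace being minus the first coefficient of `charpolyRev
M`. The `κ ≤ m` derivatives take `O(m²)`, and so does each of the `O(log X)` tests. -/
theorem rootProg_ens {s : Mem} {m κ l i : ℕ} (hm : 0 < m) (hκ : κ ≤ m) (h4 : s.nat 4 0 = m)
    (h5 : s.nat 5 0 = l) (h6 : s.nat 6 0 = i) (h17 : s.nat 17 0 = m - κ) (h18 : s.nat 18 0 = κ)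
    {F : ℝ[X]} (hF : ∀ a < m + 1,
      (if 0 < s.real 7 i 0 then s.real 7 i a else s.real 8 a 0) = F.coeff a) {r ε X : ℝ}
    (hp : ∀ x, 0 < x → ((∀ b < m - κ + 1,
      0 ≤ (horner (negDer^[κ] F) x (m - κ + 1)).coeff b) ↔ r ≤ x))
    (h1 : s.real 1 0 0 = ε) (hr : 0 ≤ r) (hrh : r ≤ 0 - s.real 8 1 0) (hε : 0 < ε) (hX : 2 ≤ X)
    (hh : 0 - s.real 8 1 0 ≤ ε * X ^ 2) :
    Ens rootProg s (8000 * ((m : ℝ) ^ 2 * Real.log X)) fun s' =>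
      Eqv [8, 9, 15, 16] [2, 9, 10, 13, 14, 15] s s' ∧ |s'.real 2 l i - r| ≤ ε ∧
      ∀ x y, ¬ (x = l ∧ y = i) → s'.real 2 x y = s.real 2 x y := by
  have A1 : Ens (forN 8 (.add (V 4) (.lit 1)) (.ite (.rlt (.lit 0) (.cell 7 (V 6) (.lit 0)))
      (.rset 9 (.lit 0) (V 8) (.cell 7 (V 6) (V 8)))
      (.rset 9 (.lit 0) (V 8) (.cell 8 (V 8) (.lit 0))))) s
      ((m + 1) * (20 + (4 + 10)) + (4 + 10)) fun s1 => Eqv [8] [9] s s1 ∧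
      ∀ a < m + 1, s1.real 9 0 a = F.coeff a := by
    refine (Ens.fill (a := 9) (X := []) (Y := []) (t := 20) (N := m + 1) (fun _ => 0) (fun a => a)
      (fun a => F.coeff a) (fun s2 e2 => ?_) (by intros; omega) ?_).mono
        (le_of_eq (by norm_num [NExpr.cost])) fun s2 h => ⟨h.1, h.2.1⟩
    · simp [NExpr.eval, e2.nat 4, h4]
    · intro a ha s1 e1 hv _
      have ht : (Test.rlt (.lit 0) (.cell 7 (V 6) (.lit 0))).Holds s1 ↔ 0 < s.real 7 i 0 := by
        simp [Test.Holds, RExpr.eval, NExpr.eval, e1.nat 6, h6, e1.real 7]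
      refine (Ens.ite (B := 12) (fun hb => ?_) (fun hb => ?_)).mono
        (by norm_num [Test.cost, RExpr.cost, NExpr.cost]) fun _ h => h
      · refine Ens.fillBody (by norm_num [NExpr.cost, RExpr.cost]) (by simp [NExpr.eval])
          (by simp [NExpr.eval, hv]) ?_
        rw [← hF a ha, if_pos (ht.mp hb)]
        simp [NExpr.eval, RExpr.eval, hv, e1.nat 6, h6, e1.real 7]
      · refine Ens.fillBody (by norm_num [NExpr.cost, RExpr.cost]) (by simp [NExpr.eval])
          (by simp [NExpr.eval, hv]) ?_
        rw [← hF a ha, if_neg (mt ht.mpr hb)]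
        simp [NExpr.eval, RExpr.eval, hv, e1.real 8]
  have A2 : ∀ s1, (Eqv [8] [9] s s1 ∧ ∀ a < m + 1, s1.real 9 0 a = F.coeff a) →
      Ens derivProg s1 (κ * (m * (22 + 12) + 12 + 12) + 12) fun s2 => Eqv [8, 16] [9, 13, 14] s s2 ∧
      ∀ a < m - κ + 1, s2.real 9 κ a = (negDer^[κ] F).coeff a := by
    rintro s1 ⟨e1, g⟩
    exact (derivProg_ens (by rw [e1.nat 4, h4]) (by rw [e1.nat 18, h18]) g).mono le_rfl
      fun s2 h => ⟨e1.weaken.trans h.1.weaken, fun a ha => h.2 a (by omega)⟩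
  have A3 : ∀ s2, (Eqv [8, 16] [9, 13, 14] s s2 ∧
      ∀ a < m - κ + 1, s2.real 9 κ a = (negDer^[κ] F).coeff a) →
      Ens (.rset 13 (.lit 0) (.lit 0) (.lit 0)) s2 4 fun s3 => Eqv [8, 16] [9, 13, 14] s s3 ∧
      (∀ a < m - κ + 1, s3.real 9 κ a = (negDer^[κ] F).coeff a) ∧ s3.real 13 0 0 = 0 := by
    rintro s2 ⟨e2, g⟩
    exact Ens.rset (by norm_num [NExpr.cost, RExpr.cost])
      ⟨e2.trans (Eqv.setReal _ _ _ _ _).weaken, by simpa [setReal_real] using g,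
        by simp [setReal_real, NExpr.eval, RExpr.eval]⟩
  have A4 : ∀ s3, (Eqv [8, 16] [9, 13, 14] s s3 ∧
      (∀ a < m - κ + 1, s3.real 9 κ a = (negDer^[κ] F).coeff a) ∧ s3.real 13 0 0 = 0) →
      Ens (.rset 14 (.lit 0) (.lit 0) (.sub (.lit 0) (.cell 8 (.lit 1) (.lit 0)))) s3 8 fun s4 =>
      Eqv [8, 16] [9, 13, 14] s s4 ∧
      (∀ a < m - κ + 1, s4.real 9 κ a = (negDer^[κ] F).coeff a) ∧ s4.real 13 0 0 = 0 ∧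
      s4.real 14 0 0 = 0 - s.real 8 1 0 := by
    rintro s3 ⟨e3, g, k⟩
    exact Ens.rset (by norm_num [NExpr.cost, RExpr.cost])
      ⟨e3.trans (Eqv.setReal _ _ _ _ _).weaken, by simpa [setReal_real] using g,
        by simpa [setReal_real] using k,
        by simp [setReal_real, NExpr.eval, RExpr.eval, e3.real 8]⟩
  have A5 : ∀ s4, (Eqv [8, 16] [9, 13, 14] s s4 ∧
      (∀ a < m - κ + 1, s4.real 9 κ a = (negDer^[κ] F).coeff a) ∧ s4.real 13 0 0 = 0 ∧
      s4.real 14 0 0 = 0 - s.real 8 1 0) →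
      Ens rootLoop s4 (5 * Real.log X * (320 * (((m - κ : ℕ) : ℝ) + 1) ^ 2) + 12) fun s5 =>
      Eqv [8, 9, 15, 16] [9, 10, 13, 14, 15] s s5 ∧ |s5.real 14 0 0 - r| ≤ ε := by
    rintro s4 ⟨e4, g, k, k'⟩
    exact (rootLoop_ens (by rw [e4.nat 17, h17]) (by rw [e4.nat 18, h18]) g hp
      (by rw [e4.real 1, h1]) k k' hr hrh hε hX hh).mono le_rfl fun s5 h =>
        ⟨e4.weaken.trans h.1.weaken, h.2⟩
  have A6 : ∀ s5, (Eqv [8, 9, 15, 16] [9, 10, 13, 14, 15] s s5 ∧ |s5.real 14 0 0 - r| ≤ ε) →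
      Ens (.rset 2 (V 5) (V 6) (RV 14)) s5 8 fun s' =>
      Eqv [8, 9, 15, 16] [2, 9, 10, 13, 14, 15] s s' ∧ |s'.real 2 l i - r| ≤ ε ∧
      ∀ x y, ¬ (x = l ∧ y = i) → s'.real 2 x y = s.real 2 x y := by
    rintro s5 ⟨e5, g⟩
    have e5' : NExpr.eval s5 (V 5) = l := by simp [NExpr.eval, e5.nat 5, h5]
    have e6' : NExpr.eval s5 (V 6) = i := by simp [NExpr.eval, e5.nat 6, h6]
    refine Ens.rset (by norm_num [NExpr.cost, RExpr.cost])
      ⟨e5.weaken.trans (Eqv.setReal _ _ _ _ _).weaken, ?_, fun x y hxy => ?_⟩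
    · rw [e5', e6']
      simpa [setReal_real, NExpr.eval, RExpr.eval] using g
    · rw [e5', e6', setReal_real, if_neg (by tauto), e5.real 2]
  refine (A1.seq fun s1 k1 => (A2 s1 k1).seq fun s2 k2 => (A3 s2 k2).seq fun s3 k3 =>
    (A4 s3 k3).seq fun s4 k4 => (A5 s4 k4).seq fun s5 k5 => A6 s5 k5).mono ?_ fun _ h => h
  have hm1 : (1 : ℝ) ≤ m := by exact_mod_cast hm
  have hκ' : (κ : ℝ) ≤ m := by exact_mod_cast hκ
  have hlog2 := Real.log_two_gt_d9
  have hlog : Real.log 2 ≤ Real.log X := Real.log_le_log (by norm_num) hX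
  have b1 : (κ : ℝ) * (m * (22 + 12) + 12 + 12) ≤ m * (m * (22 + 12) + 12 + 12) :=
    mul_le_mul_of_nonneg_right hκ' (by positivity)
  have b2 : (((m - κ : ℕ) : ℝ) + 1) ^ 2 ≤ (2 * (m : ℝ)) ^ 2 := by
    refine pow_le_pow_left₀ (by positivity) ?_ 2
    have : ((m - κ : ℕ) : ℝ) ≤ m := by exact_mod_cast Nat.sub_le m κ
    linarith
  have b3 : 5 * Real.log X * (320 * (((m - κ : ℕ) : ℝ) + 1) ^ 2) ≤
      5 * Real.log X * (320 * (2 * (m : ℝ)) ^ 2) :=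
    mul_le_mul_of_nonneg_left (by linarith) (by linarith)
  have b4 : (m : ℝ) ^ 2 * 0.6 ≤ (m : ℝ) ^ 2 * Real.log X :=
    mul_le_mul_of_nonneg_left (by linarith) (by positivity)
  have b5 : (m : ℝ) ≤ (m : ℝ) ^ 2 := by nlinarith
  linarith

end ColSubset

/-! ### Minimization and elimination -/

namespace ColSubset

/-- The minimization over the columns that have not been chosen. -/
def argminProg : Prog :=
  .seq (.nset 14 (.lit 0) (.lit 0)) <|
  forN 6 (V 1) (.ite (.nlt (.cell 12 (V 6)) (.lit 1))
    (.ite (.nlt (V 14) (.lit 1)) (.seq (.nset 14 (.lit 0) (.lit 1)) (.nset 13 (.lit 0) (V 6)))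
      (.ite (.rlt (.cell 2 (V 5) (V 6)) (.cell 2 (V 5) (V 13))) (.nset 13 (.lit 0) (V 6)) .skip))
    .skip)

/-- The flag in variable `14` tells whether a candidate has been met; before that, variable `13` has
no meaning. -/
theorem argminProg_ens {s : Mem} {d l : ℕ} (h1 : s.nat 1 0 = d) (h5 : s.nat 5 0 = l)
    (hex : ∃ i < d, s.nat 12 i < 1) :
    Ens argminProg s (100 * (d : ℝ)) fun s' => Eqv [6, 13, 14] [] s s' ∧ ∃ jb < d,
      s'.nat 13 0 = jb ∧ s.nat 12 jb < 1 ∧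
      ∀ i < d, s.nat 12 i < 1 → s.real 2 l jb ≤ s.real 2 l i := by
  have A1 : Ens (.nset 14 (.lit 0) (.lit 0)) s 3 fun s1 => Eqv [6, 13, 14] [] s s1 ∧
      s1.nat 14 0 = 0 :=
    Ens.nset (by norm_num [NExpr.cost]) ⟨(Eqv.setNat _ _ _ _).weaken, by
      simp [setNat_nat, NExpr.eval]⟩
  refine (A1.seq fun s1 ⟨e1, h14⟩ => (Ens.forN (N := d) (t := 40) (I := fun i s2 =>
    (Eqv [6, 13, 14] [] s s2 ∧ ((s2.nat 14 0 = 0 ∧ ∀ i' < i, ¬ s.nat 12 i' < 1) ∨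
      (s2.nat 14 0 = 1 ∧ s2.nat 13 0 < i ∧ s.nat 12 (s2.nat 13 0) < 1 ∧ ∀ i' < i,
        s.nat 12 i' < 1 → s.real 2 l (s2.nat 13 0) ≤ s.real 2 l i'))) ∧ s2.nat 6 0 = i)
      ?_ ?_ ?_).mono le_rfl fun s2 ⟨⟨e2, h2⟩, _⟩ => ⟨e2, ?_⟩).mono ?_ fun _ h => h
  · exact ⟨⟨e1.trans (Eqv.setNat _ _ _ _).weaken, .inl ⟨by simp [setNat_nat, h14], by simp⟩⟩, by
      simp [setNat_nat]⟩
  · exact fun i s2 h => ⟨h.2, by simp [NExpr.eval, h.1.1.nat 1, h1]⟩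
  · rintro i hi s2 ⟨⟨e2, h2⟩, h3⟩
    have t1 : (Test.nlt (.cell 12 (V 6)) (.lit 1)).Holds s2 ↔ s.nat 12 i < 1 := by
      simp [Test.Holds, NExpr.eval, h3, e2.nat 12]
    have t2 : (Test.nlt (V 14) (.lit 1)).Holds s2 ↔ s2.nat 14 0 < 1 := by
      simp [Test.Holds, NExpr.eval]
    have t3 : (Test.rlt (.cell 2 (V 5) (V 6)) (.cell 2 (V 5) (V 13))).Holds s2 ↔
        s.real 2 l i < s.real 2 l (s2.nat 13 0) := by
      simp [Test.Holds, NExpr.eval, RExpr.eval, h3, e2.real 2, e2.nat 5, h5]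
    suffices H : Ens (.ite (.nlt (.cell 12 (V 6)) (.lit 1))
        (.ite (.nlt (V 14) (.lit 1)) (.seq (.nset 14 (.lit 0) (.lit 1)) (.nset 13 (.lit 0) (V 6)))
        (.ite (.rlt (.cell 2 (V 5) (V 6)) (.cell 2 (V 5) (V 13))) (.nset 13 (.lit 0) (V 6)) .skip))
        .skip) s2 40 fun s3 => Eqv [6, 13, 14] [] s s3 ∧ s3.nat 6 0 = i ∧
        ((s3.nat 14 0 = 0 ∧ ∀ i' < i + 1, ¬ s.nat 12 i' < 1) ∨
        (s3.nat 14 0 = 1 ∧ s3.nat 13 0 < i + 1 ∧ s.nat 12 (s3.nat 13 0) < 1 ∧ ∀ i' < i + 1,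
        s.nat 12 i' < 1 → s.real 2 l (s3.nat 13 0) ≤ s.real 2 l i')) by
      refine H.mono le_rfl fun s3 h => ⟨h.2.1, ⟨h.1.trans (Eqv.setNat _ _ _ _).weaken, ?_⟩, by
        simp [setNat_nat]⟩
      simpa [setNat_nat] using h.2.2
    refine (Ens.ite (B := 34) (fun b1 => ?_) (fun b1 => ?_)).mono
      (by norm_num [Test.cost, NExpr.cost]) fun _ h => h
    · rw [t1] at b1
      refine (Ens.ite (B := 28) (fun b2 => ?_) (fun b2 => ?_)).mono
        (by norm_num [Test.cost, NExpr.cost]) fun _ h => h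
      · rw [t2] at b2
        refine (Ens.seq (B := 3) (B' := 4) (Q := fun s3 => s3 = s2.setNat 14 0 1)
          (Ens.nset (by norm_num [NExpr.cost]) (by simp [NExpr.eval])) ?_).mono
            (by norm_num) fun _ h => h
        rintro s3 rfl
        refine Ens.nset (by norm_num [NExpr.cost])
          ⟨(e2.trans (Eqv.setNat _ _ _ _).weaken).trans (Eqv.setNat _ _ _ _).weaken, ?_, .inr ?_⟩
        · simp [setNat_nat, h3]
        · simp only [setNat_nat, NExpr.eval, h3]
          refine ⟨by simp, by simp, by simpa using b1, ?_⟩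
          rcases h2 with h2 | h2
          · intro i' hi' hc
            rcases Nat.lt_succ_iff_lt_or_eq.mp hi' with h | rfl
            · exact absurd hc (h2.2 i' h)
            · simp
          · omega
      · rw [t2] at b2
        obtain ⟨k1, k2, k3, k4⟩ := h2.resolve_left (by omega)
        refine (Ens.ite (B := 4) (fun b3 => ?_) (fun b3 => ?_)).mono
          (by norm_num [Test.cost, RExpr.cost, NExpr.cost]) fun _ h => h
        · rw [t3] at b3
          refine Ens.nset (by norm_num [NExpr.cost])
            ⟨e2.trans (Eqv.setNat _ _ _ _).weaken, ?_, .inr ?_⟩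
          · simp [setNat_nat, h3]
          · simp only [setNat_nat, NExpr.eval, h3]
            refine ⟨by simpa using k1, by simp, by simpa using b1, ?_⟩
            intro i' hi' hc
            rcases Nat.lt_succ_iff_lt_or_eq.mp hi' with h | rfl
            · simpa using b3.le.trans (k4 i' h hc)
            · simp
        · rw [t3, not_lt] at b3
          refine Ens.skip (by norm_num) ⟨e2, h3, .inr ⟨k1, by omega, k3, ?_⟩⟩
          intro i' hi' hc
          rcases Nat.lt_succ_iff_lt_or_eq.mp hi' with h | rfl
          · exact k4 i' h hc
          · exact b3
    · rw [t1] at b1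
      refine Ens.skip (by norm_num) ⟨e2, h3, ?_⟩
      rcases h2 with h2 | ⟨k1, k2, k3, k4⟩
      · refine .inl ⟨h2.1, fun i' hi' => ?_⟩
        rcases Nat.lt_succ_iff_lt_or_eq.mp hi' with h | rfl
        · exact h2.2 i' h
        · exact b1
      · refine .inr ⟨k1, by omega, k3, fun i' hi' hc => ?_⟩
        rcases Nat.lt_succ_iff_lt_or_eq.mp hi' with h | rfl
        · exact k4 i' h hc
        · exact absurd hc b1
  · obtain ⟨i, hi, -⟩ := hex
    have : (1 : ℝ) ≤ d := by exact_mod_cast (by omega : 1 ≤ d)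
    norm_num [NExpr.cost]
    linarith
  · obtain ⟨i, hi, hc⟩ := hex
    obtain ⟨-, k2, k3, k4⟩ := h2.resolve_left fun h => h.2 i hi hc
    exact ⟨_, k2, rfl, k3, k4⟩

/-- The elimination of the column that has been chosen. -/
def updateProg : Prog :=
  .ite (.rlt (.lit 0) (.cell 7 (V 13) (.lit 0)))
    (.seq (forN 6 (V 1) (.seq
      (sumN 10 (V 4) 11 (.mul (.cell 4 (V 13) (V 10)) (.cell 3 (V 10) (V 6))))
      (.rset 17 (.lit 0) (V 6) (RV 11)))) <|
    -- The result goes to a separate array first, because column `jb` of `R` is still needed for the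
    -- other columns.
    .seq (forN 8 (V 4) (forN 6 (V 1) (.rset 16 (V 8) (V 6) (.sub (.cell 3 (V 8) (V 6))
      (.div (.mul (.cell 3 (V 8) (V 13)) (.cell 17 (.lit 0) (V 6)))
        (.cell 7 (V 13) (.lit 0))))))) <|
    forN 8 (V 4) (forN 6 (V 1) (.rset 3 (V 8) (V 6) (.cell 16 (V 8) (V 6))))) .skip

/-- The rank-one correction of `M = L R` has its left factor in the range of `L`, as column `jb` of
`M` is `L` times column `jb` of `R`. So `L` may remain unchanged, and the update costs `O(d m)`. -/
theorem updateProg_ens {s : Mem} {m d : ℕ} (hm : 0 < m) (h4 : s.nat 4 0 = m) (h1 : s.nat 1 0 = d)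
    {jb : Fin d} (h13 : s.nat 13 0 = jb) {M : Matrix (Fin d) (Fin d) ℝ}
    (hM : toMat d m (s.real 4) * toMat m d (s.real 3) = M) (h7 : s.real 7 jb 0 = M jb jb)
    (hnn : 0 ≤ M jb jb) :
    Ens updateProg s (500 * (d * (m : ℝ))) fun s' => Eqv [6, 8, 10] [3, 11, 16, 17] s s' ∧
      toMat d m (s'.real 4) * toMat m d (s'.real 3) = schurStep M jb := by
  have hm1 : (1 : ℝ) ≤ m := by exact_mod_cast hm
  have hd1 : (1 : ℝ) ≤ d := by exact_mod_cast jb.pos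
  have ht : (Test.rlt (.lit 0) (.cell 7 (V 13) (.lit 0))).Holds s ↔ 0 < M jb jb := by
    simp [Test.Holds, RExpr.eval, NExpr.eval, h13, h7]
  refine (Ens.ite (B := 450 * (d * (m : ℝ))) (fun hb => ?_) (fun hb => ?_)).mono ?_ fun _ h => h
  · rw [ht] at hb
    have A1 : Ens (forN 6 (V 1) (.seq
        (sumN 10 (V 4) 11 (.mul (.cell 4 (V 13) (V 10)) (.cell 3 (V 10) (V 6))))
        (.rset 17 (.lit 0) (V 6) (RV 11)))) s (d * ((m * 30 + 24) + 12) + 12) fun s1 =>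
        Eqv [6, 8, 10] [11, 16, 17] s s1 ∧ ∀ i < d, s1.real 17 0 i =
          ∑ c ∈ Finset.range m, s.real 4 jb c * s.real 3 c i := by
      refine (Ens.fill (a := 17) (X := [10]) (Y := [11]) (t := m * 30 + 24) (N := d) (fun _ => 0)
        (fun i => i) (fun i => ∑ c ∈ Finset.range m, s.real 4 jb c * s.real 3 c i)
        (fun s2 e2 => ?_) (by intros; omega) ?_).mono (le_of_eq (by norm_num [NExpr.cost]))
          fun s2 h => ⟨h.1.weaken, h.2.1⟩
      · simp [NExpr.eval, e2.nat 1, h1]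
      · intro i hi s1 e1 hv _
        refine (Ens.fillSum (N := m) (x₀ := 0) (y₀ := i) (fun c => s.real 4 jb c * s.real 3 c i)
          (fun s2 e2 => ?_) (fun c hc s2 e2 hc' => ?_) (fun s2 e2 h2 => ?_) ?_).mono le_rfl
            fun s2 h2 => ⟨h2.1, h2.2⟩
        · simp [NExpr.eval, e2.nat 4, e1.nat 4, h4]
        · simp [NExpr.eval, RExpr.eval, e2.real 4, e1.real 4, e2.real 3, e1.real 3, e2.nat 6, hv,
            hc', e2.nat 13, e1.nat 13, h13]
        · simp [NExpr.eval, RExpr.eval, e2.nat 6, hv, h2]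
        · norm_num [NExpr.cost, RExpr.cost]
          linarith
    have A2 : ∀ s1, (Eqv [6, 8, 10] [11, 16, 17] s s1 ∧ ∀ i < d, s1.real 17 0 i =
          ∑ c ∈ Finset.range m, s.real 4 jb c * s.real 3 c i) →
        Ens (forN 8 (V 4) (forN 6 (V 1) (.rset 16 (V 8) (V 6) (.sub (.cell 3 (V 8) (V 6))
        (.div (.mul (.cell 3 (V 8) (V 13)) (.cell 17 (.lit 0) (V 6)))
        (.cell 7 (V 13) (.lit 0))))))) s1 (m * ((d * (40 + 12) + 12) + 12) + 12) fun s2 =>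
        Eqv [6, 8, 10] [11, 16, 17] s s2 ∧ ∀ a < m, ∀ i < d, s2.real 16 a i =
          s.real 3 a i - s.real 3 a jb * (∑ c ∈ Finset.range m, s.real 4 jb c * s.real 3 c i) /
            M jb jb := by
      rintro s1 ⟨e1, g⟩
      refine (Ens.fill2 (a := 16) (X := []) (Y := []) (t := 40) (N := m) (N' := d)
        (fun a _ => a) (fun _ b => b) (fun a i => s.real 3 a i - s.real 3 a jb *
          (∑ c ∈ Finset.range m, s.real 4 jb c * s.real 3 c i) / M jb jb)
        (fun s2 e2 => ?_) (by intros; omega) ?_).mono (le_of_eq (by norm_num [NExpr.cost]))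
          fun s2 h => ⟨e1.trans h.1.weaken, h.2.1⟩
      · simp [NExpr.eval, e2.nat 4, h4, e2.nat 1, h1, e1.nat 1, e1.nat 4]
      · intro a _ i hi s2 e2 hv hw _
        exact Ens.fillBody (by norm_num [NExpr.cost, RExpr.cost]) (by simp [NExpr.eval, hv])
          (by simp [NExpr.eval, hw])
          (by simp [NExpr.eval, RExpr.eval, hv, hw, e2.real 3, e1.real 3, e2.nat 13, e1.nat 13,
            h13, e2.real 17, g i hi, e2.real 7, e1.real 7, h7])
    have A3 : ∀ s2, (Eqv [6, 8, 10] [11, 16, 17] s s2 ∧ ∀ a < m, ∀ i < d, s2.real 16 a i =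
          s.real 3 a i - s.real 3 a jb * (∑ c ∈ Finset.range m, s.real 4 jb c * s.real 3 c i) /
            M jb jb) →
        Ens (forN 8 (V 4) (forN 6 (V 1) (.rset 3 (V 8) (V 6) (.cell 16 (V 8) (V 6))))) s2
        (m * ((d * (10 + 12) + 12) + 12) + 12) fun s' => Eqv [6, 8, 10] [3, 11, 16, 17] s s' ∧
        toMat d m (s'.real 4) * toMat m d (s'.real 3) = schurStep M jb := by
      rintro s2 ⟨e2, g⟩
      refine (Ens.fill2 (a := 3) (X := []) (Y := []) (t := 10) (N := m) (N' := d)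
        (fun a _ => a) (fun _ b => b) (fun a i => s2.real 16 a i)
        (fun s3 e3 => ?_) (by intros; omega) ?_).mono (le_of_eq (by norm_num [NExpr.cost]))
          fun s3 h => ⟨e2.weaken.trans h.1.weaken, ?_⟩
      · simp [NExpr.eval, e2.nat 4, h4, e2.nat 1, h1, e3.nat 1, e3.nat 4]
      · intro a _ i hi s3 e3 hv hw _
        exact Ens.fillBody (by norm_num [NExpr.cost, RExpr.cost]) (by simp [NExpr.eval, hv])
          (by simp [NExpr.eval, hw])
          (by simp [NExpr.eval, RExpr.eval, hv, hw, e3.real 16])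
      · have hrow : ∀ a i : Fin d, ∑ c ∈ Finset.range m, s.real 4 a c * s.real 3 c i = M a i := by
          intro a i
          rw [← hM, toMat_mul_apply]
        ext a i
        rw [toMat_mul_apply, h.1.real 4, e2.real 4, schurStep, if_neg hb.ne', Matrix.sub_apply,
          Matrix.smul_apply, vecMulVec_apply, ← hrow a i, ← hrow a jb, smul_eq_mul,
          Finset.sum_mul, Finset.mul_sum, ← Finset.sum_sub_distrib]
        refine Finset.sum_congr rfl fun c hc => ?_
        rw [h.2.1 c (Finset.mem_range.mp hc) i i.2, g c (Finset.mem_range.mp hc) i i.2, hrow]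
        ring
    refine (A1.seq fun s1 k1 => (A2 s1 k1).seq fun s2 k2 => A3 s2 k2).mono ?_ fun _ h => h
    obtain ⟨u, hu⟩ : ∃ u : ℝ, (m : ℝ) = 1 + u := ⟨m - 1, by ring⟩
    obtain ⟨v, hv⟩ : ∃ v : ℝ, (d : ℝ) = 1 + v := ⟨d - 1, by ring⟩
    have hu0 : 0 ≤ u := by linarith
    have hv0 : 0 ≤ v := by linarith
    rw [← sub_nonneg, hu, hv]
    ring_nf
    positivity
  · rw [ht] at hb
    refine Ens.skip (by nlinarith) ⟨Eqv.refl _ _ _, ?_⟩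
    rw [hM, schurStep, if_pos (le_antisymm (not_lt.mp hb) hnn)]
  · norm_num [Test.cost, RExpr.cost, NExpr.cost]
    nlinarith

end ColSubset

/-! ### One iteration of the greedy algorithm -/

namespace ColSubset

section
variable {n d k : ℕ} {A : Matrix (Fin n) (Fin d) ℝ}

/-- If the diagonal entry is zero, the new column changes nothing and the polynomial of `S` itself
is used; otherwise the diagonal entry is the factor `w`. -/
theorem exists_eq_C_mul_charpolyRev_insert (A : Matrix (Fin n) (Fin d) ℝ) (S : Finset (Fin d))
    (i : Fin d) {U : Matrix (Fin d) (Fin d) ℝ} {lam : Fin d → ℝ}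
    (D : Diagonalizes (gram A S) U lam) :
    ∃ w : ℝ, 0 < w ∧ (if 0 < gram A S i i then weighted lam fun a => U i a ^ 2
      else charpolyRev (gram A S)) = C w * charpolyRev (gram A (insert i S)) := by
  rw [gram_insert]
  split_ifs with h
  · exact ⟨_, h, (D.charpolyRev_schurStep h.ne').symm⟩
  · refine ⟨1, one_pos, ?_⟩
    rw [schurStep, if_pos (le_antisymm (not_lt.mp h) (D.apply_self_nonneg i)), map_one, one_mul]

theorem trace_gram_insert_le (A : Matrix (Fin n) (Fin d) ℝ) (S : Finset (Fin d)) (i : Fin d) :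
    (gram A (insert i S)).trace ≤ (gram A S).trace := by
  rw [gram_insert]
  exact trace_schurStep_le (gram_posSemidef A S) i

/-- Approximations of the largest roots, for all the columns that have not been chosen. -/
def rootsProg : Prog :=
  forN 6 (V 1) (.ite (.nlt (.cell 12 (V 6)) (.lit 1)) rootProg .skip)

theorem rootsProg_ens {s : Mem} {m κ l : ℕ} {ε X : ℝ} {S : Finset (Fin d)}
    {U : Matrix (Fin d) (Fin d) ℝ} {lam : Fin d → ℝ} (D : Diagonalizes (gram A S) U lam)
    (hk : k < A.rank) (hS : S.card = l) (hl : l < k) (hm : 0 < m) (hkm : k ≤ m)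
    (hκ : κ = k - l - 1) (hrank : ∀ S : Finset (Fin d), (gram A S).rank ≤ m)
    (h1 : s.nat 1 0 = d) (h4 : s.nat 4 0 = m) (h5 : s.nat 5 0 = l) (h17 : s.nat 17 0 = m - κ)
    (h18 : s.nat 18 0 = κ) (h12 : ∀ i : Fin d, s.nat 12 i < 1 ↔ i ∉ S)
    (h7 : ∀ (i : Fin d), ∀ j < m + 1, s.real 7 i j = (weighted lam fun a => U i a ^ 2).coeff j)
    (h8 : ∀ j < m + 1, s.real 8 j 0 = (charpolyRev (gram A S)).coeff j)
    (he : s.real 1 0 0 = ε) (hε : 0 < ε) (hX : 2 ≤ X) (hh : (gram A S).trace ≤ ε * X ^ 2) :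
    Ens rootsProg s (8100 * (d * ((m : ℝ) ^ 2 * Real.log X))) fun s' =>
      Eqv [6, 8, 9, 15, 16] [2, 9, 10, 13, 14, 15] s s' ∧
      (∀ i : Fin d, i ∉ S → IsApproxMaxRoot (pHat A k (insert i S)) ε (s'.real 2 l i)) ∧
      ∀ x y, x ≠ l → s'.real 2 x y = s.real 2 x y := by
  have hc1 : 0 - s.real 8 1 0 = (gram A S).trace := by
    rw [h8 1 (by omega), coeff_charpolyRev_eq_neg_trace]
    ring
  have hlog2 := Real.log_two_gt_d9
  have hlog : Real.log 2 ≤ Real.log X := Real.log_le_log (by norm_num) hX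
  have hm1 : (1 : ℝ) ≤ m := by exact_mod_cast hm
  have hmX : 0.6 ≤ (m : ℝ) ^ 2 * Real.log X := by
    have := one_le_pow₀ hm1 (n := 2)
    nlinarith
  refine (Ens.forR (X := [8, 9, 15, 16]) (Y := [2, 9, 10, 13, 14, 15]) (N := d)
    (t := 8000 * ((m : ℝ) ^ 2 * Real.log X) + 1 + 7)
    (J := fun i r => (∀ i' : Fin d, (i' : ℕ) < i → i' ∉ S →
      IsApproxMaxRoot (pHat A k (insert i' S)) ε (r 2 l i')) ∧
      ∀ x y, x ≠ l → r 2 x y = s.real 2 x y)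
    (fun s1 e1 => ?_) ⟨fun _ h => absurd h (Nat.not_lt_zero _), fun _ _ _ => rfl⟩ ?_).mono ?_
      fun s1 h => ⟨h.1, fun i => h.2.1 i i.2, h.2.2⟩
  · simp [NExpr.eval, e1.nat 1, h1]
  · rintro i hi s1 e1 hv ⟨g1, g2⟩
    have ht : (Test.nlt (.cell 12 (V 6)) (.lit 1)).Holds s1 ↔ (⟨i, hi⟩ : Fin d) ∉ S := by
      rw [← h12]
      simp [Test.Holds, NExpr.eval, hv, e1.nat 12]
    refine (Ens.ite (B := 8000 * ((m : ℝ) ^ 2 * Real.log X) + 1) (fun hb => ?_)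
      (fun hb => ?_)).mono (by norm_num [Test.cost, NExpr.cost]; linarith) fun _ h => h
    · rw [ht] at hb
      have hS' : (insert ⟨i, hi⟩ S).card = l + 1 := by
        rw [Finset.card_insert_of_notMem hb, hS]
      obtain ⟨r, hr, hr0, hrT⟩ := exists_isGreatest_root hk (S := insert ⟨i, hi⟩ S) (by omega)
      obtain ⟨w, hw, hF⟩ := exists_eq_C_mul_charpolyRev_insert A S ⟨i, hi⟩ D
      have hq0 : s.real 7 i 0 = gram A S ⟨i, hi⟩ ⟨i, hi⟩ := by
        rw [h7 ⟨i, hi⟩ 0 (by omega), ← coeffMat_apply_self, D.coeffMat_zero]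
      refine (rootProg_ens (m := m) (κ := κ) (l := l) (i := i)
        (F := C w * charpolyRev (gram A (insert ⟨i, hi⟩ S))) (r := r) (ε := ε) (X := X) hm (by omega)
        (by rw [e1.nat 4, h4]) (by rw [e1.nat 5, h5]) hv (by rw [e1.nat 17, h17])
        (by rw [e1.nat 18, h18]) ?_ ?_ (by rw [e1.real 1, he]) hr0 ?_ hε hX ?_).mono
          (by linarith) fun s2 ⟨e2, k1, k2⟩ => ⟨e2.weaken, ⟨fun i' hi' hni => ?_,
            fun x y hx => ?_⟩⟩
      · intro a ha
        rw [e1.real 7, e1.real 8, hq0, ← hF, apply_ite (fun p : ℝ[X] => p.coeff a), h8 a ha,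
          h7 ⟨i, hi⟩ a ha]
      · intro x hx
        have := budan_iff_root_le hk (S := insert ⟨i, hi⟩ S) (by omega) hr hw (M := m - κ) ?_ hx
        · rwa [hatRev, ← negDer_iterate_C_mul, hS', show k - (l + 1) = κ by omega] at this
        · rw [natDegree_hatRev, hS', show k - (l + 1) = κ by omega]
          exact Nat.sub_le_sub_right (hrank _) _
      · rw [e1.real 8, hc1]
        -- The trace for `S` serves as upper end for all candidates, since inserting a column does
        -- not increase it.
        exact hrT.trans (trace_gram_insert_le A S _)
      · rw [e1.real 8, hc1]
        exact hh
      · rcases Nat.lt_succ_iff_lt_or_eq.mp hi' with h | rfl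
        · rw [k2 _ _ (by omega)]
          exact g1 i' h hni
        · exact ⟨r, hr, k1⟩
      · rw [k2 _ _ (fun h => hx h.1), g2 x y hx]
    · rw [ht] at hb
      refine Ens.skip (by linarith) ⟨Eqv.refl _ _ _, fun i' hi' hni => ?_, g2⟩
      rcases Nat.lt_succ_iff_lt_or_eq.mp hi' with h | rfl
      · exact g1 i' h hni
      · exact absurd hni hb
  · have hd1 : (1 : ℝ) ≤ d := by exact_mod_cast (rank_pos_of_lt hk)
    norm_num [NExpr.cost]
    have : 0.6 * (d : ℝ) ≤ d * ((m : ℝ) ^ 2 * Real.log X) := by nlinarith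
    linarith

/-- `j` and `μ` record the first `l` iterations of a run of the greedy algorithm. -/
def PartialRun (A : Matrix (Fin n) (Fin d) ℝ) (k : ℕ) (ε : ℝ) (j : Fin k → Fin d)
    (μ : Fin k → Fin d → ℝ) (l : ℕ) : Prop :=
  ∀ l' : Fin k, (l' : ℕ) < l →
    (∀ i ∉ chosen j l', IsApproxMaxRoot (pHat A k (insert i (chosen j l'))) ε (μ l' i)) ∧
    j l' ∉ chosen j l' ∧ ∀ i ∉ chosen j l', μ l' (j l') ≤ μ l' i

theorem PartialRun.isGreedyRun {ε : ℝ} {j : Fin k → Fin d} {μ : Fin k → Fin d → ℝ}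
    (h : PartialRun A k ε j μ k) : IsGreedyRun A k ε j μ :=
  ⟨fun l => (h l l.2).1, fun l => (h l l.2).2.1, fun l => (h l l.2).2.2⟩

theorem chosen_update (j : Fin k → Fin d) (l : Fin k) (x : Fin d) {l' : ℕ} (h : l' ≤ l) :
    chosen (Function.update j l x) l' = chosen j l' := by
  refine Finset.image_congr fun a ha => Function.update_of_ne ?_ _ _
  rintro rfl
  have := (Finset.mem_filter.mp ha).2
  omega

theorem PartialRun.succ {ε : ℝ} {j : Fin k → Fin d} {μ μ' : Fin k → Fin d → ℝ} {l : Fin k}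
    (h : PartialRun A k ε j μ l) (hμ : ∀ l' : Fin k, (l' : ℕ) < l → μ' l' = μ l') {x : Fin d}
    (h1 : ∀ i ∉ chosen j l, IsApproxMaxRoot (pHat A k (insert i (chosen j l))) ε (μ' l i))
    (h2 : x ∉ chosen j l) (h3 : ∀ i ∉ chosen j l, μ' l x ≤ μ' l i) :
    PartialRun A k ε (Function.update j l x) μ' (l + 1) := by
  intro l' hl'
  rw [chosen_update j l x (Nat.lt_succ_iff.mp hl')]
  rcases Nat.lt_succ_iff_lt_or_eq.mp hl' with hlt | heq
  · rw [hμ l' hlt, Function.update_of_ne (by rintro rfl; omega)]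
    exact h l' hlt
  · obtain rfl : l' = l := Fin.ext heq
    rw [Function.update_self]
    exact ⟨h1, h2, h3⟩

/-- The memory before iteration `l`. -/
def State (A : Matrix (Fin n) (Fin d) ℝ) (k m : ℕ) (ε : ℝ) (l : ℕ) (s : Mem) : Prop :=
  (s.nat 1 0 = d ∧ s.nat 2 0 = k ∧ s.nat 4 0 = m ∧ s.real 1 0 0 = ε) ∧
  ∃ j : Fin k → Fin d, (∀ l' : Fin k, (l' : ℕ) < l → s.nat 3 l' = j l') ∧
    PartialRun A k ε j (fun l' i => s.real 2 l' i) l ∧ (chosen j l).card = l ∧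
    (∀ i : Fin d, s.nat 12 i < 1 ↔ i ∉ chosen j l) ∧
    toMat d m (s.real 4) * toMat m d (s.real 3) = gram A (chosen j l)

/-- One iteration. -/
def iterProg (mm : Prog) : Prog :=
  .seq (coeffProg mm) <|
  .seq (.nset 18 (.lit 0) (.sub (.sub (V 2) (V 5)) (.lit 1))) <|
  .seq (.nset 17 (.lit 0) (.sub (V 4) (V 18))) <|
  .seq rootsProg <|
  .seq argminProg <|
  .seq (.nset 3 (V 5) (V 13)) <|
  .seq (.nset 12 (V 13) (.lit 1)) updateProg

theorem iterProg_ens {mm : Prog} {C w : ℝ} (hw : 2 ≤ w) (hC : 0 ≤ C) (hmm : Multiplies mm C w)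
    {s : Mem} {m l : ℕ} {ε X : ℝ} (hk : k < A.rank) (hl : l < k) (hkm : k ≤ m) (hmd : m ≤ d)
    (hrank : ∀ S : Finset (Fin d), (gram A S).rank ≤ m) (hε : 0 < ε) (hX : 2 ≤ X)
    (hh : (Aᵀ * A).trace ≤ ε * X ^ 2) (hs : State A k m ε l s) (h5 : s.nat 5 0 = l) :
    Ens (iterProg mm) s ((8 * C + 20000) * (d * (m : ℝ) ^ w * Real.log X)) fun s' =>
      s'.nat 5 0 = l ∧ State A k m ε (l + 1) s' := by
  obtain ⟨⟨h1, h2, h4, he⟩, j, hj, hrun, hcard, h12, hM⟩ := hs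
  have hm : 0 < m := by omega
  have D := diagonalizes_of_posSemidef (gram_posSemidef A (chosen j l))
  generalize ((gram_posSemidef A (chosen j l)).1.eigenvectorUnitary :
    Matrix (Fin d) (Fin d) ℝ) = U at D
  generalize (gram_posSemidef A (chosen j l)).1.eigenvalues = lam at D
  set S := chosen j l with hS
  set κ := k - l - 1 with hκ
  have A1 := coeffProg_ens hw hC hmm hm hmd h4 h1 D hM
  have A2 : ∀ s1, (Eqv [6, 7, 8, 9, 10, 11, 100] [5, 6, 7, 8, 11, 100, 101] s s1 ∧
      (∀ (i : Fin d), ∀ j < m + 1, s1.real 7 i j = (weighted lam fun a => U i a ^ 2).coeff j) ∧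
      ∀ j < m + 1, s1.real 8 j 0 = (charpolyRev (gram A S)).coeff j) →
      Ens (.nset 18 (.lit 0) (.sub (.sub (V 2) (V 5)) (.lit 1))) s1 9 fun s2 =>
      (Eqv [6, 7, 8, 9, 10, 11, 18, 100] [5, 6, 7, 8, 11, 100, 101] s s2 ∧
      (∀ (i : Fin d), ∀ j < m + 1, s2.real 7 i j = (weighted lam fun a => U i a ^ 2).coeff j) ∧
      ∀ j < m + 1, s2.real 8 j 0 = (charpolyRev (gram A S)).coeff j) ∧ s2.nat 18 0 = κ := by
    rintro s1 ⟨e1, g1, g2⟩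
    exact Ens.nset (by norm_num [NExpr.cost])
      ⟨⟨e1.weaken.trans (Eqv.setNat _ _ _ _).weaken, g1, g2⟩, by
        simp [setNat_nat, NExpr.eval, e1.nat 2, e1.nat 5, h2, h5, hκ]⟩
  have A3 : ∀ s2, ((Eqv [6, 7, 8, 9, 10, 11, 18, 100] [5, 6, 7, 8, 11, 100, 101] s s2 ∧
      (∀ (i : Fin d), ∀ j < m + 1, s2.real 7 i j = (weighted lam fun a => U i a ^ 2).coeff j) ∧
      ∀ j < m + 1, s2.real 8 j 0 = (charpolyRev (gram A S)).coeff j) ∧ s2.nat 18 0 = κ) →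
      Ens (.nset 17 (.lit 0) (.sub (V 4) (V 18))) s2 7 fun s3 =>
      (Eqv [6, 7, 8, 9, 10, 11, 17, 18, 100] [5, 6, 7, 8, 11, 100, 101] s s3 ∧
      (∀ (i : Fin d), ∀ j < m + 1, s3.real 7 i j = (weighted lam fun a => U i a ^ 2).coeff j) ∧
      ∀ j < m + 1, s3.real 8 j 0 = (charpolyRev (gram A S)).coeff j) ∧ s3.nat 18 0 = κ ∧
      s3.nat 17 0 = m - κ := by
    rintro s2 ⟨⟨e2, g1, g2⟩, g3⟩
    exact Ens.nset (by norm_num [NExpr.cost])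
      ⟨⟨e2.weaken.trans (Eqv.setNat _ _ _ _).weaken, g1, g2⟩, by simp [setNat_nat, g3], by
        simp [setNat_nat, NExpr.eval, e2.nat 4, h4, g3]⟩
  have A4 : ∀ s3, ((Eqv [6, 7, 8, 9, 10, 11, 17, 18, 100] [5, 6, 7, 8, 11, 100, 101] s s3 ∧
      (∀ (i : Fin d), ∀ j < m + 1, s3.real 7 i j = (weighted lam fun a => U i a ^ 2).coeff j) ∧
      ∀ j < m + 1, s3.real 8 j 0 = (charpolyRev (gram A S)).coeff j) ∧ s3.nat 18 0 = κ ∧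
      s3.nat 17 0 = m - κ) →
      Ens rootsProg s3 (8100 * (d * ((m : ℝ) ^ 2 * Real.log X))) fun s4 =>
      Eqv [6, 7, 8, 9, 10, 11, 15, 16, 17, 18, 100]
        [2, 5, 6, 7, 8, 9, 10, 11, 13, 14, 15, 100, 101] s s4 ∧
      (∀ i : Fin d, i ∉ S → IsApproxMaxRoot (pHat A k (insert i S)) ε (s4.real 2 l i)) ∧
      (∀ x y, x ≠ l → s4.real 2 x y = s.real 2 x y) ∧
      ∀ i : Fin d, s4.real 7 i 0 = gram A S i i := by
    rintro s3 ⟨⟨e3, g1, g2⟩, g3, g4⟩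
    refine (rootsProg_ens D hk hcard hl hm hkm hκ hrank (by rw [e3.nat 1, h1])
      (by rw [e3.nat 4, h4]) (by rw [e3.nat 5, h5]) g4 g3 (by rw [e3.nat 12]; exact h12) g1 g2
      (by rw [e3.real 1, he]) hε hX ((trace_gram_le A S).trans hh)).mono le_rfl
        fun s4 ⟨e4, k1, k2⟩ => ⟨e3.weaken.trans e4.weaken, k1, ?_, fun i => ?_⟩
    · rwa [e3.real 2] at k2
    · rw [e4.real 7, g1 i 0 (by omega), ← coeffMat_apply_self, D.coeffMat_zero]
  have A5 : ∀ s4, (Eqv [6, 7, 8, 9, 10, 11, 15, 16, 17, 18, 100]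
        [2, 5, 6, 7, 8, 9, 10, 11, 13, 14, 15, 100, 101] s s4 ∧
      (∀ i : Fin d, i ∉ S → IsApproxMaxRoot (pHat A k (insert i S)) ε (s4.real 2 l i)) ∧
      (∀ x y, x ≠ l → s4.real 2 x y = s.real 2 x y) ∧
      ∀ i : Fin d, s4.real 7 i 0 = gram A S i i) →
      Ens argminProg s4 (100 * (d : ℝ)) fun s5 =>
      ∃ x : Fin d, Eqv [6, 7, 8, 9, 10, 11, 13, 14, 15, 16, 17, 18, 100]
        [2, 5, 6, 7, 8, 9, 10, 11, 13, 14, 15, 100, 101] s s5 ∧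
      PartialRun A k ε (Function.update j ⟨l, hl⟩ x) (fun l' i => s5.real 2 l' i) (l + 1) ∧
      x ∉ S ∧ s5.real 7 x 0 = gram A S x x ∧ s5.nat 13 0 = x := by
    rintro s4 ⟨e4, g1, g2, g3⟩
    have hex : ∃ i < d, s4.nat 12 i < 1 := by
      have : S ≠ Finset.univ := by
        intro h
        rw [h, Finset.card_univ, Fintype.card_fin] at hcard
        omega
      obtain ⟨i, hi⟩ := (not_forall.mp (mt Finset.eq_univ_iff_forall.mpr this))
      exact ⟨i, i.2, by rw [e4.nat 12]; exact (h12 i).mpr hi⟩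
    refine (argminProg_ens (l := l) (by rw [e4.nat 1, h1]) (by rw [e4.nat 5, h5]) hex).mono le_rfl
      fun s5 ⟨e5, jb, hjb, k1, k2, k3⟩ => ?_
    rw [e4.nat 12] at k2 k3
    have hx : (⟨jb, hjb⟩ : Fin d) ∉ S := (h12 ⟨jb, hjb⟩).mp k2
    refine ⟨⟨jb, hjb⟩, e4.weaken.trans e5.weaken, ?_, hx, ?_, k1⟩
    · rw [e5.real 2]
      refine PartialRun.succ (l := ⟨l, hl⟩) hrun (fun l' hl' => ?_) g1 hx fun i hi => ?_
      · funext i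
        exact g2 l' i hl'.ne
      · exact k3 i i.2 ((h12 i).mpr hi)
    · rw [e5.real 7]
      exact g3 ⟨jb, hjb⟩
  have A6 : ∀ s5, (∃ x : Fin d, Eqv [6, 7, 8, 9, 10, 11, 13, 14, 15, 16, 17, 18, 100]
        [2, 5, 6, 7, 8, 9, 10, 11, 13, 14, 15, 100, 101] s s5 ∧
      PartialRun A k ε (Function.update j ⟨l, hl⟩ x) (fun l' i => s5.real 2 l' i) (l + 1) ∧
      x ∉ S ∧ s5.real 7 x 0 = gram A S x x ∧ s5.nat 13 0 = x) →
      Ens (.seq (.nset 3 (V 5) (V 13)) <| .seq (.nset 12 (V 13) (.lit 1)) updateProg) s5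
        (5 + (4 + 500 * (d * (m : ℝ)))) fun s' => s'.nat 5 0 = l ∧ State A k m ε (l + 1) s' := by
    rintro s5 ⟨x, e5, g1, g2, g3, g4⟩
    refine (Ens.nset (Q := fun s6 => s6 = s5.setNat 3 l x) (by norm_num [NExpr.cost]) ?_).seq ?_
    · simp [NExpr.eval, e5.nat 5, h5, g4]
    rintro s6 rfl
    refine (Ens.nset (Q := fun s7 => s7 = (s5.setNat 3 l x).setNat 12 x 1)
      (by norm_num [NExpr.cost]) ?_).seq ?_
    · simp [NExpr.eval, setNat_nat, g4]
    rintro s7 rfl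
    refine (updateProg_ens (m := m) (d := d) (jb := x) (M := gram A S) hm ?_ ?_ ?_ ?_ ?_ ?_).mono
      le_rfl fun s8 ⟨e8, k1⟩ => ⟨?_, ⟨⟨?_, ?_, ?_, ?_⟩, Function.update j ⟨l, hl⟩ x, ?_, ?_, ?_, ?_, ?_⟩⟩
    · simp [setNat_nat, e5.nat 4, h4]
    · simp [setNat_nat, e5.nat 1, h1]
    · simp [setNat_nat, g4]
    · simpa [setNat_real, e5.real 4, e5.real 3] using hM
    · simpa [setNat_real] using g3
    · exact D.apply_self_nonneg x
    · simp [e8.nat 5, setNat_nat, e5.nat 5, h5]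
    · simp [e8.nat 1, setNat_nat, e5.nat 1, h1]
    · simp [e8.nat 2, setNat_nat, e5.nat 2, h2]
    · simp [e8.nat 4, setNat_nat, e5.nat 4, h4]
    · simp [e8.real 1, setNat_real, e5.real 1, he]
    · intro l' hl'
      rw [e8.nat 3]
      rcases Nat.lt_succ_iff_lt_or_eq.mp hl' with hlt | heq
      · rw [Function.update_of_ne (by rintro rfl; simp at hlt)]
        simp [setNat_nat, hlt.ne, e5.nat 3, hj l' hlt]
      · obtain rfl : l' = ⟨l, hl⟩ := Fin.ext heq
        simp [setNat_nat]
    · rw [e8.real 2]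
      exact g1
    · have := chosen_succ (Function.update j ⟨l, hl⟩ x) ⟨l, hl⟩
      rw [Function.update_self, chosen_update j ⟨l, hl⟩ x le_rfl] at this
      change chosen _ (l + 1) = insert x S at this
      rw [this, Finset.card_insert_of_notMem g2, hcard]
    · intro i
      have := chosen_succ (Function.update j ⟨l, hl⟩ x) ⟨l, hl⟩
      rw [Function.update_self, chosen_update j ⟨l, hl⟩ x le_rfl] at this
      change chosen _ (l + 1) = insert x S at this
      rw [this, Finset.mem_insert, not_or, e8.nat 12, ← h12, setNat_nat]
      by_cases hix : i = x
      · simp [hix]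
      · have : (i : ℕ) ≠ x := fun h => hix (Fin.ext h)
        simp [hix, this, setNat_nat, e5.nat 12]
    · have := chosen_succ (Function.update j ⟨l, hl⟩ x) ⟨l, hl⟩
      rw [Function.update_self, chosen_update j ⟨l, hl⟩ x le_rfl] at this
      change chosen _ (l + 1) = insert x S at this
      rw [this, gram_insert, k1]
  refine (A1.seq fun s1 k1 => (A2 s1 k1).seq fun s2 k2 => (A3 s2 k2).seq fun s3 k3 =>
    (A4 s3 k3).seq fun s4 k4 => (A5 s4 k4).seq fun s5 k5 => A6 s5 k5).mono ?_ fun _ h => h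
  have hlog2 := Real.log_two_gt_d9
  have hlog : Real.log 2 ≤ Real.log X := Real.log_le_log (by norm_num) hX
  have hm1 : (1 : ℝ) ≤ m := by exact_mod_cast hm
  have hd1 : (1 : ℝ) ≤ d := by exact_mod_cast hm.trans_le hmd
  have hmw : (m : ℝ) ^ 2 ≤ (m : ℝ) ^ w := by
    rw [← Real.rpow_natCast]
    exact Real.rpow_le_rpow_of_exponent_le hm1 (by exact_mod_cast hw)
  have hm2 : (m : ℝ) ≤ (m : ℝ) ^ 2 := by nlinarith
  -- Coefficients cost `O(Y)` and roots `O(d m² log X)`; with `m² ≤ m ^ w` and `log X ≥ 0.6` all is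
  -- `O(Y log X)`.
  set Y := (d : ℝ) * (m : ℝ) ^ w with hY
  have b1 : (d : ℝ) * (m : ℝ) ≤ Y := mul_le_mul_of_nonneg_left (hm2.trans hmw) (by linarith)
  have b2 : (d : ℝ) * 1 ≤ d * m := mul_le_mul_of_nonneg_left hm1 (by linarith)
  have hY0 : 0 ≤ Y := by linarith
  have b3 : (d : ℝ) * ((m : ℝ) ^ 2 * Real.log X) ≤ Y * Real.log X := by
    rw [← mul_assoc]
    exact mul_le_mul_of_nonneg_right (mul_le_mul_of_nonneg_left hmw (by linarith)) (by linarith)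
  have b4 : Y * 0.6 ≤ Y * Real.log X := mul_le_mul_of_nonneg_left (by linarith) hY0
  have b5 : C * (Y * 0.6) ≤ C * (Y * Real.log X) := mul_le_mul_of_nonneg_left b4 hC
  have b6 : 0 ≤ C * Y := mul_nonneg hC hY0
  linarith

end
end ColSubset

/-! ### The greedy algorithm -/

namespace ColSubset

section
variable {n d k : ℕ} {A : Matrix (Fin n) (Fin d) ℝ}

/-- Marks all columns as not chosen. -/
def clearProg : Prog := forN 6 (V 1) (.nset 12 (V 6) (.lit 0))

theorem clearProg_ens {s : Mem} (h1 : s.nat 1 0 = d) :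
    Ens clearProg s (d * (5 + 12) + 12) fun s' => Eqv [6, 12] [] s s' ∧ ∀ i < d, s'.nat 12 i = 0 := by
  refine (Ens.forN (N := d) (t := 5) (I := fun i s1 => (Eqv [6, 12] [] s s1 ∧
    ∀ i' < i, s1.nat 12 i' = 0) ∧ s1.nat 6 0 = i) ?_ ?_ ?_).mono
      (le_of_eq (by norm_num [NExpr.cost])) fun s1 h => h.1
  · exact ⟨⟨(Eqv.setNat _ _ _ _).weaken, by simp⟩, by simp [setNat_nat]⟩
  · exact fun i s1 h => ⟨h.2, by simp [NExpr.eval, h.1.1.nat 1, h1]⟩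
  · rintro i hi s1 ⟨⟨e1, g1⟩, hv⟩
    refine Ens.nset (by norm_num [NExpr.cost]) ⟨by simp [setNat_nat, hv],
      ⟨(e1.trans (Eqv.setNat _ _ _ _).weaken).trans (Eqv.setNat _ _ _ _).weaken, ?_⟩, by
        simp [setNat_nat]⟩
    intro i' hi'
    rcases Nat.lt_succ_iff_lt_or_eq.mp hi' with h | rfl
    · simp [setNat_nat, NExpr.eval, g1 i' h]
    · simp [setNat_nat, NExpr.eval, hv]

/-- The factorization `1 * AᵀA`, for `d < n`. -/
def tallProg : Prog :=
  .seq (.nset 4 (.lit 0) (V 1)) <|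
  .seq (forN 6 (V 1) (forN 8 (V 1) (.rset 4 (V 6) (V 8)
    -- Truncated subtraction makes this the Kronecker delta: `(a - b) + (b - a)` is the distance.
    (.ofNat (.sub (.lit 1) (.add (.sub (V 6) (V 8)) (.sub (V 8) (V 6)))))))) <|
  forN 8 (V 1) (forN 6 (V 1) (.seq
    (sumN 10 (V 0) 11 (.mul (.cell 0 (V 10) (V 8)) (.cell 0 (V 10) (V 6))))
    (.rset 3 (V 8) (V 6) (RV 11))))

theorem tallProg_ens {s : Mem} (hn : 0 < n) (hd : 0 < d) (h0 : s.nat 0 0 = n) (h1 : s.nat 1 0 = d)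
    (hA : s.Stores 0 A) :
    Ens tallProg s (500 * (d * d * (n : ℝ))) fun s' => Eqv [4, 6, 8, 10] [3, 4, 11] s s' ∧
      s'.nat 4 0 = d ∧ toMat d d (s'.real 4) * toMat d d (s'.real 3) = Aᵀ * A := by
  have A1 : Ens (.nset 4 (.lit 0) (V 1)) s 4 fun s1 => Eqv [4, 6, 8, 10] [3, 4, 11] s s1 ∧
      s1.nat 4 0 = d ∧ s1.real 0 = s.real 0 :=
    Ens.nset (by norm_num [NExpr.cost]) ⟨(Eqv.setNat _ _ _ _).weaken, by
      simp [setNat_nat, NExpr.eval, h1], rfl⟩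
  have A2 : ∀ s1, (Eqv [4, 6, 8, 10] [3, 4, 11] s s1 ∧ s1.nat 4 0 = d ∧ s1.real 0 = s.real 0) →
      Ens (forN 6 (V 1) (forN 8 (V 1) (.rset 4 (V 6) (V 8)
        (.ofNat (.sub (.lit 1) (.add (.sub (V 6) (V 8)) (.sub (V 8) (V 6)))))))) s1
        (d * ((d * (19 + 12) + 12) + 12) + 12) fun s2 => Eqv [4, 6, 8, 10] [3, 4, 11] s s2 ∧
        s2.nat 4 0 = d ∧ toMat d d (s2.real 4) = 1 := by
    rintro s1 ⟨e1, g1, g2⟩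
    refine (Ens.fill2 (a := 4) (X := []) (Y := []) (t := 19) (N := d) (N' := d)
      (fun a _ => a) (fun _ b => b) (fun a b => if a = b then 1 else 0)
      (fun s2 e2 => ?_) (by intros; omega) ?_).mono (le_of_eq (by norm_num [NExpr.cost]))
        fun s2 h => ⟨e1.trans h.1.weaken, by simp [h.1.nat 4, g1], ?_⟩
    · simp [NExpr.eval, e2.nat 1, e1.nat 1, h1]
    · intro a _ b _ s2 e2 hv hw _
      refine Ens.fillBody (by norm_num [NExpr.cost, RExpr.cost]) (by simp [NExpr.eval, hv])
        (by simp [NExpr.eval, hw]) ?_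
      simp only [NExpr.eval, RExpr.eval, hv, hw]
      split_ifs with h
      · simp [h]
      · rw [show 1 - (a - b + (b - a)) = 0 by omega, Nat.cast_zero]
    · ext a b
      rw [Matrix.one_apply]
      simp only [toMat, of_apply, h.2.1 a a.2 b b.2, Fin.ext_iff]
  have A3 : ∀ s2, (Eqv [4, 6, 8, 10] [3, 4, 11] s s2 ∧ s2.nat 4 0 = d ∧
        toMat d d (s2.real 4) = 1) →
      Ens (forN 8 (V 1) (forN 6 (V 1) (.seq
        (sumN 10 (V 0) 11 (.mul (.cell 0 (V 10) (V 8)) (.cell 0 (V 10) (V 6))))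
        (.rset 3 (V 8) (V 6) (RV 11))))) s2
        (d * ((d * ((n * 30 + 24) + 12) + 12) + 12) + 12) fun s3 =>
        Eqv [4, 6, 8, 10] [3, 4, 11] s s3 ∧
        s3.nat 4 0 = d ∧ toMat d d (s3.real 4) * toMat d d (s3.real 3) = Aᵀ * A := by
    rintro s2 ⟨e2, g1, g2⟩
    refine (Ens.fill2 (a := 3) (X := [10]) (Y := [11]) (t := n * 30 + 24) (N := d) (N' := d)
      (fun a _ => a) (fun _ b => b) (fun a b => ∑ c ∈ Finset.range n, s.real 0 c a * s.real 0 c b)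
      (fun s3 e3 => ?_) (by intros; omega) ?_).mono (le_of_eq (by norm_num [NExpr.cost]))
        fun s3 h => ⟨e2.trans h.1.weaken, by simp [h.1.nat 4, g1], ?_⟩
    · simp [NExpr.eval, e3.nat 1, e2.nat 1, h1]
    · intro a _ b _ s3 e3 hv hw _
      refine (Ens.fillSum (N := n) (x₀ := a) (y₀ := b) (fun c => s.real 0 c a * s.real 0 c b)
        (fun s4 e4 => ?_) (fun c hc s4 e4 hc' => ?_) (fun s4 e4 h2 => ?_) ?_).mono le_rfl
          fun s4 h2 => ⟨h2.1, h2.2⟩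
      · simp [NExpr.eval, e4.nat 0, e3.nat 0, e2.nat 0, h0]
      · simp [NExpr.eval, RExpr.eval, e4.real 0, e3.real 0, e2.real 0, e4.nat 8, e4.nat 6,
          hv, hw, hc']
      · simp [NExpr.eval, RExpr.eval, e4.nat 8, e4.nat 6, hv, hw, h2]
      · norm_num [NExpr.cost, RExpr.cost]
        linarith
    · rw [h.1.real 4, g2, Matrix.one_mul]
      ext a b
      rw [Matrix.mul_apply]
      simp only [toMat, of_apply, h.2.1 a a.2 b b.2, transpose_apply]
      rw [← Fin.sum_univ_eq_sum_range fun c => s.real 0 c a * s.real 0 c b]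
      exact Finset.sum_congr rfl fun c _ => by rw [hA c a, hA c b]
  refine (A1.seq fun s1 k1 => (A2 s1 k1).seq fun s2 k2 => A3 s2 k2).mono ?_ fun _ h => h
  obtain ⟨u, hu⟩ : ∃ u : ℝ, (n : ℝ) = 1 + u := ⟨n - 1, by ring⟩
  obtain ⟨v, hv⟩ : ∃ v : ℝ, (d : ℝ) = 1 + v := ⟨d - 1, by ring⟩
  have hu0 : 0 ≤ u := by
    have : (1 : ℝ) ≤ n := by exact_mod_cast hn
    linarith
  have hv0 : 0 ≤ v := by
    have : (1 : ℝ) ≤ d := by exact_mod_cast hd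
    linarith
  rw [← sub_nonneg, hu, hv]
  ring_nf
  positivity

/-- The factorization `Aᵀ * A`, for `n ≤ d`. -/
def wideProg : Prog :=
  .seq (.nset 4 (.lit 0) (V 0)) <|
  .seq (forN 6 (V 1) (forN 8 (V 0) (.rset 4 (V 6) (V 8) (.cell 0 (V 8) (V 6))))) <|
  forN 8 (V 0) (forN 6 (V 1) (.rset 3 (V 8) (V 6) (.cell 0 (V 8) (V 6))))

theorem wideProg_ens {s : Mem} (hn : 0 < n) (hd : 0 < d) (h0 : s.nat 0 0 = n) (h1 : s.nat 1 0 = d)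
    (hA : s.Stores 0 A) :
    Ens wideProg s (500 * (d * (n : ℝ))) fun s' => Eqv [4, 6, 8, 10] [3, 4, 11] s s' ∧
      s'.nat 4 0 = n ∧ toMat d n (s'.real 4) * toMat n d (s'.real 3) = Aᵀ * A := by
  have A1 : Ens (.nset 4 (.lit 0) (V 0)) s 4 fun s1 => Eqv [4, 6, 8, 10] [3, 4, 11] s s1 ∧
      s1.nat 4 0 = n :=
    Ens.nset (by norm_num [NExpr.cost]) ⟨(Eqv.setNat _ _ _ _).weaken, by
      simp [setNat_nat, NExpr.eval, h0]⟩
  have A2 : ∀ s1, (Eqv [4, 6, 8, 10] [3, 4, 11] s s1 ∧ s1.nat 4 0 = n) →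
      Ens (forN 6 (V 1) (forN 8 (V 0) (.rset 4 (V 6) (V 8) (.cell 0 (V 8) (V 6))))) s1
        (d * ((n * (10 + 12) + 12) + 12) + 12) fun s2 => Eqv [4, 6, 8, 10] [3, 4, 11] s s2 ∧
        s2.nat 4 0 = n ∧ toMat d n (s2.real 4) = Aᵀ := by
    rintro s1 ⟨e1, g1⟩
    refine (Ens.fill2 (a := 4) (X := []) (Y := []) (t := 10) (N := d) (N' := n)
      (fun a _ => a) (fun _ b => b) (fun a b => s.real 0 b a)
      (fun s2 e2 => ?_) (by intros; omega) ?_).mono (le_of_eq (by norm_num [NExpr.cost]))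
        fun s2 h => ⟨e1.trans h.1.weaken, by simp [h.1.nat 4, g1], ?_⟩
    · simp [NExpr.eval, e2.nat 1, e1.nat 1, h1, e2.nat 0, e1.nat 0, h0]
    · intro a _ b _ s2 e2 hv hw _
      exact Ens.fillBody (by norm_num [NExpr.cost, RExpr.cost]) (by simp [NExpr.eval, hv])
        (by simp [NExpr.eval, hw]) (by
          simp [NExpr.eval, RExpr.eval, hv, hw, e2.real 0, e1.real 0])
    · ext a b
      simp only [toMat, of_apply, h.2.1 a a.2 b b.2, transpose_apply, hA b a]
  have A3 : ∀ s2, (Eqv [4, 6, 8, 10] [3, 4, 11] s s2 ∧ s2.nat 4 0 = n ∧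
        toMat d n (s2.real 4) = Aᵀ) →
      Ens (forN 8 (V 0) (forN 6 (V 1) (.rset 3 (V 8) (V 6) (.cell 0 (V 8) (V 6))))) s2
        (n * ((d * (10 + 12) + 12) + 12) + 12) fun s3 => Eqv [4, 6, 8, 10] [3, 4, 11] s s3 ∧
        s3.nat 4 0 = n ∧ toMat d n (s3.real 4) * toMat n d (s3.real 3) = Aᵀ * A := by
    rintro s2 ⟨e2, g1, g2⟩
    refine (Ens.fill2 (a := 3) (X := []) (Y := []) (t := 10) (N := n) (N' := d)
      (fun a _ => a) (fun _ b => b) (fun a b => s.real 0 a b)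
      (fun s3 e3 => ?_) (by intros; omega) ?_).mono (le_of_eq (by norm_num [NExpr.cost]))
        fun s3 h => ⟨e2.trans h.1.weaken, by simp [h.1.nat 4, g1], ?_⟩
    · simp [NExpr.eval, e3.nat 1, e2.nat 1, h1, e3.nat 0, e2.nat 0, h0]
    · intro a _ b _ s3 e3 hv hw _
      exact Ens.fillBody (by norm_num [NExpr.cost, RExpr.cost]) (by simp [NExpr.eval, hv])
        (by simp [NExpr.eval, hw]) (by
          simp [NExpr.eval, RExpr.eval, hv, hw, e3.real 0, e2.real 0])
    · rw [h.1.real 4, g2]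
      congr 1
      ext a b
      simp only [toMat, of_apply, h.2.1 a a.2 b b.2, hA a b]
  refine (A1.seq fun s1 k1 => (A2 s1 k1).seq fun s2 k2 => A3 s2 k2).mono ?_ fun _ h => h
  obtain ⟨u, hu⟩ : ∃ u : ℝ, (n : ℝ) = 1 + u := ⟨n - 1, by ring⟩
  obtain ⟨v, hv⟩ : ∃ v : ℝ, (d : ℝ) = 1 + v := ⟨d - 1, by ring⟩
  have hu0 : 0 ≤ u := by
    have : (1 : ℝ) ≤ n := by exact_mod_cast hn
    linarith
  have hv0 : 0 ≤ v := by
    have : (1 : ℝ) ≤ d := by exact_mod_cast hd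
    linarith
  rw [← sub_nonneg, hu, hv]
  ring_nf
  positivity

/-- The greedy algorithm. -/
def greedyProg (mm : Prog) : Prog :=
  .seq clearProg <| .seq (.ite (.nlt (V 1) (V 0)) tallProg wideProg) <| forN 5 (V 2) (iterProg mm)

theorem State.zero {s : Mem} {m : ℕ} {ε : ℝ} (hd : 0 < d) (h1 : s.nat 1 0 = d)
    (h2 : s.nat 2 0 = k) (h4 : s.nat 4 0 = m) (he : s.real 1 0 0 = ε)
    (h12 : ∀ i < d, s.nat 12 i = 0) (hM : toMat d m (s.real 4) * toMat m d (s.real 3) = Aᵀ * A) :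
    State A k m ε 0 s := by
  -- The values of `j` are irrelevant before the first iteration; `d > 0` provides one.
  refine ⟨⟨h1, h2, h4, he⟩, fun _ => ⟨0, hd⟩, fun _ h => absurd h (Nat.not_lt_zero _),
    fun _ h => absurd h (Nat.not_lt_zero _), ?_, fun i => ?_, ?_⟩
  · rw [chosen_zero, Finset.card_empty]
  · simp [chosen_zero, h12 i i.2]
  · rw [hM, chosen_zero, gram_empty]

theorem State.setNat {s : Mem} {m l : ℕ} {ε : ℝ} (h : State A k m ε l s) (x : ℕ) :
    State A k m ε l (s.setNat 5 0 x) := by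
  obtain ⟨⟨h1, h2, h4, he⟩, j, hj, hrun, hcard, h12, hM⟩ := h
  exact ⟨⟨by simp [setNat_nat, h1], by simp [setNat_nat, h2], by simp [setNat_nat, h4], he⟩, j,
    fun l' hl' => by simp [setNat_nat, hj l' hl'], hrun, hcard, fun i => by
      simp [setNat_nat, ← h12], hM⟩

theorem rank_gram_le_min (A : Matrix (Fin n) (Fin d) ℝ) (S : Finset (Fin d)) :
    (gram A S).rank ≤ min n d := by
  rw [← transpose_mul_residual]
  refine le_min ?_ ?_
  · exact (rank_mul_le_left _ _).trans (by simpa using rank_le_width Aᵀ)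
  · exact (rank_mul_le_left _ _).trans (by simpa using rank_le_height Aᵀ)

/-- The two shapes of `A` differ only in the initial factorization; afterwards the inner dimension
`m = min n d`, which bounds the ranks of all Gram matrices, governs both. -/
theorem greedyProg_ens {mm : Prog} {C w : ℝ} (hw : 2 ≤ w) (hC : 0 ≤ C) (hmm : Multiplies mm C w)
    {s : Mem} {ε : ℝ} (hk : k < A.rank) (hk0 : 0 < k) (hε : 0 < ε) (hs : s.HasInput A k ε) {m : ℕ}
    (hm : min n d = m) {X : ℝ} (hX : X = max (m : ℝ) (specNorm A ^ 2 / ε)) :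
    Ens (greedyProg mm) s ((if d < n then 600 * (d * d * (n : ℝ)) else 600 * (d * (n : ℝ))) +
        k * ((8 * C + 21000) * (d * (m : ℝ) ^ w * Real.log X))) fun s' => State A k m ε k s' := by
  obtain ⟨h0, h1, h2, hA, he⟩ := hs
  have hrank : ∀ S : Finset (Fin d), (gram A S).rank ≤ m := fun S => hm ▸ rank_gram_le_min A S
  have hrA : A.rank ≤ m := by
    have := rank_gram A ∅
    have := hrank ∅
    simp only [Finset.card_empty] at *
    omega
  have hmd : m ≤ d := by omega
  have hmn : m ≤ n := by omega
  have hm2 : (2 : ℝ) ≤ m := by exact_mod_cast (by omega : 2 ≤ m)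
  have hX2 : 2 ≤ X := by rw [hX]; exact hm2.trans (le_max_left _ _)
  -- One factor `X` dominates the rank, the other dominates `‖A‖²/ε`.
  have hh : (Aᵀ * A).trace ≤ ε * X ^ 2 := by
    have e1 : (m : ℝ) ≤ X := by rw [hX]; exact le_max_left _ _
    have e2 : specNorm A ^ 2 ≤ ε * X := by
      rw [hX, ← div_le_iff₀' hε]
      exact le_max_right _ _
    calc (Aᵀ * A).trace ≤ A.rank * specNorm A ^ 2 := trace_le hk
      _ ≤ X * (ε * X) := by
        refine mul_le_mul (le_trans ?_ e1) e2 (by positivity) (by linarith)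
        exact_mod_cast hrA
      _ = ε * X ^ 2 := by ring
  have A1 := clearProg_ens h1
  have A2 : ∀ s1, (Eqv [6, 12] [] s s1 ∧ ∀ i < d, s1.nat 12 i = 0) →
      Ens (.ite (.nlt (V 1) (V 0)) tallProg wideProg) s1
        ((if d < n then 500 * (d * d * (n : ℝ)) else 500 * (d * (n : ℝ))) + 5 + 1) fun s2 =>
        State A k m ε 0 s2 := by
    rintro s1 ⟨e1, g⟩
    have hA1 : s1.Stores 0 A := by rw [Mem.Stores, e1.real 0]; exact hA
    have ht : (Test.nlt (V 1) (V 0)).Holds s1 ↔ d < n := by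
      simp [Test.Holds, NExpr.eval, e1.nat 0, e1.nat 1, h0, h1]
    have hd0 : 0 < d := by omega
    refine (Ens.ite (B := if d < n then 500 * (d * d * (n : ℝ)) else 500 * (d * (n : ℝ)))
      (fun hb => ?_) (fun hb => ?_)).mono (by norm_num [Test.cost, NExpr.cost]) fun _ h => h
    · rw [ht] at hb
      obtain rfl : d = m := by omega
      rw [if_pos hb]
      refine (tallProg_ens (by omega) hd0 (by rw [e1.nat 0, h0]) (by rw [e1.nat 1, h1]) hA1).mono
        le_rfl fun s2 ⟨e2, k1, k2⟩ => ?_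
      exact State.zero hd0 (by rw [e2.nat 1, e1.nat 1, h1]) (by rw [e2.nat 2, e1.nat 2, h2]) k1
        (by rw [e2.real 1, e1.real 1, he]) (by rw [e2.nat 12]; exact g) k2
    · rw [ht] at hb
      obtain rfl : n = m := by omega
      rw [if_neg hb]
      refine (wideProg_ens (by omega) hd0 (by rw [e1.nat 0, h0]) (by rw [e1.nat 1, h1]) hA1).mono
        le_rfl fun s2 ⟨e2, k1, k2⟩ => ?_
      exact State.zero hd0 (by rw [e2.nat 1, e1.nat 1, h1]) (by rw [e2.nat 2, e1.nat 2, h2]) k1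
        (by rw [e2.real 1, e1.real 1, he]) (by rw [e2.nat 12]; exact g) k2
  have A3 : ∀ s2, State A k m ε 0 s2 → Ens (forN 5 (V 2) (iterProg mm)) s2
      (k * ((8 * C + 20000) * (d * (m : ℝ) ^ w * Real.log X) + 12) + 12)
      fun s' => State A k m ε k s' := by
    intro s2 hs2
    refine (Ens.forN (N := k) (t := (8 * C + 20000) * (d * (m : ℝ) ^ w * Real.log X))
      (I := fun l s3 => State A k m ε l s3 ∧ s3.nat 5 0 = l) ?_ ?_ ?_).mono
        (le_of_eq (by norm_num [NExpr.cost])) fun s3 h => h.1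
    · exact ⟨hs2.setNat 0, by simp [setNat_nat]⟩
    · rintro l s3 ⟨h3, h5⟩
      exact ⟨h5, by simp [NExpr.eval, h3.1.2.1]⟩
    · rintro l hl s3 ⟨h3, h5⟩
      refine (iterProg_ens hw hC hmm hk hl (by omega) hmd hrank hε hX2 hh h3 h5).mono le_rfl
        fun s4 h4 => ⟨h4.1, h4.2.setNat _, by simp [setNat_nat]⟩
  refine (A1.seq fun s1 k1 => (A2 s1 k1).seq fun s2 k2 => A3 s2 k2).mono ?_ fun _ h => h
  have hlog2 := Real.log_two_gt_d9
  have hlog : Real.log 2 ≤ Real.log X := Real.log_le_log (by norm_num) hX2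
  have hd1 : (2 : ℝ) ≤ d := hm2.trans (by exact_mod_cast hmd)
  have hn1 : (2 : ℝ) ≤ n := hm2.trans (by exact_mod_cast hmn)
  have hk1 : (1 : ℝ) ≤ k := by exact_mod_cast hk0
  have hmw : 1 ≤ (m : ℝ) ^ w := Real.one_le_rpow (by linarith) (by linarith)
  have b1 : 1 ≤ (d : ℝ) * (m : ℝ) ^ w * Real.log X := by
    have : 2 * 1 ≤ (d : ℝ) * (m : ℝ) ^ w := mul_le_mul hd1 hmw (by norm_num) (by linarith)
    nlinarith
  have b2 : (k : ℝ) * 1 ≤ k * ((d : ℝ) * (m : ℝ) ^ w * Real.log X) :=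
    mul_le_mul_of_nonneg_left b1 (by linarith)
  have b3 : (d : ℝ) * 2 ≤ d * n := mul_le_mul_of_nonneg_left hn1 (by linarith)
  have b4 : 2 * ((d : ℝ) * n) ≤ d * (d * n) := mul_le_mul_of_nonneg_right hd1 (by positivity)
  split_ifs <;> linarith

theorem State.executesGreedy {mm : Prog} {s s' : Mem} {m T : ℕ} {ε : ℝ} (h : State A k m ε k s')
    (hT : (greedyProg mm).Runs s T s') : (greedyProg mm).ExecutesGreedy s A k ε T := by
  obtain ⟨-, j, hj, hrun, -⟩ := h
  exact ⟨s', j, fun l i => s'.real 2 l i, hT, hrun.isGreedyRun, fun l => hj l l.2, fun _ _ => rfl⟩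

theorem exists_greedyProg {w : ℝ} (hw : 2 < w) (h : MatMulExponent w) :
    ∃ (P : Prog) (C : ℝ), ∀ (n d : ℕ) (A : Matrix (Fin n) (Fin d) ℝ) (k : ℕ) (ε : ℝ),
      k < A.rank → 0 < k → 0 < ε → ∀ s : Mem, s.HasInput A k ε →
        ∃ T : ℕ, P.ExecutesGreedy s A k ε T ∧
          (d < n → (T : ℝ) ≤ C * (k * d * (n : ℝ) ^ 2 + k * (d : ℝ) ^ (w + 1) *
            Real.log (max (d : ℝ) (specNorm A ^ 2 / ε)))) ∧
          (n ≤ d → (T : ℝ) ≤ C * (k * d * (n : ℝ) ^ w *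
            Real.log (max (n : ℝ) (specNorm A ^ 2 / ε)))) := by
  obtain ⟨mm, C, hC, hmm⟩ := h.exists_multiplies
  refine ⟨greedyProg mm, 8 * C + 22000, fun n d A k ε hk hk0 hε s hs => ?_⟩
  obtain ⟨T, s', hT, hB, hst⟩ := greedyProg_ens hw.le hC hmm hk hk0 hε hs rfl rfl
  refine ⟨T, hst.executesGreedy hT, fun hdn => hB.trans ?_, fun hnd => hB.trans ?_⟩
  all_goals
    have hrA : A.rank ≤ min n d := by
      have := rank_gram A ∅
      have := rank_gram_le_min A ∅
      simp only [Finset.card_empty] at *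
      omega
    have hk1 : (1 : ℝ) ≤ k := by exact_mod_cast hk0
    have hlog2 := Real.log_two_gt_d9
  · rw [if_pos hdn, min_eq_right hdn.le]
    have hd : (2 : ℝ) ≤ d := by exact_mod_cast (by omega : 2 ≤ d)
    have hlog : Real.log 2 ≤ Real.log (max (d : ℝ) (specNorm A ^ 2 / ε)) :=
      Real.log_le_log (by norm_num) (hd.trans (le_max_left _ _))
    generalize Real.log (max (d : ℝ) (specNorm A ^ 2 / ε)) = Λ at hlog
    have e : (d : ℝ) ^ (w + 1) = d * (d : ℝ) ^ w := by
      rw [Real.rpow_add_one (by linarith), mul_comm]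
    have hdn' : (d : ℝ) ≤ n := by exact_mod_cast hdn.le
    -- The single computation of `AᵀA` costs `d² n`, which `d ≤ n` and `k ≥ 1` bring under `k d n²`.
    have b1 : (d : ℝ) * d * n ≤ k * d * (n : ℝ) ^ 2 := by
      have b2 : (d : ℝ) * d * n ≤ d * n * n := by gcongr
      have b3 : 1 * ((d : ℝ) * n * n) ≤ k * (d * n * n) :=
        mul_le_mul_of_nonneg_right hk1 (by positivity)
      linarith
    have b4 : 0 ≤ (k : ℝ) * (d * (d : ℝ) ^ w * Λ) := by
      have : 0 ≤ Λ := by linarith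
      positivity
    have b5 : 0 ≤ C * ((k : ℝ) * d * (n : ℝ) ^ 2) := by positivity
    have b6 : 0 ≤ (k : ℝ) * d * (n : ℝ) ^ 2 := by positivity
    rw [e]
    linarith
  · rw [if_neg (by omega), min_eq_left hnd]
    have hn : (2 : ℝ) ≤ n := by exact_mod_cast (by omega : 2 ≤ n)
    have hlog : Real.log 2 ≤ Real.log (max (n : ℝ) (specNorm A ^ 2 / ε)) :=
      Real.log_le_log (by norm_num) (hn.trans (le_max_left _ _))
    generalize Real.log (max (n : ℝ) (specNorm A ^ 2 / ε)) = Λ at hlog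
    have hnw : (n : ℝ) ≤ (n : ℝ) ^ w := by
      conv_lhs => rw [← Real.rpow_one (n : ℝ)]
      exact Real.rpow_le_rpow_of_exponent_le (by linarith) (by linarith)
    have b1 : (d : ℝ) * n * 0.6 ≤ d * (n : ℝ) ^ w * Λ :=
      mul_le_mul (mul_le_mul_of_nonneg_left hnw (by positivity)) (by linarith) (by norm_num)
        (by positivity)
    have b2 : 0 ≤ (d : ℝ) * (n : ℝ) ^ w * Λ := le_trans (by positivity) b1
    have b3 : 1 * ((d : ℝ) * (n : ℝ) ^ w * Λ) ≤ k * (d * (n : ℝ) ^ w * Λ) :=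
      mul_le_mul_of_nonneg_right hk1 b2
    linarith

end
end ColSubset

theorem theorem1p2 :
    -- Every run of the algorithm outputs a set of `k` columns that satisfies the bound.
    (∀ (n d : ℕ) (A : Matrix (Fin n) (Fin d) ℝ) (k : ℕ) (ε : ℝ),
      ColSubset.lamLast A < ColSubset.lamFirst A →
      ColSubset.beta A * A.rank ≤ k → k < A.rank → 0 < ε →
      ∀ (j : Fin k → Fin d) (μ : Fin k → Fin d → ℝ), ColSubset.IsGreedyRun A k ε j μ →
        (Finset.univ.image j).card = k ∧
        ColSubset.specNorm (ColSubset.residual A (Finset.univ.image j)) ^ 2 ≤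
          2 * k * ε + ColSubset.specNorm A ^ 2 /
            (1 + (ColSubset.specNorm A ^ 2 * ColSubset.alphaInv A - 1) * ColSubset.gamma A k)) ∧
    -- One program executes the algorithm within the stated time.
    (∀ w : ℝ, 2 < w → ColSubset.MatMulExponent w →
      ∃ (P : ColSubset.Prog) (C : ℝ),
        ∀ (n d : ℕ) (A : Matrix (Fin n) (Fin d) ℝ) (k : ℕ) (ε : ℝ),
        ColSubset.lamLast A < ColSubset.lamFirst A →
        ColSubset.beta A * A.rank ≤ k → k < A.rank → 0 < ε →
        ∀ s : ColSubset.Mem, s.HasInput A k ε →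
          ∃ T : ℕ, P.ExecutesGreedy s A k ε T ∧
            (d < n → (T : ℝ) ≤ C * (k * d * (n : ℝ) ^ 2 + k * (d : ℝ) ^ (w + 1) *
              Real.log (max (d : ℝ) (ColSubset.specNorm A ^ 2 / ε)))) ∧
            (n ≤ d → (T : ℝ) ≤ C * (k * d * (n : ℝ) ^ w *
              Real.log (max (n : ℝ) (ColSubset.specNorm A ^ 2 / ε))))) := by
  refine ⟨fun n d A k ε h hβ hk hε j μ hrun => ColSubset.greedy_bound h hβ hk hε hrun,
    fun w hw hmm => ?_⟩
  obtain ⟨P, C, hP⟩ := ColSubset.exists_greedyProg hw hmm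
  exact ⟨P, C, fun n d A k ε h hβ hk hε s hs =>
    hP n d A k ε hk (ColSubset.pos_of_beta_le hk h hβ) hε s hs⟩
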